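/- Consider the system $$s_t = s_{xx} - f(s) + u^m,\quad x\in(0,\pi),\ t>0,\qquad s(0,t)=s(\pi,t)=0,$$ where $f:\mathbb R\to\mathbb R$ is odd, locally Lipschitz and nondecreasing (in particular, strictly increasing and unbounded $f$ are allowed), and $m\in(0,1]$. For $r<0$ the power $r^m$ is understood either as $|r|^m$ or as $-|r|^m$, with one fixed choice; the theorem holds for both (for $m=1$ the second choice gives $u^m=u$). The state space is $X=H^1_0(0,\pi)$ with norm $\|s\|_X=(\int_0^\pi s_x^2\,dx)^{1/2}$, the input space is $C(\mathbb R_+,L_2(0,\pi))$ with the sup-norm $\|u\|_{U_c}=\sup_{t\ge0}\|u(t)\|_{L_2}$ (estimates involving $\|u\|_{U_c}$ are claimed for inputs with $\|u\|_{U_c}<\infty$). A solution on $[0,T)$, $0<T\le\infty$, is a function $s\in C([0,T),H^1_0(0,\pi))$ with $s(0)=s_0$ such that for all $t\in[0,T)$ and all $\psi\in C_c^\infty(0,\pi)$ $$\int_0^\pi s(t)\psi\,dx=\int_0^\pi s_0\psi\,dx+\int_0^t\int_0^\pi\big(-s_x\psi'+(-f(s)+u^m)\psi\big)\,dx\,d\tau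 .$$ Then for every $s_0\in X$ and every $u\in C(\mathbb R_+,L_2(0,\pi))$ there is a solution $\phi(\cdot,s_0,u)$ on $[0,\infty)$, and every solution on an interval $[0,T)$ with the same data coincides there with $\phi(\cdot,s_0,u)$. The map $\phi$ is the transition map of a time-invariant control system (identity, causality, continuity in time and semigroup property), and: 1. The system is input-to-state stable: there are $\beta\in\mathcal{KL}$ and $\gamma\in\mathcal K$ with $\|\phi(t,s_0,u)\|_X\le\beta(\|s_0\|_X,t)+\gamma(\|u\|_{U_c})$ for all $t\ge0$, $s_0\in X$ and all inputs $u$ with $\|u\|_{U_c}<\infty$. 2. For every $a>1$, the function $$V(s)=\int_0^\pi\Big(\tfrac12 s_x(x)^2+\int_0^{s(x)}f(y)\,dy\Big)dx$$ is an ISS-Lyapunov function of the system with ISS-Lyapunov gain $\chi(r)=a\,\pi^{(1-m)/2}r^m$. That is, $V$ is continuous on $X$, $\chi\in\mathcal K$, there are $\psi_1,\psi_2\in\mathcal K_\infty$ with $\psi_1(\|s\|_X)\le V(s)\le\psi_2(\|s\|_X)$ for all $s \in X$, and there is a continuous positive definite $\alpha:\mathbb R_+\to\mathbb R_+$ such that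 for all $s \in X$ and all inputs $u$ with $\|u\|_{U_c}<\infty$ $$\|s\|_X\ge\chi(\|u\|_{U_c})\ \Rightarrow\ \dot V_u(s)\le-\alpha(\|s\|_X),\qquad \dot V_u(s):=\limsup_{t\to+0}\tfrac1t\big(V(\phi(t,s,u))-V(s)\big)\in[-\infty,\infty].$$ Moreover, for all $s\in X$ and all $u\in C(\mathbb R_+,L_2(0,\pi))$, if $\chi(\|u(0)\|_{L_2})\le\|s\|_X$, then $\dot V_u(s)\le\big(\tfrac1a-1\big)\|s\|_X^2$. Here $\mathcal K$ is the class of continuous strictly increasing $\gamma:\mathbb R_+\to\mathbb R_+$ with $\gamma(0)=0$; $\mathcal K_\infty$ consists of the unbounded elements of $\mathcal K$; and $\beta:\mathbb R_+^2\to\mathbb R_+$ belongs to $\mathcal{KL}$ if $\beta(\cdot,t)\in\mathcal K$ for all $t\ge0$ and $\beta(r,\cdot)$ is continuous and strictly decreasing to $0$ for all $r>0$. -/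

import Mathlib

open Set Filter Topology MeasureTheory
open scoped NNReal ENNReal

noncomputable section

/-! ### Comparison functions -/

/-- Class `K`: continuous, strictly increasing, zero at zero. -/
structure IsClassK (γ : ℝ≥0 → ℝ≥0) : Prop where
  continuous : Continuous γ
  strictMono : StrictMono γ
  map_zero : γ 0 = 0

/-- Class `K∞`: unbounded class `K` functions. -/
structure IsClassKInf (γ : ℝ≥0 → ℝ≥0) : Prop extends IsClassK γ where
  unbounded : ∀ M : ℝ≥0, ∃ r, M < γ r

/-- Class `L`: continuous, decreasing, with limit zero at infinity. -/
structure IsClassL (γ : ℝ≥0 → ℝ≥0) : Prop where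
  continuous : Continuous γ
  strictAnti : StrictAnti γ
  tendsto_zero : Tendsto γ atTop (𝓝 0)

/-- Class `KL`. -/
structure IsClassKL (β : ℝ≥0 → ℝ≥0 → ℝ≥0) : Prop where
  left : ∀ t, IsClassK (fun r => β r t)
  right : ∀ r, 0 < r → IsClassL (fun t => β r t)

/-- Positive definite functions on `[0, ∞)`. -/
structure IsPosDefFun (α : ℝ≥0 → ℝ≥0) : Prop where
  continuous : Continuous α
  map_zero : α 0 = 0
  pos : ∀ r, 0 < r → 0 < α r

/-! ### Control systems with continuous inputs -/

section ControlSystems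

variable {X U : Type*} [NormedAddCommGroup X] [NormedAddCommGroup U]

/-- The sup-norm of a continuous input; it is `⊤` exactly for unbounded inputs. -/
def inputNorm (u : C(ℝ≥0, U)) : ℝ≥0∞ := ⨆ t, ‖u t‖ₑ

/-- The input `τ ↦ u (τ + r)`. -/
def shiftInput (r : ℝ≥0) (u : C(ℝ≥0, U)) : C(ℝ≥0, U) :=
  u.comp ⟨fun τ => τ + r, by fun_prop⟩

/-- The axioms of a time-invariant control system with state space `X`, input space
`C(ℝ₊, U)` and transition map `φ t x u` (the state at time `t` of the trajectory that starts in
`x` at time `0` under the input `u`). The map `φ` is total, so all trajectories exist for all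
nonnegative times. -/
structure IsControlSystem (φ : ℝ≥0 → X → C(ℝ≥0, U) → X) : Prop where
  identity : ∀ x u, φ 0 x u = x
  causality : ∀ t x u v, (∀ τ, τ ≤ t → u τ = v τ) → φ t x u = φ t x v
  continuity : ∀ x u, Continuous (fun t => φ t x u)
  semigroup : ∀ t r x u, φ (r + t) x u = φ t (φ r x u) (shiftInput r u)

/-- Input-to-state stability, inputs being measured in the sup-norm. -/
def IsISS (φ : ℝ≥0 → X → C(ℝ≥0, U) → X) : Prop :=
  ∃ (β : ℝ≥0 → ℝ≥0 → ℝ≥0) (γ : ℝ≥0 → ℝ≥0), IsClassKL β ∧ IsClassK γ ∧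
    ∀ (x : X) (u : C(ℝ≥0, U)), inputNorm u ≠ ⊤ → ∀ t,
      ‖φ t x u‖₊ ≤ β ‖x‖₊ t + γ (inputNorm u).toNNReal

/-- The Lie derivative `limsup_{t → 0+} (V (φ t x u) - V x) / t` of `V` along `φ`. It is an
extended real number, since it may be infinite. -/
def lieDeriv (φ : ℝ≥0 → X → C(ℝ≥0, U) → X) (V : X → ℝ) (x : X) (u : C(ℝ≥0, U)) : EReal :=
  limsup (fun t : ℝ≥0 => (((V (φ t x u) - V x) / (t : ℝ) : ℝ) : EReal)) (𝓝[>] 0)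

/-- `V` is an ISS-Lyapunov function of `φ` with ISS-Lyapunov gain `χ`. -/
def IsISSLyapunovFunction (φ : ℝ≥0 → X → C(ℝ≥0, U) → X) (V : X → ℝ) (χ : ℝ≥0 → ℝ≥0) : Prop :=
  Continuous V ∧ IsClassK χ ∧
  (∃ ψ₁ ψ₂ : ℝ≥0 → ℝ≥0, IsClassKInf ψ₁ ∧ IsClassKInf ψ₂ ∧
    ∀ x, (ψ₁ ‖x‖₊ : ℝ) ≤ V x ∧ V x ≤ ψ₂ ‖x‖₊) ∧
  ∃ α : ℝ≥0 → ℝ≥0, IsPosDefFun α ∧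
    ∀ (x : X) (u : C(ℝ≥0, U)), inputNorm u ≠ ⊤ → χ (inputNorm u).toNNReal ≤ ‖x‖₊ →
      lieDeriv φ V x u ≤ ((-(α ‖x‖₊ : ℝ) : ℝ) : EReal)

end ControlSystems

/-! ### The spaces `L₂(0, π)` and `H¹₀(0, π)` -/

/-- The real Hilbert space `L₂(0, π)`. -/
abbrev L2pi : Type := Lp ℝ 2 (volume.restrict (Ioo 0 Real.pi))

/-- `C^k` functions with compact support in `(0, π)`; `k = ⊤` means smooth. -/
structure IsTestFun (k : ℕ∞) (ψ : ℝ → ℝ) : Prop where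
  contDiff : ContDiff ℝ k ψ
  hasCompactSupport : HasCompactSupport ψ
  tsupport_subset : tsupport ψ ⊆ Ioo 0 Real.pi

/-- The pairs `(ψ, ψ')`, where `ψ` is a `C¹` function with compact support in `(0, π)`. -/
def testGraph : Submodule ℝ (L2pi × L2pi) where
  carrier := {p | ∃ ψ : ℝ → ℝ, IsTestFun 1 ψ ∧
    p.1 =ᵐ[volume.restrict (Ioo 0 Real.pi)] ψ ∧
    p.2 =ᵐ[volume.restrict (Ioo 0 Real.pi)] deriv ψ}
  zero_mem' := by
    refine ⟨fun _ => 0, ⟨contDiff_const, HasCompactSupport.zero, ?_⟩, ?_, ?_⟩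
    · have : tsupport (fun _ : ℝ => (0 : ℝ)) = ∅ := tsupport_eq_empty_iff.2 rfl
      simp [this]
    · exact Lp.coeFn_zero _ _ _
    · filter_upwards [Lp.coeFn_zero ℝ 2 (volume.restrict (Ioo 0 Real.pi))] with x hx
      simpa using hx
  add_mem' := by
    rintro p q ⟨ψ, hψ, h1, h2⟩ ⟨η, hη, h3, h4⟩
    refine ⟨ψ + η, ⟨hψ.1.add hη.1, hψ.2.add hη.2, ?_⟩, ?_, ?_⟩
    · exact (tsupport_add ψ η).trans (union_subset hψ.3 hη.3)
    · filter_upwards [Lp.coeFn_add p.1 q.1, h1, h3] with x hx hx1 hx3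
      rw [Prod.fst_add, hx, Pi.add_apply, Pi.add_apply, hx1, hx3]
    · filter_upwards [Lp.coeFn_add p.2 q.2, h2, h4] with x hx hx2 hx4
      rw [Prod.snd_add, hx, Pi.add_apply, hx2, hx4,
        deriv_add (hψ.1.differentiable (by simp) x) (hη.1.differentiable (by simp) x)]
  smul_mem' := by
    rintro c p ⟨ψ, hψ, h1, h2⟩
    refine ⟨c • ψ, ⟨hψ.1.const_smul c, hψ.2.smul_left (f := fun _ => c), ?_⟩, ?_, ?_⟩
    · exact (closure_mono (Function.support_const_smul_subset c ψ)).trans hψ.3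
    · filter_upwards [Lp.coeFn_smul c p.1, h1] with x hx hx1
      rw [Prod.smul_fst, hx, Pi.smul_apply, Pi.smul_apply, hx1]
    · filter_upwards [Lp.coeFn_smul c p.2, h2] with x hx hx2
      rw [Prod.smul_snd, hx, Pi.smul_apply, hx2,
        deriv_const_smul c (hψ.1.differentiable (by simp) x)]

/-- The Sobolev space `H¹₀(0, π)`, the closure of the `C¹` functions with compact support in
`(0, π)` with respect to the `W^{1,2}`-norm. An element is stored as the pair of the function and
of its weak derivative. -/
def H10 : Type := testGraph.topologicalClosure

namespace H10

instance : AddCommGroup H10 := inferInstanceAs (AddCommGroup testGraph.topologicalClosure)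

instance : Module ℝ H10 := inferInstanceAs (Module ℝ testGraph.topologicalClosure)

/-- An element of `H¹₀(0, π)` as an element of `L₂(0, π)`. -/
def toL2 : H10 →ₗ[ℝ] L2pi := LinearMap.fst ℝ L2pi L2pi ∘ₗ testGraph.topologicalClosure.subtype

/-- The weak derivative of an element of `H¹₀(0, π)`. -/
def dx : H10 →ₗ[ℝ] L2pi := LinearMap.snd ℝ L2pi L2pi ∘ₗ testGraph.topologicalClosure.subtype

/-- A Friedrichs inequality, which makes `‖∂s/∂x‖_{L₂}` a norm. -/
theorem norm_toL2_le : ∃ C : ℝ, ∀ s : H10, ‖toL2 s‖ ≤ C * ‖dx s‖ := by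
  set μ : Measure ℝ := volume.restrict (Ioo 0 Real.pi) with hμ
  let one : L2pi := MemLp.toLp (fun _ => (1 : ℝ)) (memLp_const 1)
  let κ : ℝ := (measureUnivNNReal μ : ℝ) ^ ((2 : ℝ≥0∞).toReal)⁻¹
  refine ⟨κ * ‖one‖, fun s => ?_⟩
  suffices h : ∀ p ∈ testGraph.topologicalClosure, ‖p.1‖ ≤ κ * ‖one‖ * ‖p.2‖ from h s.1 s.2
  have hcl : IsClosed {p : L2pi × L2pi | ‖p.1‖ ≤ κ * ‖one‖ * ‖p.2‖} :=
    isClosed_le (by fun_prop) (by fun_prop)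
  refine fun p hp => hcl.closure_subset_iff.2 ?_ hp
  rintro p ⟨ψ, hψ, h1, h2⟩
  have hsup : ∀ᵐ x ∂μ, ‖p.1 x‖ ≤ ‖one‖ * ‖p.2‖ := by
    filter_upwards [h1, ae_restrict_mem measurableSet_Ioo] with x hx hx0
    have hd : Continuous (deriv ψ) := hψ.1.continuous_deriv (by simp)
    have hzero : ψ 0 = 0 := by
      by_contra hne
      exact absurd (hψ.3 (subset_tsupport ψ hne)).1 (lt_irrefl _)
    have hftc : ∫ y in (0 : ℝ)..x, deriv ψ y = ψ x := by
      rw [intervalIntegral.integral_deriv_eq_sub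
        (fun y _ => hψ.1.differentiable (by simp) y) (hd.intervalIntegrable _ _), hzero, sub_zero]
    have habs : |ψ x| ≤ ∫ y in Ioo 0 Real.pi, |deriv ψ y| := by
      rw [← hftc, intervalIntegral.integral_of_le hx0.1.le]
      refine (abs_integral_le_integral_abs).trans ?_
      refine setIntegral_mono_set ?_ (Eventually.of_forall fun _ => abs_nonneg _) ?_
      · exact (hd.abs.integrableOn_Icc (a := 0) (b := Real.pi)).mono_set Ioo_subset_Icc_self
      · exact LE.le.eventuallyLE fun y hy => ⟨hy.1, hy.2.trans_lt hx0.2⟩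
    have hinner : ∫ y in Ioo 0 Real.pi, |deriv ψ y| = inner ℝ one |p.2| := by
      rw [L2.inner_def]
      refine integral_congr_ae ?_
      filter_upwards [MemLp.coeFn_toLp (μ := μ) (p := 2) (memLp_const (1 : ℝ)), Lp.coeFn_abs p.2,
        h2] with y hy1 hy2 hy3
      rw [hy2, hy3]
      change _ = inner ℝ ((MemLp.toLp (μ := μ) (fun _ => (1 : ℝ)) (memLp_const 1)) y) _
      rw [hy1]
      simp
    rw [hx, Real.norm_eq_abs]
    refine habs.trans (hinner.le.trans ((real_inner_le_norm _ _).trans ?_))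
    rw [norm_abs_eq_norm]
  have := Lp.norm_le_of_ae_bound (by positivity) hsup
  simpa [κ, μ, mul_assoc] using this

theorem dx_injective : Function.Injective dx := by
  obtain ⟨C, hC⟩ := norm_toL2_le
  rw [← LinearMap.ker_eq_bot, LinearMap.ker_eq_bot']
  intro s hs
  have h1 : toL2 s = 0 := by
    have := hC s
    rw [hs, norm_zero, mul_zero] at this
    exact norm_le_zero_iff.1 this
  exact Subtype.ext (Prod.ext h1 hs)

/-- `H¹₀(0, π)` carries the norm `‖s‖ = ‖∂s/∂x‖_{L₂}`. -/
instance : NormedAddCommGroup H10 := NormedAddCommGroup.induced H10 L2pi dx dx_injective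

instance : NormedSpace ℝ H10 := NormedSpace.induced ℝ H10 L2pi dx

end H10

/-! ### The parabolic system -/

/-- The power `r ^ m` on the whole real line: `r ^ m` for `r ≥ 0` and `σ |r| ^ m` for `r < 0`, where
`σ = 1` or `σ = -1`. So `σ = -1` is the odd power, which is `r` itself for `m = 1`, and `σ = 1` is
`|r| ^ m`. -/
def signedPower (σ m r : ℝ) : ℝ := if 0 ≤ r then r ^ m else σ * |r| ^ m

/-- `s` is a weak solution on `[0, T)` of `s_t = s_xx - f(s) + u^m` on `(0, π)` with homogeneous
Dirichlet boundary conditions and initial state `s₀`: it is a continuous curve in `H¹₀(0, π)` that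
satisfies the equation integrated in time and tested with functions in `C_c^∞(0, π)`. The boundary
conditions are part of `H¹₀`. -/
structure IsWeakSolution (f : ℝ → ℝ) (σ m : ℝ) (T : ℝ≥0∞) (s₀ : H10) (u : C(ℝ≥0, L2pi))
    (s : ℝ≥0 → H10) : Prop where
  continuousOn : ContinuousOn s {t | (t : ℝ≥0∞) < T}
  initial : s 0 = s₀
  equation : ∀ t : ℝ≥0, (t : ℝ≥0∞) < T → ∀ ψ : ℝ → ℝ, IsTestFun ⊤ ψ →
    ∫ x in Ioo 0 Real.pi, H10.toL2 (s t) x * ψ x =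
      (∫ x in Ioo 0 Real.pi, H10.toL2 s₀ x * ψ x) +
      ∫ τ in (0 : ℝ)..t, ∫ x in Ioo 0 Real.pi,
        (-(H10.dx (s τ.toNNReal) x * deriv ψ x)
          + (-f (H10.toL2 (s τ.toNNReal) x) + signedPower σ m (u τ.toNNReal x)) * ψ x)

/-- `V(s) = ∫₀^π (½ (∂s/∂x)² + ∫₀^{s(x)} f(y) dy) dx`. -/
def energy (f : ℝ → ℝ) (s : H10) : ℝ :=
  ∫ x in Ioo 0 Real.pi, ((1 / 2) * (H10.dx s x) ^ 2 + ∫ y in (0 : ℝ)..(H10.toL2 s x), f y)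

/-- The gain `χ(r) = a π^{(1 - m)/2} r^m`. -/
def gain (a : ℝ≥0) (m : ℝ) (r : ℝ≥0) : ℝ≥0 := a * NNReal.pi ^ ((1 - m) / 2) * r ^ m

end

open scoped RealInnerProductSpace

noncomputable section


/-! Write the equation as s' = -A s + g - N(s), where A = -d²/dx² with Dirichlet conditions, g =
u^m, and N(s) = f ∘ s is the L₂-gradient of the convex functional Φ(s) = ∫∫₀^s f. The energy is V =
‖s‖²/2 + Φ(s), with ‖·‖ the H¹₀ norm. Formally, with w = A s + N(s), one has s' = g - w and V' = ⟨w,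
g - w⟩ ≤ ‖w‖(‖g‖ - ‖w‖) in L₂. Testing w with s gives ‖w‖‖s‖ ≥ ⟨w, s⟩ = ‖s‖² + ⟨N(s), s⟩ ≥ ‖s‖²,
because N(s)s ≥ 0 and the L₂ norm is at most the H¹₀ norm. Hence ‖w‖ ≥ ‖s‖, and V' is at most the
supremum of ω(‖g‖ - ω) over ω ≥ ‖s‖. This supremum is `dissipation`; unlike w, it makes sense and is
continuous for every state in H¹₀.

The inequality is made rigorous by projecting a solution to finitely many sine modes, where
everything is differentiable, and letting the number of modes grow (`DiagonalEmbedding.energy_le`).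
The abstract setting needs only an embedding that is diagonal in two Hilbert bases; the sines
provide them (`diagonalEmbedding_toL2L`).

Everything else rests on this inequality. With N = 0 it bounds linear flows by their force, which
yields existence for linear problems, a contraction for globally Lipschitz N, and uniqueness through
Gronwall's lemma. For merely locally Lipschitz f, the energy bounds the sup-norm a priori on bounded
time intervals, so cutting f off at a large enough level changes nothing (`exists_isFlow`). Weak
solutions are the same as flows in coordinates, since smooth test functions and sines both span
dense subspaces of H¹₀.

Jensen's inequality gives ‖u^m‖ ≤ π^((1-m)/2)‖u‖^m (`norm_powerL2_le`). So ‖s‖ ≥ χ(‖u‖) means ‖g‖ ≤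
‖s‖/a, and then the dissipation is ‖s‖(‖g‖ - ‖s‖) ≤ (1/a - 1)‖s‖². For the ISS estimate, take a = 2:
above a level of V fixed by the input, V decays exponentially at a rate depending on the initial
norm, and V cannot climb back above that level (`IsSolutionMap.norm_le`). -/

section


/-! ### Partial sums of Hilbert basis expansions -/

namespace HilbertBasis

variable {E : Type*} [NormedAddCommGroup E] [InnerProductSpace ℝ E]

/-- The orthogonal projection onto the span of the first `n` basis vectors. -/
def trunc (b : HilbertBasis ℕ ℝ E) (n : ℕ) : E →L[ℝ] E :=
  ∑ k ∈ Finset.range n, (innerSL ℝ (b k)).smulRight (b k)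

theorem trunc_apply (b : HilbertBasis ℕ ℝ E) (n : ℕ) (x : E) :
    b.trunc n x = ∑ k ∈ Finset.range n, ⟪b k, x⟫ • b k := by
  simp [trunc]

theorem inner_sum_smul_left (b : HilbertBasis ℕ ℝ E) (n : ℕ) (c : ℕ → ℝ) (y : E) :
    ⟪∑ k ∈ Finset.range n, c k • b k, y⟫ = ∑ k ∈ Finset.range n, c k * ⟪b k, y⟫ := by
  simp [sum_inner, real_inner_smul_left]

theorem inner_sum_smul_right (b : HilbertBasis ℕ ℝ E) (n : ℕ) (c : ℕ → ℝ) (k : ℕ) :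
    ⟪b k, ∑ j ∈ Finset.range n, c j • b j⟫ = if k < n then c k else 0 := by
  classical
  simp [inner_sum, real_inner_smul_right, orthonormal_iff_ite.1 b.orthonormal k]

theorem norm_sq_sum_smul (b : HilbertBasis ℕ ℝ E) (n : ℕ) (c : ℕ → ℝ) :
    ‖∑ k ∈ Finset.range n, c k • b k‖ ^ 2 = ∑ k ∈ Finset.range n, c k ^ 2 := by
  rw [← real_inner_self_eq_norm_sq, inner_sum_smul_left]
  refine Finset.sum_congr rfl fun k hk => ?_
  rw [inner_sum_smul_right, if_pos (Finset.mem_range.1 hk), sq]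

theorem inner_trunc (b : HilbertBasis ℕ ℝ E) (n : ℕ) (x : E) (k : ℕ) :
    ⟪b k, b.trunc n x⟫ = if k < n then ⟪b k, x⟫ else 0 := by
  rw [trunc_apply, inner_sum_smul_right]

theorem norm_sub_trunc_sq (b : HilbertBasis ℕ ℝ E) (n : ℕ) (x : E) :
    ‖x - b.trunc n x‖ ^ 2 = ‖x‖ ^ 2 - ‖b.trunc n x‖ ^ 2 := by
  have h : ⟪x, b.trunc n x⟫ = ‖b.trunc n x‖ ^ 2 := by
    rw [real_inner_comm, trunc_apply, inner_sum_smul_left, norm_sq_sum_smul]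
    exact Finset.sum_congr rfl fun k _ => (sq _).symm
  rw [norm_sub_sq_real, h]; ring

theorem norm_trunc_le (b : HilbertBasis ℕ ℝ E) (n : ℕ) (x : E) : ‖b.trunc n x‖ ≤ ‖x‖ := by
  have := b.norm_sub_trunc_sq n x
  exact le_of_sq_le_sq (by nlinarith [sq_nonneg ‖x - b.trunc n x‖]) (norm_nonneg _)

theorem norm_sub_trunc_le (b : HilbertBasis ℕ ℝ E) (n : ℕ) (x : E) :
    ‖x - b.trunc n x‖ ≤ ‖x‖ := by
  have := b.norm_sub_trunc_sq n x
  exact le_of_sq_le_sq (by nlinarith [sq_nonneg ‖b.trunc n x‖]) (norm_nonneg _)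

theorem tendsto_trunc (b : HilbertBasis ℕ ℝ E) (x : E) :
    Tendsto (fun n => b.trunc n x) atTop (𝓝 x) := by
  have := (b.hasSum_repr x).tendsto_sum_nat
  simpa only [trunc_apply, b.repr_apply_apply] using this

theorem ext_inner (b : HilbertBasis ℕ ℝ E) {x y : E} (h : ∀ k, ⟪b k, x⟫ = ⟪b k, y⟫) : x = y := by
  refine tendsto_nhds_unique (b.tendsto_trunc x) ?_
  simpa only [trunc_apply, h] using b.tendsto_trunc y

end HilbertBasis

/-! ### The dissipation rate -/

/-- The supremum of `w * (b - w)` over `w ≥ x`. -/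
def dissipation (x b : ℝ) : ℝ := max x (b / 2) * (b - max x (b / 2))

/-- The concave parabola ω ↦ ω(b - ω) peaks at b/2, so on [x, ∞) its maximum lies at the larger of x
and b/2. -/
theorem mul_sub_le_dissipation {x b w : ℝ} (h : x ≤ w) : w * (b - w) ≤ dissipation x b := by
  unfold dissipation
  rcases le_total x (b / 2) with h1 | h1
  · rw [max_eq_right h1]; nlinarith [sq_nonneg (w - b / 2)]
  · rw [max_eq_left h1]; nlinarith

theorem dissipation_le_sq (x b : ℝ) : dissipation x b ≤ b ^ 2 / 4 := by
  unfold dissipation; nlinarith [sq_nonneg (max x (b / 2) - b / 2)]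

theorem dissipation_le_sub {x b : ℝ} (hx : 0 ≤ x) :
    dissipation x b ≤ -(x ^ 2) / 2 + b ^ 2 / 2 := by
  unfold dissipation
  have h := le_max_left x (b / 2)
  nlinarith [sq_nonneg (max x (b / 2) - b)]

theorem dissipation_of_le {x b : ℝ} (h : b / 2 ≤ x) : dissipation x b = x * (b - x) := by
  rw [dissipation, max_eq_left h]

theorem abs_dissipation_le {x b R : ℝ} (hx : 0 ≤ x) (hb : 0 ≤ b) (hR : x + b ≤ R) :
    |dissipation x b| ≤ R ^ 2 := by
  have h0 : 0 ≤ max x (b / 2) := le_max_of_le_left hx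
  have h1 : max x (b / 2) ≤ R := max_le (by linarith) (by linarith)
  have h2 : |b - max x (b / 2)| ≤ R := abs_le.2 ⟨by linarith, by linarith⟩
  rw [dissipation, abs_mul, abs_of_nonneg h0, sq]
  gcongr
  linarith

@[fun_prop]
theorem Continuous.dissipation {α : Type*} [TopologicalSpace α] {x b : α → ℝ} (hx : Continuous x)
    (hb : Continuous b) : Continuous fun a => dissipation (x a) (b a) := by
  unfold _root_.dissipation; fun_prop

theorem continuous_of_lipschitz_on_balls {E F : Type*} [SeminormedAddCommGroup E]
    [SeminormedAddCommGroup F] {N : E → F}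
    (hN : ∀ R, ∃ L, ∀ x y, ‖x‖ ≤ R → ‖y‖ ≤ R → ‖N x - N y‖ ≤ L * ‖x - y‖) : Continuous N := by
  refine continuous_iff_continuousAt.2 fun x => ?_
  obtain ⟨L, hL⟩ := hN (‖x‖ + 1)
  refine tendsto_iff_norm_sub_tendsto_zero.2 ?_
  have h1 : Tendsto (fun y => L * ‖y - x‖) (𝓝 x) (𝓝 0) := by
    have : Continuous fun y => L * ‖y - x‖ := by fun_prop
    simpa using this.tendsto x
  refine squeeze_zero' (Eventually.of_forall fun _ => norm_nonneg _) ?_ h1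
  filter_upwards [(continuous_norm.tendsto x).eventually (gt_mem_nhds (lt_add_one ‖x‖))] with y hy
  exact hL y x hy.le (by linarith)

/-! ### Diagonal embeddings and the flows they generate -/

variable {H X : Type*} [NormedAddCommGroup H] [InnerProductSpace ℝ H]
  [NormedAddCommGroup X] [InnerProductSpace ℝ X]

/-- The embedding `ι` is diagonal with entries `1 / μ k` in the bases `eX` and `eH`. -/
structure DiagonalEmbedding (ι : X →L[ℝ] H) (eX : HilbertBasis ℕ ℝ X) (eH : HilbertBasis ℕ ℝ H)
    (μ : ℕ → ℝ) : Prop where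
  one_le : ∀ k, 1 ≤ μ k
  inner_eq : ∀ k s, ⟪eX k, s⟫ = μ k * ⟪eH k, ι s⟫
  smul_map : ∀ k, μ k • ι (eX k) = eH k

/-- `s` solves `s' = -A s + h` on `[0, T]`, where `A` is the positive operator with eigenvalues
`μ k ^ 2`; the equation is written in coordinates and integrated in time. -/
structure IsLinearFlow (eX : HilbertBasis ℕ ℝ X) (eH : HilbertBasis ℕ ℝ H) (μ : ℕ → ℝ) (T : ℝ)
    (s : ℝ → X) (h : ℝ → H) : Prop where
  continuous : Continuous s
  continuous_force : Continuous h
  equation : ∀ k, ∀ t ∈ Icc 0 T, ⟪eX k, s t⟫ = ⟪eX k, s 0⟫ +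
    ∫ τ in (0 : ℝ)..t, (-(μ k ^ 2 * ⟪eX k, s τ⟫) + μ k * ⟪eH k, h τ⟫)

/-- `N` is a locally Lipschitz operator that is, in the pairing of `H`, the derivative of `Φ` and
that satisfies a sign condition. -/
structure IsGradientOf (ι : X →L[ℝ] H) (N : X → H) (Φ : X → ℝ) : Prop where
  lipschitz : ∀ R, ∃ L, ∀ x y, ‖x‖ ≤ R → ‖y‖ ≤ R → ‖N x - N y‖ ≤ L * ‖x - y‖
  hasFDerivAt : ∀ s, HasFDerivAt Φ ((innerSL ℝ (N s)).comp ι) s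
  inner_nonneg : ∀ s, 0 ≤ ⟪N s, ι s⟫

theorem IsGradientOf.zero (ι : X →L[ℝ] H) : IsGradientOf ι (fun _ => 0) (fun _ => 0) where
  lipschitz _ := ⟨0, by simp⟩
  hasFDerivAt s := by
    have : (innerSL ℝ (0 : H)).comp ι = (0 : X →L[ℝ] ℝ) := by ext; simp
    rw [this]; exact hasFDerivAt_const _ _
  inner_nonneg s := by simp

namespace DiagonalEmbedding

variable {ι : X →L[ℝ] H} {eX : HilbertBasis ℕ ℝ X} {eH : HilbertBasis ℕ ℝ H} {μ : ℕ → ℝ}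

theorem map_trunc (D : DiagonalEmbedding ι eX eH μ) (n : ℕ) (s : X) :
    ι (eX.trunc n s) = eH.trunc n (ι s) := by
  rw [eX.trunc_apply, eH.trunc_apply, map_sum]
  refine Finset.sum_congr rfl fun k _ => ?_
  rw [map_smul, D.inner_eq, mul_comm, mul_smul, D.smul_map]

/-- All entries 1/μ k are at most 1: compare coefficients on truncations and pass to the limit. In
the application this is the Friedrichs inequality with constant 1. -/
theorem norm_map_le (D : DiagonalEmbedding ι eX eH μ) (s : X) : ‖ι s‖ ≤ ‖s‖ := by
  have h : ∀ n, ‖ι (eX.trunc n s)‖ ≤ ‖eX.trunc n s‖ := fun n => by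
    refine le_of_sq_le_sq ?_ (norm_nonneg _)
    rw [D.map_trunc, eX.trunc_apply, eH.trunc_apply, eX.norm_sq_sum_smul, eH.norm_sq_sum_smul]
    refine Finset.sum_le_sum fun k _ => ?_
    rw [D.inner_eq, mul_pow]
    have := D.one_le k
    nlinarith [sq_nonneg ⟪eH k, ι s⟫, mul_nonneg (by nlinarith : 0 ≤ μ k ^ 2 - 1)
      (sq_nonneg ⟪eH k, ι s⟫)]
  exact le_of_tendsto_of_tendsto' ((ι.continuous.norm.tendsto _).comp (eX.tendsto_trunc s))
    ((continuous_norm.tendsto _).comp (eX.tendsto_trunc s)) h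

/-- Along the truncated vector field, the energy decays at the dissipation rate. -/
theorem truncated_energy_le (D : DiagonalEmbedding ι eX eH μ) {N : X → H} {Φ : X → ℝ}
    (hN : IsGradientOf ι N Φ) (n : ℕ) (x : X) (g : H) :
    let v := ∑ k ∈ Finset.range n,
      (-(μ k ^ 2 * ⟪eX k, x⟫) + μ k * ⟪eH k, g - N x⟫) • eX k
    ⟪eX.trunc n x, v⟫ + ⟪N (eX.trunc n x), ι v⟫ ≤
      dissipation ‖eX.trunc n x‖ (‖g‖ + ‖N (eX.trunc n x) - N x‖) := by
  intro v
  set y := eX.trunc n x with hy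
  -- These are the coefficients of w = Pₙ(A y + N y). The projected velocity is -w + Pₙ(g + N y - N
  -- x); the difference N y - N x is the price of evaluating N at x in the equation but at y in the
  -- gradient.
  set c : ℕ → ℝ := fun k => μ k * ⟪eX k, x⟫ + ⟪eH k, N y⟫ with hc
  set w : H := ∑ k ∈ Finset.range n, c k • eH k with hw
  have hιv : ι v = ∑ k ∈ Finset.range n, (-(μ k * ⟪eX k, x⟫) + ⟪eH k, g - N x⟫) • eH k := by
    simp only [v, map_sum, map_smul]
    refine Finset.sum_congr rfl fun k _ => ?_
    rw [← D.smul_map k, smul_smul]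
    congr 1; ring
  have hιy : ι y = ∑ k ∈ Finset.range n, ⟪eH k, ι x⟫ • eH k := by
    rw [hy, D.map_trunc, eH.trunc_apply]
  have h1 : ⟪y, v⟫ + ⟪N y, ι v⟫ = -‖w‖ ^ 2 + ⟪w, g + (N y - N x)⟫ := by
    rw [hιv, real_inner_comm, real_inner_comm _ (N y), eH.inner_sum_smul_left,
      eX.inner_sum_smul_left, hw, eH.norm_sq_sum_smul, eH.inner_sum_smul_left,
      ← Finset.sum_add_distrib, ← Finset.sum_neg_distrib, ← Finset.sum_add_distrib]
    refine Finset.sum_congr rfl fun k hk => ?_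
    rw [hy, eX.inner_trunc, if_pos (Finset.mem_range.1 hk)]
    simp only [hc, inner_add_right, inner_sub_right, hy]
    ring
  -- Pairing w with y and using the sign condition on N forces ‖w‖ ≥ ‖y‖, which allows the supremum
  -- to be restricted to ω ≥ ‖y‖.
  have h2 : ‖y‖ ^ 2 ≤ ⟪w, ι y⟫ := by
    have h3 : ⟪w, ι y⟫ = ‖y‖ ^ 2 + ⟪N y, ι y⟫ := by
      rw [hw, eH.inner_sum_smul_left, hιy, real_inner_comm, eH.inner_sum_smul_left,
        show ‖y‖ ^ 2 = ∑ k ∈ Finset.range n, ⟪eX k, x⟫ ^ 2 by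
          rw [hy, eX.trunc_apply, eX.norm_sq_sum_smul], ← Finset.sum_add_distrib]
      refine Finset.sum_congr rfl fun k hk => ?_
      rw [eH.inner_sum_smul_right, if_pos (Finset.mem_range.1 hk)]
      simp only [hc, D.inner_eq]
      ring
    rw [h3]; linarith [hN.inner_nonneg y]
  have h4 : ‖y‖ ≤ ‖w‖ := by
    rcases (norm_nonneg y).eq_or_lt with h0 | h0
    · rw [← h0]; exact norm_nonneg _
    · have : ‖y‖ ^ 2 ≤ ‖w‖ * ‖y‖ := h2.trans ((real_inner_le_norm _ _).trans
        (mul_le_mul_of_nonneg_left (D.norm_map_le y) (norm_nonneg _)))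
      exact le_of_mul_le_mul_right (by linarith [sq ‖y‖]) h0
  rw [h1]
  refine le_trans ?_ (mul_sub_le_dissipation h4)
  have h5 : ⟪w, g + (N y - N x)⟫ ≤ ‖w‖ * (‖g‖ + ‖N y - N x‖) :=
    (real_inner_le_norm _ _).trans (mul_le_mul_of_nonneg_left (norm_add_le _ _) (norm_nonneg _))
  linarith

/-- The energy inequality. -/
theorem energy_le (D : DiagonalEmbedding ι eX eH μ) {N : X → H} {Φ : X → ℝ}
    (hN : IsGradientOf ι N Φ) {T : ℝ} {s : ℝ → X} {g : ℝ → H} (hg : Continuous g)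
    (hs : IsLinearFlow eX eH μ T s fun τ => g τ - N (s τ)) {r t : ℝ} (hr : 0 ≤ r) (hrt : r ≤ t)
    (htT : t ≤ T) :
    (‖s t‖ ^ 2 / 2 + Φ (s t)) - (‖s r‖ ^ 2 / 2 + Φ (s r)) ≤
      ∫ τ in r..t, dissipation ‖s τ‖ ‖g τ‖ := by
  have hNc : Continuous N := continuous_of_lipschitz_on_balls hN.lipschitz
  have hsc := hs.continuous
  set V : X → ℝ := fun x => ‖x‖ ^ 2 / 2 + Φ x with hV
  have hVd : ∀ x, HasFDerivAt V (innerSL ℝ x + (innerSL ℝ (N x)).comp ι) x := fun x => by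
    have h1 : HasFDerivAt (fun x : X => ‖x‖ ^ 2 / 2) (innerSL ℝ x) x := by
      have := ((hasStrictFDerivAt_norm_sq x).hasFDerivAt).const_mul (1 / 2 : ℝ)
      refine (this.congr_fderiv ?_).congr_of_eventuallyEq
        (Eventually.of_forall fun y => by ring)
      ext y; simp
    exact h1.add (hN.hasFDerivAt x)
  have hVc : Continuous V := continuous_iff_continuousAt.2 fun x => (hVd x).continuousAt
  let c : ℕ → ℝ → ℝ := fun k τ => -(μ k ^ 2 * ⟪eX k, s τ⟫) + μ k * ⟪eH k, g τ - N (s τ)⟫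
  have hc : ∀ k, Continuous (c k) := fun k => by
    have := hs.continuous_force
    fun_prop
  -- The curve S n agrees with the truncation of s on [0, T], but it is differentiable on the whole
  -- line, so the chain rule applies also at the endpoints.
  let S : ℕ → ℝ → X := fun n t =>
    ∑ k ∈ Finset.range n, (⟪eX k, s 0⟫ + ∫ τ in (0 : ℝ)..t, c k τ) • eX k
  have hS : ∀ n, ∀ t ∈ Icc 0 T, S n t = eX.trunc n (s t) := fun n t ht => by
    rw [eX.trunc_apply]
    exact Finset.sum_congr rfl fun k _ => by rw [hs.equation k t ht]
  let v : ℕ → ℝ → X := fun n τ => ∑ k ∈ Finset.range n, c k τ • eX k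
  have hSd : ∀ n t, HasDerivAt (S n) (v n t) t := fun n t => by
    refine HasDerivAt.fun_sum fun k _ => ?_
    exact (((hc k).integral_hasStrictDerivAt 0 t).hasDerivAt.const_add _).smul_const _
  have hvc : ∀ n, Continuous (v n) := fun n => by fun_prop
  have hsub : ∀ τ ∈ uIcc r t, τ ∈ Icc 0 T := fun τ hτ => by
    rw [uIcc_of_le hrt] at hτ; exact ⟨hr.trans hτ.1, hτ.2.trans htT⟩
  let E' : ℕ → ℝ → ℝ := fun n τ =>
    ⟪eX.trunc n (s τ), v n τ⟫ + ⟪N (eX.trunc n (s τ)), ι (v n τ)⟫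
  have hE'c : ∀ n, Continuous (E' n) := fun n => by
    have := hvc n
    fun_prop
  have hftc : ∀ n, V (eX.trunc n (s t)) - V (eX.trunc n (s r)) = ∫ τ in r..t, E' n τ := by
    intro n
    have := intervalIntegral.integral_eq_sub_of_hasDerivAt (f := fun τ => V (S n τ))
      (f' := E' n) (a := r) (b := t) ?_ ((hE'c n).intervalIntegrable _ _)
    · rw [this, hS n t (hsub t right_mem_uIcc), hS n r (hsub r left_mem_uIcc)]
    · intro τ hτ
      have h1 := (hVd (S n τ)).comp_hasDerivAt τ (hSd n τ)
      rw [hS n τ (hsub τ hτ)] at h1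
      exact h1
  -- The derivative E' n contains A applied to a truncation, for which no uniform bound is at hand.
  -- Its bound Q n involves only norms in X and values of N, hence it converges with domination.
  let Q : ℕ → ℝ → ℝ := fun n τ =>
    dissipation ‖eX.trunc n (s τ)‖ (‖g τ‖ + ‖N (eX.trunc n (s τ)) - N (s τ)‖)
  have hQc : ∀ n, Continuous (Q n) := fun n => by fun_prop
  have hle : ∀ n, V (eX.trunc n (s t)) - V (eX.trunc n (s r)) ≤ ∫ τ in r..t, Q n τ := fun n => by
    rw [hftc n]
    refine intervalIntegral.integral_mono_on hrt ((hE'c n).intervalIntegrable _ _)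
      ((hQc n).intervalIntegrable _ _) fun τ _ => ?_
    exact D.truncated_energy_le hN n (s τ) (g τ)
  obtain ⟨R, hR⟩ := (isCompact_uIcc (a := r) (b := t)).exists_bound_of_continuousOn
    hsc.continuousOn
  obtain ⟨G, hG⟩ := (isCompact_uIcc (a := r) (b := t)).exists_bound_of_continuousOn
    hg.continuousOn
  obtain ⟨L, hL⟩ := hN.lipschitz R
  have hlim : Tendsto (fun n => ∫ τ in r..t, Q n τ) atTop
      (𝓝 (∫ τ in r..t, dissipation ‖s τ‖ ‖g τ‖)) := by
    refine intervalIntegral.tendsto_integral_filter_of_dominated_convergence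
      (fun _ => (R + (G + |L| * R)) ^ 2) (Eventually.of_forall fun n =>
        (hQc n).aestronglyMeasurable) (Eventually.of_forall fun n => ?_)
      intervalIntegrable_const ?_
    · refine Eventually.of_forall fun τ hτ => ?_
      have hτ' := uIoc_subset_uIcc hτ
      have h1 := eX.norm_trunc_le n (s τ)
      have h2 := hR τ hτ'
      refine abs_dissipation_le (norm_nonneg _) (by positivity) (add_le_add (h1.trans h2)
        (add_le_add (hG τ hτ') ?_))
      refine (hL _ _ (h1.trans h2) h2).trans ?_
      refine mul_le_mul (le_abs_self L) ?_ (norm_nonneg _) (abs_nonneg _)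
      rw [norm_sub_rev]
      exact (eX.norm_sub_trunc_le n _).trans h2
    · refine Eventually.of_forall fun τ _ => ?_
      have h1 : Continuous fun y => dissipation ‖y‖ (‖g τ‖ + ‖N y - N (s τ)‖) := by fun_prop
      have h2 := (h1.tendsto (s τ)).comp (eX.tendsto_trunc (s τ))
      simp only [sub_self, norm_zero, add_zero] at h2
      exact h2
  exact le_of_tendsto_of_tendsto' (((hVc.tendsto _).comp (eX.tendsto_trunc _)).sub
    ((hVc.tendsto _).comp (eX.tendsto_trunc _))) hlim hle

end DiagonalEmbedding

end


section


/-! ### Integrated differential inequalities -/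

/-- An integrated inequality bounds the upper right Dini derivative of V by q, as the right slope of
the integral tends to q x. This serves both Gronwall's lemma and the Lie derivative. -/
theorem eventually_slope_lt_of_sub_le_integral {V q : ℝ → ℝ} {x b r : ℝ} (hq : Continuous q)
    (hxb : x < b) (h : ∀ z, x ≤ z → z ≤ b → V z - V x ≤ ∫ τ in x..z, q τ) (hr : q x < r) :
    ∀ᶠ z in 𝓝[>] x, (z - x)⁻¹ * (V z - V x) < r := by
  have h1 : Tendsto (slope (fun z => ∫ τ in x..z, q τ) x) (𝓝[>] x) (𝓝 (q x)) :=
    (hasDerivAt_iff_tendsto_slope.1 (hq.integral_hasStrictDerivAt x x).hasDerivAt).mono_left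
      (nhdsWithin_mono _ fun z hz => (ne_of_gt hz : z ≠ x))
  filter_upwards [h1.eventually (gt_mem_nhds hr), Ioo_mem_nhdsGT hxb] with z hz hzb
  refine lt_of_le_of_lt ?_ hz
  rw [slope_def_field, intervalIntegral.integral_same, sub_zero, div_eq_inv_mul]
  exact mul_le_mul_of_nonneg_left (h z hzb.1.le hzb.2.le) (inv_nonneg.2 (sub_nonneg.2 hzb.1.le))

theorem le_mul_exp_of_sub_le_integral {V q : ℝ → ℝ} {K a b : ℝ} (hV : ContinuousOn V (Icc a b))
    (hq : Continuous q)
    (h : ∀ r t, a ≤ r → r ≤ t → t ≤ b → V t - V r ≤ ∫ τ in r..t, q τ)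
    (hqV : ∀ x ∈ Icc a b, q x ≤ K * V x) : ∀ x ∈ Icc a b, V x ≤ V a * Real.exp (K * (x - a)) := by
  intro x hx
  have := le_gronwallBound_of_liminf_deriv_right_le (f' := q) (K := K) (ε := 0) hV
    (fun y hy r hr => (eventually_slope_lt_of_sub_le_integral hq hy.2
      (fun z hyz hzb => h y z hy.1 hyz hzb) hr).frequently) le_rfl
    (fun y hy => by simpa using hqV y (Ico_subset_Icc_self hy)) x hx
  rwa [gronwallBound_ε0] at this

/-! ### Linear flows -/

variable {H X : Type*} [NormedAddCommGroup H] [InnerProductSpace ℝ H]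
  [NormedAddCommGroup X] [InnerProductSpace ℝ X]

variable {ι : X →L[ℝ] H} {eX : HilbertBasis ℕ ℝ X} {eH : HilbertBasis ℕ ℝ H} {μ : ℕ → ℝ}

theorem HilbertBasis.norm_trunc_sub_trunc_le (b : HilbertBasis ℕ ℝ X) {m n : ℕ} (hmn : m ≤ n)
    (x : X) : ‖b.trunc n x - b.trunc m x‖ ≤ ‖x - b.trunc m x‖ := by
  have h : b.trunc n x - b.trunc m x = b.trunc n (x - b.trunc m x) := by
    refine b.ext_inner fun k => ?_
    simp only [inner_sub_right, b.inner_trunc]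
    split_ifs <;> first | omega | ring
  rw [h]
  exact b.norm_trunc_le n _

theorem IsLinearFlow.congr {T : ℝ} {s s' : ℝ → X} {h h' : ℝ → H}
    (hs : IsLinearFlow eX eH μ T s h) (hc : Continuous s') (hc' : Continuous h')
    (hss : ∀ t ∈ Icc 0 T, s t = s' t) (hh : ∀ t ∈ Icc 0 T, h t = h' t) :
    IsLinearFlow eX eH μ T s' h' where
  continuous := hc
  continuous_force := hc'
  equation k t ht := by
    rw [← hss t ht, ← hss 0 ⟨le_rfl, ht.1.trans ht.2⟩, hs.equation k t ht]
    congr 1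
    refine intervalIntegral.integral_congr fun τ hτ => ?_
    rw [uIcc_of_le ht.1] at hτ
    have hτ' : τ ∈ Icc 0 T := ⟨hτ.1, hτ.2.trans ht.2⟩
    simp only [hh τ hτ', hss τ hτ']

theorem IsLinearFlow.shift {T r : ℝ} {s : ℝ → X} {h : ℝ → H} (hs : IsLinearFlow eX eH μ T s h)
    (hr : 0 ≤ r) :
    IsLinearFlow eX eH μ (T - r) (fun t => s (t + r)) (fun t => h (t + r)) where
  continuous := hs.continuous.comp (continuous_add_const r)
  continuous_force := hs.continuous_force.comp (continuous_add_const r)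
  equation k t ht := by
    have h1 := hs.continuous
    have h2 := hs.continuous_force
    have hi : Continuous fun τ => -(μ k ^ 2 * ⟪eX k, s τ⟫) + μ k * ⟪eH k, h τ⟫ := by fun_prop
    have h3 := intervalIntegral.integral_comp_add_right (a := 0) (b := t)
      (fun τ => -(μ k ^ 2 * ⟪eX k, s τ⟫) + μ k * ⟪eH k, h τ⟫) r
    have h4 := intervalIntegral.integral_add_adjacent_intervals
      (hi.intervalIntegrable (μ := volume) 0 r) (hi.intervalIntegrable r (t + r))
    rw [h3, zero_add, hs.equation k (t + r) ⟨by linarith [ht.1], by linarith [ht.2]⟩,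
      hs.equation k r ⟨hr, by linarith [ht.1, ht.2]⟩, ← h4, add_assoc]

theorem IsLinearFlow.mono {T T' : ℝ} {s : ℝ → X} {h : ℝ → H} (hs : IsLinearFlow eX eH μ T s h)
    (hT : T' ≤ T) : IsLinearFlow eX eH μ T' s h :=
  ⟨hs.1, hs.2, fun k t ht => hs.3 k t ⟨ht.1, ht.2.trans hT⟩⟩

theorem IsLinearFlow.sub {T : ℝ} {s s' : ℝ → X} {h h' : ℝ → H} (hs : IsLinearFlow eX eH μ T s h)
    (hs' : IsLinearFlow eX eH μ T s' h') :
    IsLinearFlow eX eH μ T (fun t => s t - s' t) (fun t => h t - h' t) where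
  continuous := hs.continuous.sub hs'.continuous
  continuous_force := hs.continuous_force.sub hs'.continuous_force
  equation k t ht := by
    have h1 := hs.continuous
    have h2 := hs.continuous_force
    have h3 := hs'.continuous
    have h4 := hs'.continuous_force
    have i1 : Continuous fun τ => -(μ k ^ 2 * ⟪eX k, s τ⟫) + μ k * ⟪eH k, h τ⟫ := by fun_prop
    have i2 : Continuous fun τ => -(μ k ^ 2 * ⟪eX k, s' τ⟫) + μ k * ⟪eH k, h' τ⟫ := by fun_prop
    simp only [inner_sub_right]
    rw [hs.equation k t ht, hs'.equation k t ht, add_sub_add_comm,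
      ← intervalIntegral.integral_sub (i1.intervalIntegrable _ _) (i2.intervalIntegrable _ _)]
    congr 1
    exact intervalIntegral.integral_congr fun τ _ => by ring

/-! ### Uniqueness and existence of flows with Lipschitz nonlinearity -/

namespace DiagonalEmbedding

/-- The energy inequality with N = 0 and Φ = 0, with the dissipation replaced by its maximum ‖h‖²/4.
It controls the X-norm by an H-norm of the force, so Lipschitz maps from X to H count as lower-order
terms. -/
theorem linear_energy_le (D : DiagonalEmbedding ι eX eH μ) {T : ℝ} {s : ℝ → X} {h : ℝ → H}
    (hs : IsLinearFlow eX eH μ T s h) {r t : ℝ} (hr : 0 ≤ r) (hrt : r ≤ t) (htT : t ≤ T) :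
    ‖s t‖ ^ 2 / 2 - ‖s r‖ ^ 2 / 2 ≤ ∫ τ in r..t, ‖h τ‖ ^ 2 / 4 := by
  have h1 := hs.continuous
  have h2 := hs.continuous_force
  have := D.energy_le (IsGradientOf.zero ι) hs.continuous_force (s := s) (T := T)
    (by simpa using hs) hr hrt htT
  simp only [add_zero] at this
  refine this.trans (intervalIntegral.integral_mono_on hrt ?_ ?_ fun τ _ => dissipation_le_sq _ _)
  · exact Continuous.intervalIntegrable (by fun_prop) _ _
  · exact Continuous.intervalIntegrable (by fun_prop) _ _

/-- The difference of two flows is a linear flow with force N(s') - N(s); both curves stay in one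
ball on [0, T], where N is Lipschitz, and Gronwall's lemma applies. -/
theorem flow_unique (D : DiagonalEmbedding ι eX eH μ) {N : X → H}
    (hN : ∀ R, ∃ L, ∀ x y, ‖x‖ ≤ R → ‖y‖ ≤ R → ‖N x - N y‖ ≤ L * ‖x - y‖)
    {T : ℝ} {s s' : ℝ → X} {g : ℝ → H}
    (hs : IsLinearFlow eX eH μ T s fun τ => g τ - N (s τ))
    (hs' : IsLinearFlow eX eH μ T s' fun τ => g τ - N (s' τ)) (h0 : s 0 = s' 0) :
    ∀ t ∈ Icc 0 T, s t = s' t := by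
  have c1 := hs.continuous
  have c2 := hs'.continuous
  have hd := hs.sub hs'
  have cF := hd.continuous_force
  obtain ⟨R, hR⟩ := (isCompact_Icc (a := 0) (b := T)).exists_bound_of_continuousOn
    c1.continuousOn
  obtain ⟨R', hR'⟩ := (isCompact_Icc (a := 0) (b := T)).exists_bound_of_continuousOn
    c2.continuousOn
  obtain ⟨L, hL⟩ := hN (max R R')
  intro t ht
  have key := le_mul_exp_of_sub_le_integral (V := fun t => ‖s t - s' t‖ ^ 2 / 2) (K := L ^ 2 / 2)
    (a := 0) (b := T) (Continuous.continuousOn (by fun_prop))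
    (q := fun τ => ‖(g τ - N (s τ)) - (g τ - N (s' τ))‖ ^ 2 / 4) (by fun_prop)
    (fun r t hr hrt htT => D.linear_energy_le hd hr hrt htT) (fun x hx => ?_) t ht
  · rw [h0, sub_self, norm_zero] at key
    have h2 : ‖s t - s' t‖ ^ 2 ≤ 0 := by linarith
    have h3 : ‖s t - s' t‖ = 0 := by nlinarith [norm_nonneg (s t - s' t)]
    exact sub_eq_zero.1 (norm_eq_zero.1 h3)
  · have h1 := hL (s' x) (s x) ((hR' x hx).trans (le_max_right _ _))
      ((hR x hx).trans (le_max_left _ _))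
    rw [norm_sub_rev (s' x)] at h1
    have h2 : (g x - N (s x)) - (g x - N (s' x)) = N (s' x) - N (s x) := by abel
    have h3 := pow_le_pow_left₀ (norm_nonneg _) h1 2
    simp only [h2]
    rw [mul_pow] at h3
    linarith

/-- Each mode is solved by variation of constants. The partial sums are flows with truncated data,
so the linear energy estimate makes them uniformly Cauchy on [0, T]. -/
theorem exists_linearFlow [CompleteSpace X] (D : DiagonalEmbedding ι eX eH μ) {T : ℝ} (hT : 0 ≤ T)
    (x₀ : X) {h : ℝ → H} (hh : Continuous h) :
    ∃ s, IsLinearFlow eX eH μ T s h ∧ s 0 = x₀ := by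
  let σ : ℕ → ℝ → ℝ := fun k t => Real.exp (-(μ k ^ 2 * t)) *
    (⟪eX k, x₀⟫ + ∫ τ in (0 : ℝ)..t, Real.exp (μ k ^ 2 * τ) * (μ k * ⟪eH k, h τ⟫))
  have hσ0 : ∀ k, σ k 0 = ⟪eX k, x₀⟫ := fun k => by simp [σ]
  have hσd : ∀ k t, HasDerivAt (σ k) (-(μ k ^ 2 * σ k t) + μ k * ⟪eH k, h t⟫) t := fun k t => by
    have hc : Continuous fun τ => Real.exp (μ k ^ 2 * τ) * (μ k * ⟪eH k, h τ⟫) := by fun_prop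
    have h1 := ((hc.integral_hasStrictDerivAt 0 t).hasDerivAt.const_add ⟪eX k, x₀⟫)
    have h2 : HasDerivAt (fun t => Real.exp (-(μ k ^ 2 * t)))
        (Real.exp (-(μ k ^ 2 * t)) * (-(μ k ^ 2 * 1))) t :=
      (((hasDerivAt_id t).const_mul (μ k ^ 2)).neg).exp
    refine (h2.mul h1).congr_deriv ?_
    have h3 : Real.exp (-(μ k ^ 2 * t)) * Real.exp (μ k ^ 2 * t) = 1 := by
      rw [← Real.exp_add]; simp
    simp only [σ]
    linear_combination (μ k * ⟪eH k, h t⟫) * h3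
  have hσc : ∀ k, Continuous (σ k) := fun k =>
    continuous_iff_continuousAt.2 fun t => (hσd k t).continuousAt
  have hσe : ∀ k t, σ k t = ⟪eX k, x₀⟫ +
      ∫ τ in (0 : ℝ)..t, (-(μ k ^ 2 * σ k τ) + μ k * ⟪eH k, h τ⟫) := fun k t => by
    have hc : Continuous fun τ => -(μ k ^ 2 * σ k τ) + μ k * ⟪eH k, h τ⟫ := by
      have := hσc k
      fun_prop
    rw [intervalIntegral.integral_eq_sub_of_hasDerivAt (fun τ _ => hσd k τ)
      (hc.intervalIntegrable _ _), hσ0]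
    ring
  let S : ℕ → ℝ → X := fun n t => ∑ k ∈ Finset.range n, σ k t • eX k
  have hSc : ∀ n, Continuous (S n) := fun n => by fun_prop
  have hS : ∀ n, IsLinearFlow eX eH μ T (S n) fun τ => eH.trunc n (h τ) := fun n =>
    ⟨hSc n, by fun_prop, fun k t _ => by
      simp only [S, eX.inner_sum_smul_right, eH.inner_trunc]
      split_ifs with hk
      · rw [hσ0]; exact hσe k t
      · simp⟩
  have hS0 : ∀ n, S n 0 = eX.trunc n x₀ := fun n => by simp only [S, hσ0, eX.trunc_apply]
  -- The right-hand side of the energy estimate, doubled, for the part of the data beyond mode m. It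
  -- bounds the squared distance of all later partial sums from the m-th.
  let ε : ℕ → ℝ := fun m => ‖x₀ - eX.trunc m x₀‖ ^ 2 +
    2 * ∫ τ in (0 : ℝ)..T, ‖h τ - eH.trunc m (h τ)‖ ^ 2 / 4
  have hεc : ∀ m, Continuous fun τ => ‖h τ - eH.trunc m (h τ)‖ ^ 2 / 4 := fun m => by fun_prop
  have hε : Tendsto ε atTop (𝓝 0) := by
    have h1 : Tendsto (fun m => ‖x₀ - eX.trunc m x₀‖ ^ 2) atTop (𝓝 0) := by
      simpa using ((eX.tendsto_trunc x₀).const_sub x₀).norm.pow 2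
    have h2 : Tendsto (fun m => ∫ τ in (0 : ℝ)..T, ‖h τ - eH.trunc m (h τ)‖ ^ 2 / 4) atTop
        (𝓝 (∫ τ in (0 : ℝ)..T, (0 : ℝ))) := by
      refine intervalIntegral.tendsto_integral_filter_of_dominated_convergence
        (fun τ => ‖h τ‖ ^ 2 / 4) (Eventually.of_forall fun m => (hεc m).aestronglyMeasurable)
        (Eventually.of_forall fun m => Eventually.of_forall fun τ _ => ?_)
        (Continuous.intervalIntegrable (by fun_prop) _ _) (Eventually.of_forall fun τ _ => ?_)
      · rw [Real.norm_of_nonneg (by positivity)]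
        have := eH.norm_sub_trunc_le m (h τ)
        gcongr
      · simpa using (((eH.tendsto_trunc (h τ)).const_sub (h τ)).norm.pow 2).div_const 4
    have h3 := h1.add (h2.const_mul 2)
    rwa [intervalIntegral.integral_zero, mul_zero, add_zero] at h3
  have hε0 : ∀ m, 0 ≤ ε m := fun m => add_nonneg (by positivity)
    (mul_nonneg zero_le_two (intervalIntegral.integral_nonneg hT fun τ _ => by positivity))
  have hdist : ∀ m n, m ≤ n → ∀ t ∈ Icc 0 T, dist (S n t) (S m t) ≤ √(ε m) := by
    intro m n hmn t ht
    rw [dist_eq_norm]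
    refine Real.le_sqrt_of_sq_le ?_
    have h1 := D.linear_energy_le ((hS n).sub (hS m)) le_rfl ht.1 ht.2
    rw [hS0, hS0] at h1
    have h2 := pow_le_pow_left₀ (norm_nonneg _) (eX.norm_trunc_sub_trunc_le hmn x₀) 2
    have h3 : ∫ τ in (0 : ℝ)..t, ‖eH.trunc n (h τ) - eH.trunc m (h τ)‖ ^ 2 / 4 ≤
        ∫ τ in (0 : ℝ)..T, ‖h τ - eH.trunc m (h τ)‖ ^ 2 / 4 := by
      refine (intervalIntegral.integral_mono_on ht.1
        (Continuous.intervalIntegrable (by fun_prop) _ _)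
        ((hεc m).intervalIntegrable _ _) fun τ _ => ?_).trans
        (intervalIntegral.integral_mono_interval le_rfl ht.1 ht.2
          (Eventually.of_forall fun τ => by positivity) ((hεc m).intervalIntegrable _ _))
      have := eH.norm_trunc_sub_trunc_le hmn (h τ)
      gcongr
    simp only [ε]
    linarith
  -- Time is clamped to [0, T], so that the convergence is uniform on ℝ and the limit is continuous
  -- on ℝ, as a flow has to be.
  let c : ℝ → ℝ := fun t => max 0 (min t T)
  have hcc : Continuous c := by fun_prop
  have hcI : ∀ t, c t ∈ Icc 0 T := fun t => ⟨le_max_left _ _, max_le hT (min_le_right _ _)⟩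
  have hceq : ∀ t ∈ Icc 0 T, c t = t := fun t ht => by
    simp only [c]; rw [min_eq_left ht.2, max_eq_right ht.1]
  have hb : Tendsto (fun m => 2 * √(ε m)) atTop (𝓝 0) := by
    simpa using (hε.sqrt).const_mul 2
  have hcau : ∀ t, CauchySeq fun n => S n (c t) := fun t => by
    refine cauchySeq_of_le_tendsto_0 (fun m => 2 * √(ε m)) (fun n m k hn hm => ?_) hb
    have h1 := hdist k n hn (c t) (hcI t)
    have h2 := hdist k m hm (c t) (hcI t)
    rw [dist_comm] at h2
    linarith [dist_triangle (S n (c t)) (S k (c t)) (S m (c t))]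
  choose s hs using fun t => cauchySeq_tendsto_of_complete (hcau t)
  have hunif : TendstoUniformly (fun n t => S n (c t)) s atTop := by
    refine Metric.tendstoUniformly_iff.2 fun δ hδ => ?_
    filter_upwards [hb.eventually (gt_mem_nhds hδ)] with m hm t
    refine lt_of_le_of_lt ?_ hm
    have h1 : dist (s t) (S m (c t)) ≤ √(ε m) :=
      le_of_tendsto ((hs t).dist tendsto_const_nhds)
        ((eventually_ge_atTop m).mono fun n hn => hdist m n hn (c t) (hcI t))
    linarith [Real.sqrt_nonneg (ε m)]
  have hsc : Continuous s := hunif.continuous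
    (Frequently.of_forall fun n => (hSc n).comp hcc)
  have hcoef : ∀ k, ∀ t ∈ Icc 0 T, ⟪eX k, s t⟫ = σ k t := fun k t ht => by
    have h1 : Tendsto (fun n => ⟪eX k, S n (c t)⟫) atTop (𝓝 ⟪eX k, s t⟫) :=
      tendsto_const_nhds.inner (hs t)
    refine tendsto_nhds_unique h1 (tendsto_const_nhds.congr' ?_)
    filter_upwards [eventually_gt_atTop k] with n hn
    rw [hceq t ht]
    simp only [S, eX.inner_sum_smul_right, if_pos hn]
  have h00 : (0 : ℝ) ∈ Icc 0 T := ⟨le_rfl, hT⟩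
  refine ⟨s, ⟨hsc, hh, fun k t ht => ?_⟩, eX.ext_inner fun k => by rw [hcoef k 0 h00, hσ0]⟩
  rw [hcoef k t ht, hcoef k 0 h00, hσ0, hσe]
  congr 1
  refine intervalIntegral.integral_congr fun τ hτ => ?_
  rw [uIcc_of_le ht.1] at hτ
  simp only [hcoef k τ ⟨hτ.1, hτ.2.trans ht.2⟩]

/-- Picard iteration in the weighted norm sup e^(-lt)‖s(t)‖, which contracts on an interval of any
length when l is large. -/
theorem exists_flow_of_lipschitz [CompleteSpace X] (D : DiagonalEmbedding ι eX eH μ) {T : ℝ}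
    (hT : 0 ≤ T) (x₀ : X) {g : ℝ → H} (hg : Continuous g) {N : X → H} {L : ℝ}
    (hN : ∀ x y, ‖N x - N y‖ ≤ L * ‖x - y‖) :
    ∃ s, IsLinearFlow eX eH μ T s (fun τ => g τ - N (s τ)) ∧ s 0 = x₀ := by
  have hNc : Continuous N := continuous_of_lipschitz_on_balls fun _ => ⟨L, fun x y _ _ => hN x y⟩
  -- The energy estimate gives squared distances at most L²d²(e^(2lt) - 1)/(4l), which is at most (d
  -- e^(lt)/2)² once l ≥ L²; the added 1 keeps l positive.
  set l : ℝ := L ^ 2 + 1 with hl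
  have hl0 : 0 < l := by positivity
  -- The unknown v stores the curve multiplied by e^(-lt), so that its plain sup-norm is the
  -- weighted norm; w undoes the weight.
  let w : C(Icc 0 T, X) → ℝ → X := fun v τ => Real.exp (l * τ) • v (projIcc 0 T hT τ)
  have hw : ∀ v, Continuous (w v) := fun v => by
    have : Continuous fun τ => v (projIcc 0 T hT τ) := v.continuous.comp continuous_projIcc
    fun_prop
  have hF : ∀ v, Continuous fun τ => g τ - N (w v τ) := fun v => by
    have := hw v
    fun_prop
  choose Sol hSol hSol0 using fun v => D.exists_linearFlow hT x₀ (hF v)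
  have hSolc : ∀ v, Continuous (Sol v) := fun v => (hSol v).continuous
  let P : C(Icc 0 T, X) → C(Icc 0 T, X) := fun v =>
    ⟨fun t => Real.exp (-(l * t)) • Sol v t, by have := hSolc v; fun_prop⟩
  have hP : ContractingWith (1 / 2) P := by
    refine ⟨by rw [← NNReal.coe_lt_coe]; norm_num, LipschitzWith.of_dist_le_mul fun v v' => ?_⟩
    refine (ContinuousMap.dist_le (by positivity)).2 fun t => ?_
    set d := dist v v' with hd
    have hd0 : 0 ≤ d := dist_nonneg
    have h1 := D.linear_energy_le ((hSol v).sub (hSol v')) le_rfl t.2.1 t.2.2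
    rw [hSol0, hSol0, sub_self, norm_zero] at h1
    have h2 : ∫ τ in (0 : ℝ)..t, ‖(g τ - N (w v τ)) - (g τ - N (w v' τ))‖ ^ 2 / 4 ≤
        ∫ τ in (0 : ℝ)..t, (L ^ 2 * d ^ 2 / 4) * Real.exp (2 * l * τ) := by
      refine intervalIntegral.integral_mono_on t.2.1 ?_ ?_ fun τ _ => ?_
      · have := hF v
        have := hF v'
        exact Continuous.intervalIntegrable (by fun_prop) _ _
      · exact Continuous.intervalIntegrable (by fun_prop) _ _
      · have h3 : ‖(g τ - N (w v τ)) - (g τ - N (w v' τ))‖ ≤ |L| * (Real.exp (l * τ) * d) := by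
          rw [sub_sub_sub_cancel_left]
          refine (hN _ _).trans ?_
          refine mul_le_mul (le_abs_self L) ?_ (norm_nonneg _) (abs_nonneg _)
          rw [norm_sub_rev, ← smul_sub, norm_smul, Real.norm_of_nonneg (Real.exp_pos _).le]
          gcongr
          rw [← dist_eq_norm]
          exact ContinuousMap.dist_apply_le_dist _
        have h4 := pow_le_pow_left₀ (norm_nonneg _) h3 2
        have h5 : Real.exp (2 * l * τ) = Real.exp (l * τ) ^ 2 := by
          rw [← Real.exp_nat_mul]; congr 1; push_cast; ring
        rw [mul_pow, mul_pow, sq_abs] at h4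
        rw [h5]
        linarith
    have h6 : ∫ τ in (0 : ℝ)..t, (L ^ 2 * d ^ 2 / 4) * Real.exp (2 * l * τ) =
        (L ^ 2 * d ^ 2 / 4) * ((2 * l)⁻¹ * (Real.exp (2 * l * t) - 1)) := by
      rw [intervalIntegral.integral_const_mul]
      have := intervalIntegral.integral_comp_mul_left (a := 0) (b := (t : ℝ)) Real.exp
        (c := 2 * l) (by positivity)
      rw [this, integral_exp]
      simp
    have h7 : ‖Sol v t - Sol v' t‖ ^ 2 ≤ (1 / 2 * d * Real.exp (l * t)) ^ 2 := by
      have h8 : Real.exp (2 * l * t) = Real.exp (l * t) ^ 2 := by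
        rw [← Real.exp_nat_mul]; congr 1; push_cast; ring
      rw [h6, h8] at h2
      have h9 : (L ^ 2 * d ^ 2 / 4) * ((2 * l)⁻¹ * (Real.exp (l * t) ^ 2 - 1)) ≤
          d ^ 2 / 8 * Real.exp (l * t) ^ 2 := by
        have : (L ^ 2 * d ^ 2 / 4) * ((2 * l)⁻¹ * (Real.exp (l * t) ^ 2 - 1)) =
            (L ^ 2 / l) * (d ^ 2 / 8 * (Real.exp (l * t) ^ 2 - 1)) := by
          field_simp; ring
        rw [this]
        have h10 : L ^ 2 / l ≤ 1 := (div_le_one hl0).2 (by linarith)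
        have h11 : 0 ≤ L ^ 2 / l := by positivity
        have h12 : 1 ≤ Real.exp (l * t) := Real.one_le_exp (mul_nonneg hl0.le t.2.1)
        have h13 : 0 ≤ d ^ 2 / 8 * (Real.exp (l * t) ^ 2 - 1) :=
          mul_nonneg (by positivity) (by nlinarith)
        nlinarith [sq_nonneg d]
      nlinarith
    have h14 := le_of_sq_le_sq h7 (by positivity)
    have h15 : dist (P v t) (P v' t) = Real.exp (-(l * t)) * ‖Sol v t - Sol v' t‖ := by
      rw [dist_eq_norm]
      change ‖Real.exp (-(l * t)) • Sol v t - Real.exp (-(l * t)) • Sol v' t‖ = _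
      rw [← smul_sub, norm_smul, Real.norm_of_nonneg (Real.exp_pos _).le]
    rw [h15]
    have h16 : Real.exp (-(l * t)) * Real.exp (l * t) = 1 := by rw [← Real.exp_add]; simp
    calc Real.exp (-(l * t)) * ‖Sol v t - Sol v' t‖
        ≤ Real.exp (-(l * t)) * (1 / 2 * d * Real.exp (l * t)) := by gcongr
      _ = 1 / 2 * d * (Real.exp (-(l * t)) * Real.exp (l * t)) := by ring
      _ = 1 / 2 * d := by rw [h16, mul_one]
      _ = _ := by simp
  have : Nonempty C(Icc 0 T, X) := ⟨0⟩
  set v := hP.fixedPoint P with hv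
  have hfix : P v = v := hP.fixedPoint_isFixedPt
  refine ⟨Sol v, (hSol v).congr (hSolc v) (by have := hSolc v; fun_prop)
    (fun _ _ => rfl) fun t ht => ?_, hSol0 v⟩
  have h1 : w v t = Sol v t := by
    simp only [w]
    rw [projIcc_of_mem hT ht]
    have h2 : v ⟨t, ht⟩ = Real.exp (-(l * t)) • Sol v t := by
      conv_lhs => rw [← hfix]
      rfl
    rw [h2, smul_smul, ← Real.exp_add]
    simp
  rw [h1]

end DiagonalEmbedding

end


/-! ### Continuous functions as elements of `L₂(0, π)` -/

/-- Lebesgue measure on `(0, π)`. -/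
abbrev volPi : Measure ℝ := volume.restrict (Ioo 0 Real.pi)

theorem volPi_real_univ : volPi.real univ = Real.pi := by
  simp [measureReal_def, Real.pi_pos.le]

theorem integral_volPi (g : ℝ → ℝ) : ∫ x, g x ∂volPi = ∫ x in (0 : ℝ)..Real.pi, g x := by
  rw [intervalIntegral.integral_of_le Real.pi_pos.le, integral_Ioc_eq_integral_Ioo]

theorem memLp_volPi_of_continuous {ψ : ℝ → ℝ} (hψ : Continuous ψ) : MemLp ψ 2 volPi := by
  obtain ⟨C, hC⟩ := (isCompact_Icc (a := 0) (b := Real.pi)).exists_bound_of_continuousOn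
    hψ.continuousOn
  refine MemLp.of_bound hψ.aestronglyMeasurable C ?_
  filter_upwards [ae_restrict_mem measurableSet_Ioo] with x hx
  exact hC x (Ioo_subset_Icc_self hx)

/-- A continuous function as an element of `L₂(0, π)`. -/
def ofContinuous (ψ : ℝ → ℝ) (hψ : Continuous ψ) : L2pi :=
  (memLp_volPi_of_continuous hψ).toLp ψ

theorem coeFn_ofContinuous {ψ : ℝ → ℝ} (hψ : Continuous ψ) : ofContinuous ψ hψ =ᵐ[volPi] ψ :=
  MemLp.coeFn_toLp _

theorem L2pi.inner_eq (v w : L2pi) : ⟪v, w⟫ = ∫ x, v x * w x ∂volPi := by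
  rw [L2.inner_def]
  exact integral_congr_ae (Eventually.of_forall fun x => by simp [mul_comm])

theorem L2pi.integrable_mul (v w : L2pi) : Integrable (fun x => v x * w x) volPi :=
  (Lp.memLp v).integrable_mul (Lp.memLp w)

theorem L2pi.norm_sq_eq (v : L2pi) : ‖v‖ ^ 2 = ∫ x, v x ^ 2 ∂volPi := by
  rw [← real_inner_self_eq_norm_sq, L2pi.inner_eq]
  simp only [sq]

theorem inner_ofContinuous (v : L2pi) {ψ : ℝ → ℝ} (hψ : Continuous ψ) :
    ⟪v, ofContinuous ψ hψ⟫ = ∫ x, v x * ψ x ∂volPi := by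
  rw [L2pi.inner_eq]
  refine integral_congr_ae ?_
  filter_upwards [coeFn_ofContinuous hψ] with x hx
  rw [hx]

theorem inner_ofContinuous_ofContinuous {φ ψ : ℝ → ℝ} (hφ : Continuous φ) (hψ : Continuous ψ) :
    ⟪ofContinuous φ hφ, ofContinuous ψ hψ⟫ = ∫ x in (0 : ℝ)..Real.pi, φ x * ψ x := by
  rw [inner_ofContinuous, ← integral_volPi]
  refine integral_congr_ae ?_
  filter_upwards [coeFn_ofContinuous hφ] with x hx
  rw [hx]

theorem L2pi.norm_le_of_ae_bound (v : L2pi) {C : ℝ} (hC : 0 ≤ C) (h : ∀ᵐ x ∂volPi, |v x| ≤ C) :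
    ‖v‖ ≤ √Real.pi * C := by
  refine le_of_sq_le_sq ?_ (by positivity)
  rw [L2pi.norm_sq_eq, mul_pow, Real.sq_sqrt Real.pi_pos.le]
  calc ∫ x, v x ^ 2 ∂volPi ≤ ∫ _, C ^ 2 ∂volPi := by
        refine integral_mono_ae ?_ (integrable_const _) ?_
        · simpa only [sq] using L2pi.integrable_mul v v
        · filter_upwards [h] with x hx
          exact sq_le_sq' (by linarith [(abs_le.1 hx).1]) (abs_le.1 hx).2
    _ = Real.pi * C ^ 2 := by rw [integral_const, volPi_real_univ, smul_eq_mul]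

/-- The constant function `1`. -/
def oneL2 : L2pi := ofContinuous (fun _ => 1) continuous_const

theorem norm_oneL2 : ‖oneL2‖ = √Real.pi := by
  have h : ‖oneL2‖ ^ 2 = Real.pi := by
    rw [← real_inner_self_eq_norm_sq, oneL2, inner_ofContinuous_ofContinuous]; simp
  exact (Real.sqrt_sq (norm_nonneg oneL2)).symm.trans (congrArg Real.sqrt h)

theorem integral_abs_le_norm (v : L2pi) : ∫ x, |v x| ∂volPi ≤ √Real.pi * ‖v‖ := by
  have h : ∫ x, |v x| ∂volPi = ⟪|v|, oneL2⟫ := by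
    rw [oneL2, inner_ofContinuous]
    refine integral_congr_ae ?_
    filter_upwards [Lp.coeFn_abs v] with x hx
    rw [hx, mul_one]
  rw [h, ← norm_oneL2, mul_comm]
  refine (real_inner_le_norm _ _).trans ?_
  rw [norm_abs_eq_norm]

theorem L2pi.integrable (v : L2pi) : Integrable v volPi :=
  (Lp.memLp v).integrable one_le_two

/-! ### The primitive operator -/

/-- The primitive of `v` that vanishes at `0`. -/
def primitive (v : L2pi) (x : ℝ) : ℝ := ∫ y in (0 : ℝ)..x, v y ∂volPi

theorem continuous_primitive (v : L2pi) : Continuous (primitive v) :=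
  intervalIntegral.continuous_primitive (fun _ _ => v.integrable.intervalIntegrable) 0

theorem abs_primitive_le (v : L2pi) (x : ℝ) : |primitive v x| ≤ √Real.pi * ‖v‖ := by
  have h := intervalIntegral.norm_integral_le_integral_norm_uIoc (f := v) (a := 0) (b := x)
    (μ := volPi)
  refine h.trans (le_trans ?_ (integral_abs_le_norm v))
  exact setIntegral_le_integral v.integrable.abs (Eventually.of_forall fun _ => abs_nonneg _)

theorem primitive_ofContinuous {ψ : ℝ → ℝ} (hψ : Continuous ψ) {x : ℝ} (hx : x ∈ Ioo 0 Real.pi) :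
    primitive (ofContinuous ψ hψ) x = ∫ y in (0 : ℝ)..x, ψ y := by
  have h1 : primitive (ofContinuous ψ hψ) x = ∫ y in (0 : ℝ)..x, ψ y ∂volPi :=
    intervalIntegral.integral_congr_ae
      ((coeFn_ofContinuous hψ).mono fun y hy _ => hy)
  rw [h1, intervalIntegral.integral_of_le hx.1.le, intervalIntegral.integral_of_le hx.1.le,
    Measure.restrict_restrict measurableSet_Ioc,
    show Ioc 0 x ∩ Ioo 0 Real.pi = Ioc 0 x from
      inter_eq_left.2 fun y hy => ⟨hy.1, hy.2.trans_lt hx.2⟩]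

/-- The primitive as a bounded operator. -/
def primitiveL : L2pi →L[ℝ] L2pi :=
  LinearMap.mkContinuous
    { toFun := fun v => ofContinuous (primitive v) (continuous_primitive v)
      map_add' := fun v w => by
        refine Lp.ext ?_
        filter_upwards [coeFn_ofContinuous (continuous_primitive (v + w)),
          coeFn_ofContinuous (continuous_primitive v), coeFn_ofContinuous (continuous_primitive w),
          Lp.coeFn_add (ofContinuous (primitive v) (continuous_primitive v))
            (ofContinuous (primitive w) (continuous_primitive w))] with x h1 h2 h3 h4
        rw [h1, h4, Pi.add_apply, h2, h3]
        unfold primitive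
        rw [← intervalIntegral.integral_add v.integrable.intervalIntegrable
          w.integrable.intervalIntegrable]
        exact intervalIntegral.integral_congr_ae ((Lp.coeFn_add v w).mono fun y hy _ => hy)
      map_smul' := fun c v => by
        refine Lp.ext ?_
        filter_upwards [coeFn_ofContinuous (continuous_primitive (c • v)),
          coeFn_ofContinuous (continuous_primitive v),
          Lp.coeFn_smul c (ofContinuous (primitive v) (continuous_primitive v))] with x h1 h2 h3
        rw [RingHom.id_apply, h1, h3, Pi.smul_apply, h2]
        unfold primitive
        rw [smul_eq_mul, ← intervalIntegral.integral_const_mul]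
        exact intervalIntegral.integral_congr_ae ((Lp.coeFn_smul c v).mono fun y hy _ => hy) }
    Real.pi fun v => by
      refine (L2pi.norm_le_of_ae_bound _ (C := √Real.pi * ‖v‖) (by positivity) ?_).trans ?_
      · exact (coeFn_ofContinuous (continuous_primitive v)).mono fun x hx => by
          rw [LinearMap.coe_mk, AddHom.coe_mk, hx]; exact abs_primitive_le v x
      · rw [← mul_assoc, Real.mul_self_sqrt Real.pi_pos.le]

theorem coeFn_primitiveL (v : L2pi) : primitiveL v =ᵐ[volPi] primitive v :=
  coeFn_ofContinuous (continuous_primitive v)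

/-! ### Test functions -/

namespace IsTestFun

variable {ψ : ℝ → ℝ} {k : ℕ∞}

theorem of_top (h : IsTestFun ⊤ ψ) : IsTestFun 1 ψ :=
  ⟨h.1.of_le (by exact_mod_cast le_top), h.2, h.3⟩

theorem apply_zero (h : IsTestFun k ψ) : ψ 0 = 0 := by
  by_contra hne
  exact absurd (h.3 (subset_tsupport ψ hne)).1 (lt_irrefl _)

theorem apply_pi (h : IsTestFun k ψ) : ψ Real.pi = 0 := by
  by_contra hne
  exact absurd (h.3 (subset_tsupport ψ hne)).2 (lt_irrefl _)

theorem continuous (h : IsTestFun k ψ) : Continuous ψ := h.1.continuous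

theorem continuous_deriv (h : IsTestFun 1 ψ) : Continuous (deriv ψ) :=
  h.1.continuous_deriv (by simp)

theorem hasDerivAt (h : IsTestFun 1 ψ) (x : ℝ) : HasDerivAt ψ (deriv ψ x) x :=
  (h.1.differentiable (by simp) x).hasDerivAt

theorem exists_Icc (h : IsTestFun k ψ) :
    ∃ α β, 0 < α ∧ α ≤ β ∧ β < Real.pi ∧ ∀ x, x ∉ Icc α β → ψ x = 0 := by
  rcases (tsupport ψ).eq_empty_or_nonempty with h0 | hne
  · refine ⟨Real.pi / 2, Real.pi / 2, Real.pi_div_two_pos, le_rfl,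
      half_lt_self Real.pi_pos, fun x _ => ?_⟩
    rw [tsupport_eq_empty_iff.1 h0]; rfl
  · have hK : IsCompact (tsupport ψ) := h.2
    obtain ⟨α, hα⟩ := hK.exists_isLeast hne
    obtain ⟨β, hβ⟩ := hK.exists_isGreatest hne
    exact ⟨α, β, (h.3 hα.1).1, hα.2 hβ.1, (h.3 hβ.1).2, fun x hx => by
      by_contra h1
      have h2 := subset_tsupport ψ h1
      exact hx ⟨hα.2 h2, hβ.2 h2⟩⟩

theorem of_Icc (h : ContDiff ℝ k ψ) {α β : ℝ} (hα : 0 < α) (hβ : β < Real.pi)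
    (h0 : ∀ x, x ∉ Icc α β → ψ x = 0) : IsTestFun k ψ := by
  have h1 : tsupport ψ ⊆ Icc α β :=
    closure_minimal (fun x hx => by by_contra hc; exact hx (h0 x hc)) isClosed_Icc
  exact ⟨h, HasCompactSupport.intro isCompact_Icc fun x hx => h0 x hx,
    h1.trans (Icc_subset_Ioo hα hβ)⟩

/-- The primitive of a test function with vanishing integral is a test function. -/
theorem exists_primitive (h : IsTestFun ⊤ ψ) (h0 : ∫ x in (0 : ℝ)..Real.pi, ψ x = 0) :
    ∃ η, IsTestFun ⊤ η ∧ deriv η = ψ := by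
  obtain ⟨α, β, hα, hαβ, hβ, hz⟩ := h.exists_Icc
  set η : ℝ → ℝ := fun x => ∫ y in (0 : ℝ)..x, ψ y with hη
  have hd : ∀ x, HasDerivAt η (ψ x) x := fun x =>
    (h.continuous.integral_hasStrictDerivAt 0 x).hasDerivAt
  have hder : deriv η = ψ := funext fun x => (hd x).deriv
  have hi : ∀ a b, IntervalIntegrable ψ volume a b := fun a b =>
    h.continuous.intervalIntegrable a b
  refine ⟨η, of_Icc (contDiff_infty_iff_deriv.2
    ⟨fun x => (hd x).differentiableAt, by rw [hder]; exact h.1⟩) hα hβ fun x hx => ?_, hder⟩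
  rcases lt_or_ge x α with h1 | h1
  · have : ∫ y in (0 : ℝ)..x, ψ y = ∫ y in (0 : ℝ)..x, (0 : ℝ) := by
      refine intervalIntegral.integral_congr fun y hy => hz y fun hy' => ?_
      have h2 : y ≤ max 0 x := hy.2
      exact absurd (hy'.1.trans h2) (not_le.2 (max_lt hα h1))
    simp [hη, this]
  · have h2 : β < x := by by_contra h2; exact hx ⟨h1, not_lt.1 h2⟩
    have h3 : ∫ y in x..Real.pi, ψ y = ∫ y in x..Real.pi, (0 : ℝ) := by
      refine intervalIntegral.integral_congr fun y hy => hz y fun hy' => ?_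
      have h4 : min x Real.pi ≤ y := hy.1
      exact absurd (h4.trans hy'.2) (not_le.2 (lt_min h2 hβ))
    have h5 := intervalIntegral.integral_add_adjacent_intervals (hi 0 x) (hi x Real.pi)
    rw [h0, h3, intervalIntegral.integral_zero, add_zero] at h5
    exact h5

theorem exists_integral_eq_one : ∃ η, IsTestFun ⊤ η ∧ ∫ x in (0 : ℝ)..Real.pi, η x = 1 := by
  let B : ContDiffBump (Real.pi / 2) := ⟨1 / 2, 1, by norm_num, by norm_num⟩
  have h3 := Real.pi_gt_three
  have hs : ∀ x, x ∉ Icc (Real.pi / 2 - 1) (Real.pi / 2 + 1) → B.normed volume x = 0 := by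
    intro x hx
    by_contra hne
    have h1 : x ∈ tsupport (B.normed volume) := subset_tsupport _ hne
    rw [B.tsupport_normed_eq, Real.closedBall_eq_Icc] at h1
    exact hx h1
  refine ⟨B.normed volume, of_Icc B.contDiff_normed (by linarith) (by linarith) hs, ?_⟩
  rw [intervalIntegral.integral_eq_integral_of_support_subset, B.integral_normed]
  intro x hx
  have h1 : x ∈ Icc (Real.pi / 2 - 1) (Real.pi / 2 + 1) := by
    by_contra hc; exact hx (hs x hc)
  exact ⟨by linarith [h1.1], by linarith [h1.2]⟩

/-- For correcting a test function to mean zero, which makes it the derivative of another test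
function. -/
theorem sub_const_mul {η : ℝ → ℝ} (h : IsTestFun k ψ) (h' : IsTestFun k η) (c : ℝ) :
    IsTestFun k fun x => ψ x - c * η x := by
  obtain ⟨α, β, hα, -, hβ, hz⟩ := h.exists_Icc
  obtain ⟨α', β', hα', -, hβ', hz'⟩ := h'.exists_Icc
  refine of_Icc (h.1.sub (contDiff_const.mul h'.1)) (lt_min hα hα') (max_lt hβ hβ') fun x hx => ?_
  rw [hz x fun hm => hx ⟨(min_le_left _ _).trans hm.1, hm.2.trans (le_max_left _ _)⟩,
    hz' x fun hm => hx ⟨(min_le_right _ _).trans hm.1, hm.2.trans (le_max_right _ _)⟩]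
  simp

end IsTestFun

theorem L2pi.eq_zero_of_inner_test {v : L2pi}
    (h : ∀ φ (hφ : IsTestFun ⊤ φ), ⟪v, ofContinuous φ hφ.continuous⟫ = 0) : v = 0 := by
  have h1 : ∀ᵐ x ∂(volume : Measure ℝ), x ∈ Ioo 0 Real.pi → v x = 0 := by
    refine isOpen_Ioo.ae_eq_zero_of_integral_contDiff_smul_eq_zero
      (IntegrableOn.locallyIntegrableOn v.integrable) fun g hg hc hs => ?_
    have hφ : IsTestFun ⊤ g := ⟨hg, hc, hs⟩
    have h2 := h g hφ
    rw [inner_ofContinuous] at h2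
    refine (setIntegral_eq_integral_of_forall_compl_eq_zero (s := Ioo 0 Real.pi)
      fun x hx => ?_).symm.trans (Eq.trans ?_ h2)
    · have : g x = 0 := by by_contra hne; exact hx (hs (subset_tsupport g hne))
      simp [this]
    · exact integral_congr_ae (Eventually.of_forall fun x => mul_comm _ _)
  refine Lp.ext ?_
  filter_upwards [(ae_restrict_iff' measurableSet_Ioo).2 h1, Lp.coeFn_zero ℝ 2 volPi] with x h2 h3
  rw [h2, h3]; rfl

/-- The lemma of du Bois-Reymond. -/
theorem L2pi.eq_const_of_inner_deriv_test {v : L2pi}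
    (h : ∀ φ (hφ : IsTestFun ⊤ φ), ⟪v, ofContinuous (deriv φ) hφ.of_top.continuous_deriv⟫ = 0) :
    ∃ c : ℝ, v = c • oneL2 := by
  obtain ⟨η, hη, hη1⟩ := IsTestFun.exists_integral_eq_one
  refine ⟨⟪v, ofContinuous η hη.continuous⟫, sub_eq_zero.1 (L2pi.eq_zero_of_inner_test
    fun φ hφ => ?_)⟩
  -- With ∫ η = 1, the function φ - Iη has mean zero and is the derivative of a test function. Hence
  -- ⟨v, φ⟩ = I⟨v, η⟩, that is, v acts as the constant ⟨v, η⟩.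
  set I := ∫ x in (0 : ℝ)..Real.pi, φ x with hI
  have hψ := hφ.sub_const_mul hη I
  obtain ⟨ζ, hζ, hd⟩ := hψ.exists_primitive (by
    rw [intervalIntegral.integral_sub (hφ.continuous.intervalIntegrable _ _)
      ((hη.continuous.intervalIntegrable _ _).const_mul _), intervalIntegral.integral_const_mul,
      hη1, mul_one, sub_self])
  have h1 := h ζ hζ
  rw [inner_ofContinuous, hd] at h1
  have i1 : Integrable (fun x => v x * φ x) volPi :=
    (Lp.memLp v).integrable_mul (memLp_volPi_of_continuous hφ.continuous)
  have i2 : Integrable (fun x => v x * η x) volPi :=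
    (Lp.memLp v).integrable_mul (memLp_volPi_of_continuous hη.continuous)
  have h2 : ∫ x, v x * (φ x - I * η x) ∂volPi =
      ∫ x, v x * φ x ∂volPi - I * ∫ x, v x * η x ∂volPi := by
    rw [← integral_const_mul, ← integral_sub i1 (i2.const_mul I)]
    exact integral_congr_ae (Eventually.of_forall fun x => by ring)
  rw [h2] at h1
  rw [inner_sub_left, real_inner_smul_left, oneL2, inner_ofContinuous_ofContinuous,
    inner_ofContinuous, inner_ofContinuous]
  simp only [one_mul]
  rw [← hI]
  linarith

/-! ### `H¹₀(0, π)` as a Hilbert space -/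

namespace H10

/-- The induction principle of the closure that defines H¹₀: closed conditions need to be checked on
test functions only. -/
theorem mem_of_isClosed {C : Set (L2pi × L2pi)} (hC : IsClosed C)
    (h : ∀ ψ (hψ : IsTestFun 1 ψ),
      (ofContinuous ψ hψ.continuous, ofContinuous (deriv ψ) hψ.continuous_deriv) ∈ C) (s : H10) :
    (toL2 s, dx s) ∈ C := by
  refine hC.closure_subset_iff.2 ?_ s.2
  rintro p ⟨ψ, hψ, h1, h2⟩
  have e1 : p.1 = ofContinuous ψ hψ.continuous := Lp.ext (h1.trans (coeFn_ofContinuous _).symm)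
  have e2 : p.2 = ofContinuous (deriv ψ) hψ.continuous_deriv :=
    Lp.ext (h2.trans (coeFn_ofContinuous _).symm)
  have := h ψ hψ
  rwa [← e1, ← e2] at this

theorem norm_eq (s : H10) : ‖s‖ = ‖dx s‖ := rfl

/-- This recovers a state from its derivative and gives the embedding into bounded functions on
which all nonlinear estimates rest. -/
theorem toL2_eq_primitiveL (s : H10) : toL2 s = primitiveL (dx s) := by
  refine mem_of_isClosed (C := {p | p.1 = primitiveL p.2})
    (isClosed_eq (by fun_prop) (by fun_prop)) (fun ψ hψ => ?_) s
  refine Lp.ext ?_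
  filter_upwards [coeFn_ofContinuous hψ.continuous, ae_restrict_mem measurableSet_Ioo,
    coeFn_primitiveL (ofContinuous (deriv ψ) hψ.continuous_deriv)] with x h1 h2 h3
  rw [h1, h3, primitive_ofContinuous _ h2, intervalIntegral.integral_deriv_eq_sub
    (fun y _ => hψ.1.differentiable (by simp) y) (hψ.continuous_deriv.intervalIntegrable _ _),
    hψ.apply_zero, sub_zero]

theorem abs_toL2_le (s : H10) : ∀ᵐ x ∂volPi, |toL2 s x| ≤ √Real.pi * ‖s‖ := by
  rw [toL2_eq_primitiveL]
  exact (coeFn_primitiveL (dx s)).mono fun x hx => by rw [hx]; exact abs_primitive_le _ _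

/-- Integration by parts. -/
theorem inner_dx (s : H10) {χ χ' : ℝ → ℝ} (hd : ∀ x, HasDerivAt χ (χ' x) x) (hχ : Continuous χ)
    (hχ' : Continuous χ') :
    ⟪ofContinuous χ hχ, dx s⟫ = -⟪ofContinuous χ' hχ', toL2 s⟫ := by
  refine mem_of_isClosed (C := {p | ⟪ofContinuous χ hχ, p.2⟫ = -⟪ofContinuous χ' hχ', p.1⟫})
    (isClosed_eq (by fun_prop) (by fun_prop)) (fun ψ hψ => ?_) s
  change ⟪_, _⟫ = -⟪_, _⟫
  rw [inner_ofContinuous_ofContinuous, inner_ofContinuous_ofContinuous,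
    intervalIntegral.integral_mul_deriv_eq_deriv_mul (fun x _ => hd x)
      (fun x _ => hψ.hasDerivAt x) (hχ'.intervalIntegrable _ _)
      (hψ.continuous_deriv.intervalIntegrable _ _), hψ.apply_pi, hψ.apply_zero]
  ring

theorem inner_one_dx (s : H10) : ⟪oneL2, dx s⟫ = 0 := by
  have h := inner_dx s (fun x => hasDerivAt_const x (1 : ℝ)) continuous_const continuous_const
  rw [oneL2, h, real_inner_comm, inner_ofContinuous]
  simp

theorem toL2_injective : Function.Injective toL2 := by
  rw [← LinearMap.ker_eq_bot, LinearMap.ker_eq_bot']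
  intro s hs
  refine dx_injective (Eq.trans (L2pi.eq_zero_of_inner_test fun φ hφ => ?_) (map_zero dx).symm)
  rw [real_inner_comm, inner_dx s hφ.of_top.hasDerivAt hφ.continuous hφ.of_top.continuous_deriv,
    hs, inner_zero_right, neg_zero]

/-- A test function as an element of `H¹₀(0, π)`. -/
def ofTest (ψ : ℝ → ℝ) (hψ : IsTestFun 1 ψ) : H10 :=
  ⟨(ofContinuous ψ hψ.continuous, ofContinuous (deriv ψ) hψ.continuous_deriv),
    subset_closure ⟨ψ, hψ, coeFn_ofContinuous hψ.continuous, coeFn_ofContinuous hψ.continuous_deriv⟩⟩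

theorem toL2_ofTest {ψ : ℝ → ℝ} (hψ : IsTestFun 1 ψ) :
    toL2 (ofTest ψ hψ) = ofContinuous ψ hψ.continuous := rfl

theorem dx_ofTest {ψ : ℝ → ℝ} (hψ : IsTestFun 1 ψ) :
    dx (ofTest ψ hψ) = ofContinuous (deriv ψ) hψ.continuous_deriv := rfl

/-- Functions with mean zero are weak derivatives. -/
theorem exists_dx_eq {y : L2pi} (hy : ⟪oneL2, y⟫ = 0) : ∃ s : H10, dx s = y := by
  let D : Set L2pi := {v | ∃ ψ, ∃ hψ : IsTestFun ⊤ ψ,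
    v = ofContinuous (deriv ψ) hψ.of_top.continuous_deriv}
  let W : Submodule ℝ (L2pi) := Submodule.span ℝ D
  -- By du Bois-Reymond, only constants are orthogonal to the derivatives of test functions, so y is
  -- a limit of such derivatives. The continuous map v ↦ (primitive of v, v) carries this limit into
  -- the closed graph.
  have h1 : y ∈ Wᗮᗮ := by
    rw [Submodule.mem_orthogonal]
    intro v hv
    obtain ⟨c, rfl⟩ := L2pi.eq_const_of_inner_deriv_test (v := v) fun φ hφ => by
      rw [real_inner_comm]
      exact (Submodule.mem_orthogonal _ _).1 hv _ (Submodule.subset_span ⟨φ, hφ, rfl⟩)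
    rw [real_inner_smul_left, hy, mul_zero]
  rw [Submodule.orthogonal_orthogonal_eq_closure] at h1
  let P : L2pi →L[ℝ] L2pi × L2pi := primitiveL.prod (ContinuousLinearMap.id ℝ L2pi)
  have h2 : W.topologicalClosure ≤ testGraph.topologicalClosure.comap P.toLinearMap := by
    refine Submodule.topologicalClosure_minimal _ (Submodule.span_le.2 ?_)
      ((Submodule.isClosed_topologicalClosure _).preimage P.continuous)
    rintro v ⟨ψ, hψ, rfl⟩
    have h3 := (ofTest ψ hψ.of_top).2
    have h4 : (ofTest ψ hψ.of_top).1 =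
        P (ofContinuous (deriv ψ) hψ.of_top.continuous_deriv) :=
      Prod.ext (toL2_eq_primitiveL (ofTest ψ hψ.of_top)) rfl
    rw [h4] at h3
    exact h3
  exact ⟨⟨P y, h2 h1⟩, rfl⟩

instance : InnerProductSpace ℝ H10 where
  inner s s' := ⟪dx s, dx s'⟫
  norm_sq_eq_re_inner s := norm_sq_eq_re_inner (𝕜 := ℝ) (dx s)
  conj_inner_symm s s' := inner_conj_symm (𝕜 := ℝ) (dx s) (dx s')
  add_left s s' s'' := by rw [map_add, inner_add_left]
  smul_left s s' r := by rw [map_smul, inner_smul_left]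

theorem inner_eq (s s' : H10) : ⟪s, s'⟫ = ⟪dx s, dx s'⟫ := rfl

theorem isometry_dx : Isometry dx := AddMonoidHomClass.isometry_of_norm dx fun _ => rfl

instance : CompleteSpace H10 := by
  refine (completeSpace_iff_isComplete_range isometry_dx.isUniformInducing).2
    (IsClosed.isComplete ?_)
  have : range dx = {y | ⟪oneL2, y⟫ = 0} := by
    ext y
    exact ⟨fun ⟨s, hs⟩ => hs ▸ inner_one_dx s, fun hy => exists_dx_eq hy⟩
  rw [this]
  exact isClosed_eq (by fun_prop) continuous_const

/-- The embedding of `H¹₀(0, π)` into `L₂(0, π)`. -/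
def toL2L : H10 →L[ℝ] L2pi := toL2.mkContinuousOfExistsBound norm_toL2_le

@[simp]
theorem toL2L_apply (s : H10) : toL2L s = toL2 s := rfl

/-- Smooth test functions are dense. -/
theorem eq_of_eqOn_test {ℓ ℓ' : H10 →L[ℝ] ℝ}
    (h : ∀ ψ (hψ : IsTestFun ⊤ ψ), ℓ (ofTest ψ hψ.of_top) = ℓ' (ofTest ψ hψ.of_top)) :
    ℓ = ℓ' := by
  let D : Set H10 := {s | ∃ ψ, ∃ hψ : IsTestFun ⊤ ψ, s = ofTest ψ hψ.of_top}
  -- If s is orthogonal to all smooth test functions, its derivative is constant; but derivatives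
  -- have mean zero, so it vanishes.
  have h1 : (Submodule.span ℝ D)ᗮ = ⊥ := by
    rw [Submodule.eq_bot_iff]
    intro s hs
    obtain ⟨c, hc⟩ := L2pi.eq_const_of_inner_deriv_test (v := dx s) fun φ hφ => by
      rw [real_inner_comm]
      exact (Submodule.mem_orthogonal _ _).1 hs _ (Submodule.subset_span ⟨φ, hφ, rfl⟩)
    have h2 : ‖s‖ ^ 2 = 0 := by
      rw [← real_inner_self_eq_norm_sq, inner_eq]
      nth_rewrite 1 [hc]
      rw [real_inner_smul_left, inner_one_dx, mul_zero]
    exact norm_eq_zero.1 (pow_eq_zero_iff two_ne_zero |>.1 h2)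
  have h2 : Dense (Submodule.span ℝ D : Set H10) := by
    rw [← Submodule.topologicalClosure_eq_top_iff] at h1
    exact Submodule.dense_iff_topologicalClosure_eq_top.2 h1
  refine ContinuousLinearMap.ext_on h2 ?_
  rintro s ⟨ψ, hψ, rfl⟩
  exact h ψ hψ

end H10


/-! ### The sine basis -/

/-- The normalized Dirichlet eigenfunctions. -/
def sinFun (k : ℕ) (x : ℝ) : ℝ := √(2 / Real.pi) * Real.sin ((k + 1) * x)

/-- The derivative of `sinFun k`. -/
def cosFun (k : ℕ) (x : ℝ) : ℝ := √(2 / Real.pi) * ((k + 1) * Real.cos ((k + 1) * x))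

theorem continuous_sinFun (k : ℕ) : Continuous (sinFun k) := by unfold sinFun; fun_prop

theorem continuous_cosFun (k : ℕ) : Continuous (cosFun k) := by unfold cosFun; fun_prop

theorem hasDerivAt_sinFun (k : ℕ) (x : ℝ) : HasDerivAt (sinFun k) (cosFun k x) x := by
  have h := (((hasDerivAt_id x).const_mul ((k : ℝ) + 1)).sin).const_mul √(2 / Real.pi)
  refine h.congr_deriv ?_
  simp [cosFun, mul_comm]

theorem hasDerivAt_cosFun (k : ℕ) (x : ℝ) :
    HasDerivAt (cosFun k) (-((k + 1) ^ 2 * sinFun k x)) x := by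
  have h := ((((hasDerivAt_id x).const_mul ((k : ℝ) + 1)).cos).const_mul
    ((k : ℝ) + 1)).const_mul √(2 / Real.pi)
  refine h.congr_deriv ?_
  simp only [sinFun, id]
  ring

theorem sinFun_zero (k : ℕ) : sinFun k 0 = 0 := by simp [sinFun]

theorem sinFun_pi (k : ℕ) : sinFun k Real.pi = 0 := by
  have := Real.sin_nat_mul_pi (k + 1)
  push_cast at this
  simp [sinFun, this]

/-- `sinFun k` in `L₂(0, π)`. -/
def sinL2 (k : ℕ) : L2pi := ofContinuous (sinFun k) (continuous_sinFun k)

/-- `cosFun k` in `L₂(0, π)`. -/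
def cosL2 (k : ℕ) : L2pi := ofContinuous (cosFun k) (continuous_cosFun k)

theorem norm_sinL2 (k : ℕ) : ‖sinL2 k‖ = 1 := by
  have h : ‖sinL2 k‖ ^ 2 = 1 := by
    rw [← real_inner_self_eq_norm_sq, sinL2, inner_ofContinuous_ofContinuous]
    have h1 : ∀ x, sinFun k x * sinFun k x = (2 / Real.pi) * Real.sin ((k + 1) * x) ^ 2 := by
      intro x
      rw [sinFun]
      have := Real.mul_self_sqrt (show 0 ≤ 2 / Real.pi by positivity)
      linear_combination Real.sin ((k + 1) * x) ^ 2 * this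
    simp only [h1]
    have h2 := intervalIntegral.integral_comp_mul_left (a := 0) (b := Real.pi)
      (fun y => Real.sin y ^ 2) (c := (k : ℝ) + 1) (by positivity)
    have h3 := Real.sin_nat_mul_pi (k + 1)
    push_cast at h3
    rw [intervalIntegral.integral_const_mul, h2, integral_sin_sq, h3]
    have := Real.pi_pos.ne'
    simp
    field_simp
  nlinarith [norm_nonneg (sinL2 k)]

theorem exists_sinH10 (k : ℕ) : ∃ s : H10, H10.toL2 s = sinL2 k ∧ H10.dx s = cosL2 k := by
  obtain ⟨s, hs⟩ := H10.exists_dx_eq (y := cosL2 k) (by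
    rw [oneL2, cosL2, inner_ofContinuous_ofContinuous]
    simp only [one_mul]
    rw [intervalIntegral.integral_eq_sub_of_hasDerivAt (fun x _ => hasDerivAt_sinFun k x)
      ((continuous_cosFun k).intervalIntegrable _ _), sinFun_pi, sinFun_zero, sub_zero])
  refine ⟨s, ?_, hs⟩
  rw [H10.toL2_eq_primitiveL, hs]
  refine Lp.ext ?_
  filter_upwards [coeFn_primitiveL (cosL2 k), coeFn_ofContinuous (continuous_sinFun k),
    ae_restrict_mem measurableSet_Ioo] with x h1 h2 h3
  rw [h1, sinL2, h2, cosL2, primitive_ofContinuous _ h3,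
    intervalIntegral.integral_eq_sub_of_hasDerivAt (fun x _ => hasDerivAt_sinFun k x)
      ((continuous_cosFun k).intervalIntegrable _ _), sinFun_zero, sub_zero]

/-- `sinFun k` in `H¹₀(0, π)`. -/
def sinH10 (k : ℕ) : H10 := (exists_sinH10 k).choose

theorem toL2_sinH10 (k : ℕ) : H10.toL2 (sinH10 k) = sinL2 k := (exists_sinH10 k).choose_spec.1

theorem dx_sinH10 (k : ℕ) : H10.dx (sinH10 k) = cosL2 k := (exists_sinH10 k).choose_spec.2

/-- Integration by parts: the sines are eigenfunctions of -d²/dx², and s contributes no boundary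
terms. -/
theorem inner_sinH10 (k : ℕ) (s : H10) :
    ⟪sinH10 k, s⟫ = (k + 1) ^ 2 * ⟪sinL2 k, H10.toL2 s⟫ := by
  have hc : Continuous fun x => -(((k : ℝ) + 1) ^ 2 * sinFun k x) :=
    (continuous_const.mul (continuous_sinFun k)).neg
  rw [H10.inner_eq, dx_sinH10, cosL2,
    H10.inner_dx s (hasDerivAt_cosFun k) (continuous_cosFun k) hc, real_inner_comm,
    inner_ofContinuous, sinL2, real_inner_comm, inner_ofContinuous, ← integral_const_mul,
    ← integral_neg]
  exact integral_congr_ae (Eventually.of_forall fun x => by ring)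

/-- Eigenfunctions of a symmetric form with different eigenvalues are orthogonal: both orders of the
H¹₀ product are expressed through the same L₂ product. -/
theorem orthonormal_sinL2 : Orthonormal ℝ sinL2 := by
  refine ⟨norm_sinL2, fun j k hjk => ?_⟩
  have h1 := inner_sinH10 j (sinH10 k)
  have h2 := inner_sinH10 k (sinH10 j)
  rw [real_inner_comm, h1, toL2_sinH10, toL2_sinH10, real_inner_comm (sinL2 j)] at h2
  have h3 : (((j : ℝ) + 1) ^ 2 - (k + 1) ^ 2) * ⟪sinL2 j, sinL2 k⟫ = 0 := by
    linear_combination h2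
  refine (mul_eq_zero.1 h3).resolve_left fun h4 => hjk ?_
  have h5 : ((j : ℝ) - k) * (j + k + 2) = 0 := by linear_combination h4
  have h6 := (mul_eq_zero.1 h5).resolve_right (by positivity)
  exact_mod_cast sub_eq_zero.1 h6

/-! ### Completeness of the sine system -/

theorem integral_mul_sin_mul_cos_pow_eq_zero {v : L2pi} (h : ∀ k, ⟪sinL2 k, v⟫ = 0) (j k : ℕ) :
    ∫ x, v x * (Real.sin (k * x) * Real.cos x ^ j) ∂volPi = 0 := by
  induction j generalizing k with
  | zero =>
    cases k with
    | zero => simp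
    | succ k =>
      have h1 := h k
      rw [real_inner_comm, sinL2, inner_ofContinuous] at h1
      have h2 : ∀ x, v x * sinFun k x =
          √(2 / Real.pi) * (v x * (Real.sin ((k + 1 : ℕ) * x) * Real.cos x ^ 0)) := fun x => by
        rw [sinFun]; push_cast; ring
      simp only [h2] at h1
      rw [integral_const_mul] at h1
      have := Real.pi_pos
      exact (mul_eq_zero.1 h1).resolve_left (by positivity)
  | succ j ih =>
    cases k with
    | zero => simp
    | succ k =>
      have hi : ∀ n : ℕ, Integrable (fun x => v x * (Real.sin (n * x) * Real.cos x ^ j)) volPi :=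
        fun n => (Lp.memLp v).integrable_mul (memLp_volPi_of_continuous (by fun_prop))
      -- The product formula sin(nx) cos x = (sin((n+1)x) + sin((n-1)x))/2 trades one power of the
      -- cosine for two neighbouring frequencies.
      have h2 : ∀ x, v x * (Real.sin ((k + 1 : ℕ) * x) * Real.cos x ^ (j + 1)) =
          2⁻¹ * (v x * (Real.sin ((k + 2 : ℕ) * x) * Real.cos x ^ j) +
            v x * (Real.sin (k * x) * Real.cos x ^ j)) := fun x => by
        have h3 : Real.sin ((k + 2 : ℕ) * x) = Real.sin ((k + 1 : ℕ) * x) * Real.cos x +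
            Real.cos ((k + 1 : ℕ) * x) * Real.sin x := by
          rw [← Real.sin_add]; congr 1; push_cast; ring
        have h4 : Real.sin (k * x) = Real.sin ((k + 1 : ℕ) * x) * Real.cos x -
            Real.cos ((k + 1 : ℕ) * x) * Real.sin x := by
          rw [← Real.sin_sub]; congr 1; push_cast; ring
        rw [h3, h4]; ring
      simp only [h2]
      rw [integral_const_mul, integral_add (hi _) (hi _), ih, ih]
      simp

/-- Orthogonality to the sines extends to sin x · p(cos x) for polynomials p, and by Weierstrass
these approximate every test function uniformly. -/
theorem eq_zero_of_inner_sinL2 {v : L2pi} (h : ∀ k, ⟪sinL2 k, v⟫ = 0) : v = 0 := by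
  refine L2pi.eq_zero_of_inner_test fun φ hφ => ?_
  have hpoly : ∀ p : Polynomial ℝ, ∫ x, v x * (Real.sin x * p.eval (Real.cos x)) ∂volPi = 0 := by
    intro p
    have h1 : ∀ x, v x * (Real.sin x * p.eval (Real.cos x)) = ∑ j ∈ Finset.range (p.natDegree + 1),
        p.coeff j * (v x * (Real.sin ((1 : ℕ) * x) * Real.cos x ^ j)) := fun x => by
      rw [Polynomial.eval_eq_sum_range, Finset.mul_sum, Finset.mul_sum]
      exact Finset.sum_congr rfl fun j _ => by push_cast; rw [one_mul]; ring
    simp only [h1]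
    rw [integral_finsetSum _ fun j _ => ?_]
    · refine Finset.sum_eq_zero fun j _ => ?_
      rw [integral_const_mul, integral_mul_sin_mul_cos_pow_eq_zero h, mul_zero]
    · exact ((Lp.memLp v).integrable_mul
        (memLp_volPi_of_continuous (by fun_prop))).const_mul _
  obtain ⟨α, β, hα, hαβ, hβ, hz⟩ := hφ.exists_Icc
  -- Chosen so that φ(x) = sin x · q(cos x). The zeros of the sine at y = ±1 are harmless because φ
  -- vanishes near 0 and π.
  let q : ℝ → ℝ := fun y => φ (Real.arccos y) / Real.sin (Real.arccos y)
  have hq : ContinuousOn q (Icc (-1) 1) := by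
    intro y hy
    rcases eq_or_ne (Real.sin (Real.arccos y)) 0 with h0 | h0
    · have h1 : Real.arccos y ∉ Icc α β := fun hm =>
        (Real.sin_pos_of_pos_of_lt_pi (hα.trans_le hm.1) (hm.2.trans_lt hβ)).ne' h0
      have h2 : ∀ᶠ z in 𝓝 y, Real.arccos z ∉ Icc α β :=
        Real.continuous_arccos.continuousAt.eventually (isClosed_Icc.isOpen_compl.mem_nhds h1)
      refine ContinuousAt.continuousWithinAt
        ((continuousAt_const (y := (0 : ℝ))).congr (h2.mono fun z hz' => ?_))
      simp only [q, hz _ hz', zero_div]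
    · exact ContinuousAt.continuousWithinAt
        ((hφ.continuous.comp Real.continuous_arccos).continuousAt.div
          (Real.continuous_sin.comp Real.continuous_arccos).continuousAt h0)
  have hle : ∀ ε > 0, |⟪v, ofContinuous φ hφ.continuous⟫| ≤ (√Real.pi * ‖v‖) * ε := by
    intro ε hε
    obtain ⟨p, hp⟩ := exists_polynomial_near_of_continuousOn (-1) 1 q hq ε hε
    have i1 : Integrable (fun x => v x * φ x) volPi :=
      (Lp.memLp v).integrable_mul (memLp_volPi_of_continuous hφ.continuous)
    have i2 : Integrable (fun x => v x * (Real.sin x * p.eval (Real.cos x))) volPi :=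
      (Lp.memLp v).integrable_mul (memLp_volPi_of_continuous (by fun_prop))
    have h1 : ⟪v, ofContinuous φ hφ.continuous⟫ =
        ∫ x, (v x * φ x - v x * (Real.sin x * p.eval (Real.cos x))) ∂volPi := by
      rw [integral_sub i1 i2, hpoly, sub_zero, inner_ofContinuous]
    rw [h1]
    refine abs_integral_le_integral_abs.trans (le_trans ?_
      (mul_le_mul_of_nonneg_right (integral_abs_le_norm v) hε.le))
    rw [← integral_mul_const]
    refine integral_mono_ae (i1.sub i2).abs (v.integrable.abs.mul_const ε) ?_
    filter_upwards [ae_restrict_mem measurableSet_Ioo] with x hx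
    rw [← mul_sub, abs_mul]
    refine mul_le_mul_of_nonneg_left ?_ (abs_nonneg _)
    have h2 := hp (Real.cos x) (Real.cos_mem_Icc x)
    have h3 : Real.sin x ≠ 0 := (Real.sin_pos_of_pos_of_lt_pi hx.1 hx.2).ne'
    simp only [q] at h2
    rw [Real.arccos_cos hx.1.le hx.2.le, abs_sub_comm] at h2
    have h4 : φ x - Real.sin x * p.eval (Real.cos x) =
        Real.sin x * (φ x / Real.sin x - p.eval (Real.cos x)) := by field_simp
    rw [h4, abs_mul]
    exact (mul_le_mul (Real.abs_sin_le_one x) h2.le (abs_nonneg _) zero_le_one).trans_eq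
      (one_mul ε)
  have h5 : |⟪v, ofContinuous φ hφ.continuous⟫| ≤ 0 := by
    have h6 : Tendsto (fun ε : ℝ => (√Real.pi * ‖v‖) * ε) (𝓝[>] 0) (𝓝 0) := by
      have : Continuous fun ε : ℝ => (√Real.pi * ‖v‖) * ε := by fun_prop
      simpa using (this.tendsto 0).mono_left nhdsWithin_le_nhds
    exact ge_of_tendsto h6 (eventually_mem_nhdsWithin.mono fun ε hε => hle ε hε)
  exact abs_nonpos_iff.1 h5

/-- The sine basis of `L₂(0, π)`. -/
def sinBasisL2 : HilbertBasis ℕ ℝ L2pi :=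
  HilbertBasis.mkOfOrthogonalEqBot orthonormal_sinL2 (by
    rw [Submodule.eq_bot_iff]
    intro v hv
    exact eq_zero_of_inner_sinL2 fun k =>
      (Submodule.mem_orthogonal _ _).1 hv _ (Submodule.subset_span ⟨k, rfl⟩))

theorem sinBasisL2_apply (k : ℕ) : sinBasisL2 k = sinL2 k := by
  rw [sinBasisL2, HilbertBasis.coe_mkOfOrthogonalEqBot]

theorem inner_smul_sinH10 (k : ℕ) (s : H10) :
    ⟪((k : ℝ) + 1)⁻¹ • sinH10 k, s⟫ = (k + 1) * ⟪sinL2 k, H10.toL2 s⟫ := by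
  rw [real_inner_smul_left, inner_sinH10]
  have : (k : ℝ) + 1 ≠ 0 := by positivity
  field_simp

theorem orthonormal_sinH10 : Orthonormal ℝ fun k : ℕ => ((k : ℝ) + 1)⁻¹ • sinH10 k := by
  rw [orthonormal_iff_ite]
  intro j k
  rw [inner_smul_sinH10, map_smul, toL2_sinH10, real_inner_smul_right,
    orthonormal_iff_ite.1 orthonormal_sinL2 j k]
  split_ifs with h
  · subst h
    have : (j : ℝ) + 1 ≠ 0 := by positivity
    field_simp
  · simp

/-- The sine basis of `H¹₀(0, π)`. -/
def sinBasisH10 : HilbertBasis ℕ ℝ H10 :=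
  HilbertBasis.mkOfOrthogonalEqBot orthonormal_sinH10 (by
    rw [Submodule.eq_bot_iff]
    intro s hs
    refine H10.toL2_injective (Eq.trans (eq_zero_of_inner_sinL2 fun k => ?_)
      (map_zero H10.toL2).symm)
    have h := (Submodule.mem_orthogonal _ _).1 hs _ (Submodule.subset_span ⟨k, rfl⟩)
    rw [inner_smul_sinH10] at h
    exact (mul_eq_zero.1 h).resolve_left (by positivity))

theorem sinBasisH10_apply (k : ℕ) : sinBasisH10 k = ((k : ℝ) + 1)⁻¹ • sinH10 k := by
  rw [sinBasisH10, HilbertBasis.coe_mkOfOrthogonalEqBot]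

/-- The embedding of `H¹₀(0, π)` into `L₂(0, π)` is diagonal in the sine bases. -/
theorem diagonalEmbedding_toL2L :
    DiagonalEmbedding H10.toL2L sinBasisH10 sinBasisL2 fun k => (k : ℝ) + 1 where
  one_le k := by linarith [k.cast_nonneg (α := ℝ)]
  inner_eq k s := by rw [sinBasisH10_apply, sinBasisL2_apply, inner_smul_sinH10, H10.toL2L_apply]
  smul_map k := by
    have : (k : ℝ) + 1 ≠ 0 := by positivity
    rw [sinBasisH10_apply, sinBasisL2_apply, map_smul, H10.toL2L_apply, toL2_sinH10, smul_smul,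
      mul_inv_cancel₀ this, one_smul]


/-! ### Superposition operators -/

theorem LocallyLipschitz.exists_abs_sub_le {f : ℝ → ℝ} (hf : LocallyLipschitz f) (R : ℝ) :
    ∃ L, 0 ≤ L ∧ ∀ a b, |a| ≤ R → |b| ≤ R → |f a - f b| ≤ L * |a - b| := by
  obtain ⟨K, hK⟩ := (hf.locallyLipschitzOn (s := Icc (-R) R)).exists_lipschitzOnWith_of_compact
    isCompact_Icc
  exact ⟨K, K.2, fun a b ha hb => hK.dist_le_mul a (abs_le.1 ha) b (abs_le.1 hb)⟩

theorem memLp_comp_toL2 {f : ℝ → ℝ} (hf : Continuous f) (s : H10) :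
    MemLp (fun x => f (H10.toL2 s x)) 2 volPi := by
  obtain ⟨C, hC⟩ := (isCompact_Icc (a := -(√Real.pi * ‖s‖))
    (b := √Real.pi * ‖s‖)).exists_bound_of_continuousOn hf.continuousOn
  refine MemLp.of_bound (hf.comp_aestronglyMeasurable (Lp.aestronglyMeasurable _)) C ?_
  exact (H10.abs_toL2_le s).mono fun x hx => hC _ (abs_le.1 hx)

/-- The superposition operator `s ↦ f ∘ s` from `H¹₀(0, π)` to `L₂(0, π)`. -/
def superposition (f : ℝ → ℝ) (hf : Continuous f) (s : H10) : L2pi := (memLp_comp_toL2 hf s).toLp _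

theorem coeFn_superposition {f : ℝ → ℝ} (hf : Continuous f) (s : H10) :
    superposition f hf s =ᵐ[volPi] fun x => f (H10.toL2 s x) := MemLp.coeFn_toLp _

theorem superposition_congr {f g : ℝ → ℝ} (hf : Continuous f) (hg : Continuous g) {R : ℝ}
    (hfg : ∀ y, |y| ≤ R → f y = g y) {s : H10} (hs : √Real.pi * ‖s‖ ≤ R) :
    superposition f hf s = superposition g hg s := by
  refine Lp.ext ?_
  filter_upwards [coeFn_superposition hf s, coeFn_superposition hg s, H10.abs_toL2_le s]
    with x h1 h2 h3
  rw [h1, h2, hfg _ (h3.trans hs)]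

/-- States are bounded by √π‖s‖ almost everywhere, so only the Lipschitz constant of f on [-R, R]
matters; no growth condition on f is needed. -/
theorem norm_superposition_sub_le {f : ℝ → ℝ} (hf : Continuous f) {R L : ℝ} (hL0 : 0 ≤ L)
    (hL : ∀ a b, |a| ≤ R → |b| ≤ R → |f a - f b| ≤ L * |a - b|) {s s' : H10}
    (hs : √Real.pi * ‖s‖ ≤ R) (hs' : √Real.pi * ‖s'‖ ≤ R) :
    ‖superposition f hf s - superposition f hf s'‖ ≤ L * ‖s - s'‖ := by
  have h : ‖superposition f hf s - superposition f hf s'‖ ≤ L * ‖H10.toL2 s - H10.toL2 s'‖ := by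
    refine Lp.norm_le_mul_norm_of_ae_le_mul ?_
    filter_upwards [coeFn_superposition hf s, coeFn_superposition hf s', H10.abs_toL2_le s,
      H10.abs_toL2_le s', Lp.coeFn_sub (superposition f hf s) (superposition f hf s'),
      Lp.coeFn_sub (H10.toL2 s) (H10.toL2 s')] with x h1 h2 h3 h4 h5 h6
    rw [h5, h6, Pi.sub_apply, Pi.sub_apply, h1, h2]
    exact hL _ _ (h3.trans hs) (h4.trans hs')
  refine h.trans (mul_le_mul_of_nonneg_left ?_ hL0)
  rw [← map_sub]
  exact diagonalEmbedding_toL2L.norm_map_le (s - s')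

theorem exists_norm_superposition_sub_le {f : ℝ → ℝ} (hf : LocallyLipschitz f) (R : ℝ) :
    ∃ L, ∀ s s', ‖s‖ ≤ R → ‖s'‖ ≤ R →
      ‖superposition f hf.continuous s - superposition f hf.continuous s'‖ ≤ L * ‖s - s'‖ := by
  obtain ⟨L, hL0, hL⟩ := hf.exists_abs_sub_le (√Real.pi * R)
  exact ⟨L, fun s s' hs hs' => norm_superposition_sub_le hf.continuous hL0 hL
    (mul_le_mul_of_nonneg_left hs (Real.sqrt_nonneg _))
    (mul_le_mul_of_nonneg_left hs' (Real.sqrt_nonneg _))⟩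

/-! ### Potentials -/

/-- The primitive of `f` that vanishes at `0`. -/
def potential (f : ℝ → ℝ) (y : ℝ) : ℝ := ∫ z in (0 : ℝ)..y, f z

theorem continuous_potential {f : ℝ → ℝ} (hf : Continuous f) : Continuous (potential f) :=
  intervalIntegral.continuous_primitive (fun a b => hf.intervalIntegrable a b) 0

/-- The potential is convex, having the nondecreasing derivative f, so its graph lies above its
tangents. -/
theorem mul_sub_le_potential_sub {f : ℝ → ℝ} (hf : Continuous f) (hm : Monotone f) (a b : ℝ) :
    f a * (b - a) ≤ potential f b - potential f a := by
  have hi : ∀ a b, IntervalIntegrable f volume a b := fun a b => hf.intervalIntegrable a b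
  have h : potential f b - potential f a = ∫ z in a..b, f z :=
    intervalIntegral.integral_interval_sub_left (hi _ _) (hi _ _)
  rw [h]
  rcases le_total a b with hab | hab
  · have := intervalIntegral.integral_mono_on hab (intervalIntegrable_const (c := f a)) (hi a b)
      fun x hx => hm hx.1
    rw [intervalIntegral.integral_const, smul_eq_mul] at this
    linarith
  · have := intervalIntegral.integral_mono_on hab (hi b a) (intervalIntegrable_const (c := f a))
      fun x hx => hm hx.2
    rw [intervalIntegral.integral_const, smul_eq_mul] at this
    rw [intervalIntegral.integral_symm]
    linarith

theorem potential_congr {f g : ℝ → ℝ} {R : ℝ} (hfg : ∀ y, |y| ≤ R → f y = g y) {y : ℝ}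
    (hy : |y| ≤ R) : potential f y = potential g y := by
  refine intervalIntegral.integral_congr fun z hz => hfg z ?_
  have h1 : z ∈ uIcc (-R) R := by
    refine uIcc_subset_uIcc ?_ ?_ hz <;>
    · have := (abs_nonneg y).trans hy
      rw [uIcc_of_le (by linarith)]
      first | exact abs_le.1 hy | exact ⟨by linarith, by linarith⟩
  rw [uIcc_of_le (by linarith [(abs_nonneg y).trans hy])] at h1
  exact abs_le.2 h1

theorem potential_nonneg {f : ℝ → ℝ} (hf : Continuous f) (hm : Monotone f) (h0 : f 0 = 0) (y : ℝ) :
    0 ≤ potential f y := by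
  have := mul_sub_le_potential_sub hf hm 0 y
  simpa [h0, potential] using this

/-- The integral of the potential of `f` along a state. -/
def potentialEnergy (f : ℝ → ℝ) (s : H10) : ℝ := ∫ x, potential f (H10.toL2 s x) ∂volPi

theorem integrable_potential {f : ℝ → ℝ} (hf : Continuous f) (s : H10) :
    Integrable (fun x => potential f (H10.toL2 s x)) volPi :=
  (memLp_comp_toL2 (continuous_potential hf) s).integrable one_le_two

theorem potentialEnergy_nonneg {f : ℝ → ℝ} (hf : Continuous f) (hm : Monotone f) (h0 : f 0 = 0)
    (s : H10) : 0 ≤ potentialEnergy f s :=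
  integral_nonneg fun _ => potential_nonneg hf hm h0 _

theorem potentialEnergy_congr {f g : ℝ → ℝ} {R : ℝ} (hfg : ∀ y, |y| ≤ R → f y = g y) {s : H10}
    (hs : √Real.pi * ‖s‖ ≤ R) : potentialEnergy f s = potentialEnergy g s :=
  integral_congr_ae ((H10.abs_toL2_le s).mono fun _ hx => potential_congr hfg (hx.trans hs))

theorem energy_eq {f : ℝ → ℝ} (hf : Continuous f) (s : H10) :
    energy f s = ‖s‖ ^ 2 / 2 + potentialEnergy f s := by
  have h1 : Integrable (fun x => (1 / 2) * (H10.dx s x) ^ 2) volPi := by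
    have := (L2pi.integrable_mul (H10.dx s) (H10.dx s)).const_mul (1 / 2)
    simpa only [sq] using this
  unfold energy potentialEnergy
  rw [H10.norm_eq, L2pi.norm_sq_eq]
  have h2 := integral_add h1 (integrable_potential hf s)
  rw [integral_const_mul] at h2
  refine Eq.trans h2 ?_
  ring

theorem inner_superposition {f : ℝ → ℝ} (hf : Continuous f) (s : H10) (v : L2pi) :
    ⟪superposition f hf s, v⟫ = ∫ x, f (H10.toL2 s x) * v x ∂volPi := by
  rw [L2pi.inner_eq]
  exact integral_congr_ae ((coeFn_superposition hf s).mono fun x hx => by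
    simp only [hx])

theorem inner_superposition_le {f : ℝ → ℝ} (hf : Continuous f) (hm : Monotone f) (s s' : H10) :
    ⟪superposition f hf s, H10.toL2 (s' - s)⟫ ≤ potentialEnergy f s' - potentialEnergy f s := by
  unfold potentialEnergy
  rw [inner_superposition, ← integral_sub (integrable_potential hf s') (integrable_potential hf s)]
  refine integral_mono_ae ((memLp_comp_toL2 hf s).integrable_mul (Lp.memLp _))
    ((integrable_potential hf s').sub (integrable_potential hf s)) ?_
  rw [map_sub]
  filter_upwards [Lp.coeFn_sub (H10.toL2 s') (H10.toL2 s)] with x hx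
  simp only [Pi.sub_apply, hx]
  exact mul_sub_le_potential_sub hf hm _ _

/-- Convexity used at both points places the remainder Φ(y) - Φ(s) - ⟨N(s), y - s⟩ between 0 and
⟨N(y) - N(s), y - s⟩. Continuity of N makes the latter o(‖y - s‖). -/
theorem isGradientOf_superposition {f : ℝ → ℝ} (hf : LocallyLipschitz f) (hm : Monotone f)
    (h0 : f 0 = 0) :
    IsGradientOf H10.toL2L (superposition f hf.continuous) (potentialEnergy f) where
  lipschitz R := exists_norm_superposition_sub_le hf R
  hasFDerivAt s := by
    have hc := (continuous_of_lipschitz_on_balls (exists_norm_superposition_sub_le hf)).tendsto s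
    refine HasFDerivAt.of_isLittleO (Asymptotics.isLittleO_iff.2 fun c hc0 => ?_)
    filter_upwards [(tendsto_iff_norm_sub_tendsto_zero.1 hc).eventually (gt_mem_nhds hc0)]
      with y hy
    have h1 := inner_superposition_le hf.continuous hm s y
    have h2 := inner_superposition_le hf.continuous hm y s
    have h3 : H10.toL2 (s - y) = -H10.toL2 (y - s) := by rw [← map_neg, neg_sub]
    rw [h3, inner_neg_right] at h2
    have h4 : ⟪superposition f hf.continuous y - superposition f hf.continuous s,
        H10.toL2 (y - s)⟫ ≤ c * ‖y - s‖ := (real_inner_le_norm _ _).trans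
      (mul_le_mul hy.le (diagonalEmbedding_toL2L.norm_map_le _) (norm_nonneg _) hc0.le)
    rw [inner_sub_left] at h4
    simp only [ContinuousLinearMap.comp_apply, innerSL_apply_apply, H10.toL2L_apply]
    rw [Real.norm_of_nonneg (by linarith)]
    linarith
  inner_nonneg s := by
    rw [H10.toL2L_apply, inner_superposition]
    refine integral_nonneg fun x => ?_
    rcases le_total 0 (H10.toL2 s x) with h | h
    · exact mul_nonneg (h0.symm.le.trans (hm h)) h
    · exact mul_nonneg_of_nonpos_of_nonpos ((hm h).trans h0.le) h

/-! ### Truncation of the nonlinearity -/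

/-- `f`, made constant outside of `[-R, R]`. -/
def clampArg (f : ℝ → ℝ) (R y : ℝ) : ℝ := f (max (-R) (min R y))

theorem clampArg_eq (f : ℝ → ℝ) {R y : ℝ} (hy : |y| ≤ R) : clampArg f R y = f y := by
  rw [clampArg, min_eq_right (abs_le.1 hy).2, max_eq_right (abs_le.1 hy).1]

theorem monotone_clampArg {f : ℝ → ℝ} (hm : Monotone f) (R : ℝ) : Monotone (clampArg f R) :=
  fun _ _ h => hm (max_le_max le_rfl (min_le_min le_rfl h))

theorem exists_lipschitz_clampArg {f : ℝ → ℝ} (hf : LocallyLipschitz f) {R : ℝ} (hR : 0 ≤ R) :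
    ∃ L : ℝ≥0, LipschitzWith L (clampArg f R) := by
  obtain ⟨L, hL0, hL⟩ := hf.exists_abs_sub_le R
  have h1 : ∀ y, |max (-R) (min R y)| ≤ R := fun y =>
    abs_le.2 ⟨le_max_left _ _, max_le (by linarith) (min_le_left _ _)⟩
  refine ⟨⟨L, hL0⟩, LipschitzWith.of_dist_le_mul fun a b => ?_⟩
  refine (hL _ _ (h1 a) (h1 b)).trans (mul_le_mul_of_nonneg_left ?_ hL0)
  refine (abs_max_sub_max_le_max _ _ _ _).trans ?_
  rw [sub_self, abs_zero, max_eq_right (abs_nonneg _)]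
  refine (abs_min_sub_min_le_max _ _ _ _).trans ?_
  rw [sub_self, abs_zero, max_eq_right (abs_nonneg _)]
  rfl

/-! ### Powers -/

theorem abs_signedPower {σ : ℝ} (hσ : σ = 1 ∨ σ = -1) (m r : ℝ) :
    |signedPower σ m r| = |r| ^ m := by
  unfold signedPower
  split_ifs with h
  · rw [abs_of_nonneg (Real.rpow_nonneg h m), abs_of_nonneg h]
  · have : |σ| = 1 := by rcases hσ with rfl | rfl <;> simp
    rw [abs_mul, this, one_mul, abs_of_nonneg (Real.rpow_nonneg (abs_nonneg r) m)]

theorem abs_rpow_sub_rpow_le {m x y : ℝ} (hm : 0 ≤ m) (hm1 : m ≤ 1) (hx : 0 ≤ x) (hy : 0 ≤ y) :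
    |x ^ m - y ^ m| ≤ |x - y| ^ m := by
  wlog h : y ≤ x generalizing x y
  · rw [abs_sub_comm, abs_sub_comm x]
    exact this hy hx (le_of_not_ge h)
  rw [abs_of_nonneg (sub_nonneg.2 (Real.rpow_le_rpow hy h hm)), abs_of_nonneg (sub_nonneg.2 h)]
  have := Real.rpow_add_le_add_rpow (sub_nonneg.2 h) hy hm hm1
  rw [sub_add_cancel] at this
  linarith

/-- For arguments on the same side of 0 this is subadditivity of the power; on opposite sides |r|
and |q| are both at most |r - q|, which costs the factor 2. -/
theorem abs_signedPower_sub_le {σ : ℝ} (hσ : σ = 1 ∨ σ = -1) {m : ℝ} (hm : 0 ≤ m) (hm1 : m ≤ 1)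
    (r q : ℝ) : |signedPower σ m r - signedPower σ m q| ≤ 2 * |r - q| ^ m := by
  have hn := Real.rpow_nonneg (abs_nonneg (r - q)) m
  by_cases h : 0 ≤ r ↔ 0 ≤ q
  · have h1 : |signedPower σ m r - signedPower σ m q| = abs (|r| ^ m - |q| ^ m) := by
      unfold signedPower
      by_cases hr : 0 ≤ r
      · rw [if_pos hr, if_pos (h.1 hr), abs_of_nonneg hr, abs_of_nonneg (h.1 hr)]
      · have : |σ| = 1 := by rcases hσ with rfl | rfl <;> simp
        rw [if_neg hr, if_neg fun hq => hr (h.2 hq), ← mul_sub, abs_mul, this, one_mul]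
    have h2 := Real.rpow_le_rpow (abs_nonneg _) (abs_abs_sub_abs_le_abs_sub r q) hm
    rw [h1]
    linarith [abs_rpow_sub_rpow_le hm hm1 (abs_nonneg r) (abs_nonneg q)]
  · have h1 : |r| ≤ |r - q| ∧ |q| ≤ |r - q| := by
      by_cases hr : 0 ≤ r
      · have hq : q < 0 := not_le.1 fun hq => h ⟨fun _ => hq, fun _ => hr⟩
        rw [abs_of_nonneg hr, abs_of_neg hq, abs_of_nonneg (by linarith)]
        constructor <;> linarith
      · have hq : 0 ≤ q := by by_contra hq; exact h ⟨fun h => absurd h hr, fun h => absurd h hq⟩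
        rw [abs_of_neg (not_le.1 hr), abs_of_nonneg hq, abs_of_neg (by linarith)]
        constructor <;> linarith
    refine (abs_sub _ _).trans ?_
    rw [abs_signedPower hσ, abs_signedPower hσ]
    linarith [Real.rpow_le_rpow (abs_nonneg _) h1.1 hm, Real.rpow_le_rpow (abs_nonneg _) h1.2 hm]

theorem continuous_signedPower {σ : ℝ} (hσ : σ = 1 ∨ σ = -1) {m : ℝ} (hm : 0 < m) (hm1 : m ≤ 1) :
    Continuous (signedPower σ m) := by
  refine continuous_iff_continuousAt.2 fun q => tendsto_iff_norm_sub_tendsto_zero.2 ?_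
  refine squeeze_zero (fun _ => norm_nonneg _)
    (fun r => abs_signedPower_sub_le hσ hm.le hm1 r q) ?_
  have : Continuous fun r : ℝ => 2 * |r - q| ^ m :=
    continuous_const.mul ((by fun_prop : Continuous fun r => |r - q|).rpow_const
      fun _ => Or.inr hm.le)
  simpa [Real.zero_rpow hm.ne'] using this.tendsto q

/-- Jensen's inequality for the concave power r ↦ r^m, applied to the mean of v² over (0, π). This
is the source of the constant π^((1-m)/2) in the gain. It is used with C = 1 for the size of u^m and
with C = 2 for its continuity in u. -/
theorem norm_le_of_abs_le_rpow {v w : L2pi} {m C : ℝ} (hm : 0 ≤ m) (hm1 : m ≤ 1) (hC : 0 ≤ C)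
    (h : ∀ᵐ x ∂volPi, |w x| ≤ C * |v x| ^ m) :
    ‖w‖ ≤ C * (Real.pi ^ ((1 - m) / 2) * ‖v‖ ^ m) := by
  have hπ := Real.pi_pos
  have hi : Integrable (fun x => v x ^ 2) volPi := by
    simpa only [sq] using L2pi.integrable_mul v v
  have hg : Integrable (fun x => (v x ^ 2) ^ m) volPi := by
    refine (hi.add (integrable_const 1)).mono' ?_ (Eventually.of_forall fun x => ?_)
    · exact ((Real.continuous_rpow_const hm).comp
        (continuous_pow 2)).comp_aestronglyMeasurable (Lp.aestronglyMeasurable v)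
    · rw [Real.norm_of_nonneg (by positivity), Pi.add_apply]
      rcases le_total (v x ^ 2) 1 with h1 | h1
      · have := Real.rpow_le_one (sq_nonneg (v x)) h1 hm
        linarith [sq_nonneg (v x)]
      · have := Real.rpow_le_rpow_of_exponent_le h1 hm1
        rw [Real.rpow_one] at this
        linarith
  have hne : NeZero volPi := ⟨fun h0 => by
    have := volPi_real_univ
    rw [h0] at this
    simp at this
    linarith⟩
  have hJ := (Real.concaveOn_rpow hm hm1).le_map_average
    (Real.continuous_rpow_const hm).continuousOn isClosed_Ici
    (Eventually.of_forall fun x => sq_nonneg (v x)) hi hg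
  rw [average_eq, average_eq, volPi_real_univ, smul_eq_mul, smul_eq_mul, ← L2pi.norm_sq_eq,
    inv_mul_le_iff₀ hπ, Real.mul_rpow (by positivity) (by positivity)] at hJ
  refine le_of_sq_le_sq ?_ (by positivity)
  calc ‖w‖ ^ 2 ≤ ∫ x, C ^ 2 * (v x ^ 2) ^ m ∂volPi := by
        rw [L2pi.norm_sq_eq]
        refine integral_mono_ae (by simpa only [sq] using L2pi.integrable_mul w w)
          (hg.const_mul _) ?_
        filter_upwards [h] with x hx
        have h1 := pow_le_pow_left₀ (abs_nonneg _) hx 2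
        rw [sq_abs, mul_pow, ← Real.rpow_mul_natCast (abs_nonneg _), mul_comm m,
          Real.rpow_mul (abs_nonneg _), Real.rpow_natCast, sq_abs] at h1
        exact h1
    _ ≤ C ^ 2 * (Real.pi * (Real.pi⁻¹ ^ m * (‖v‖ ^ 2) ^ m)) := by
        rw [integral_const_mul]; exact mul_le_mul_of_nonneg_left hJ (sq_nonneg C)
    _ = (C * (Real.pi ^ ((1 - m) / 2) * ‖v‖ ^ m)) ^ 2 := by
        have h1 : (Real.pi ^ ((1 - m) / 2)) ^ 2 = Real.pi * Real.pi⁻¹ ^ m := by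
          rw [← Real.rpow_mul_natCast hπ.le, Real.inv_rpow hπ.le, ← Real.rpow_neg hπ.le,
            show (1 - m) / 2 * ((2 : ℕ) : ℝ) = 1 + -m by push_cast; ring, Real.rpow_add hπ,
            Real.rpow_one]
        have h2 : (‖v‖ ^ m) ^ 2 = (‖v‖ ^ 2) ^ m := by
          rw [← Real.rpow_mul_natCast (norm_nonneg v), mul_comm m, Real.rpow_mul (norm_nonneg v),
            Real.rpow_natCast]
        rw [mul_pow, mul_pow, h1, h2]; ring

theorem memLp_signedPower {σ : ℝ} (hσ : σ = 1 ∨ σ = -1) {m : ℝ} (hm : 0 < m) (hm1 : m ≤ 1)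
    (v : L2pi) : MemLp (fun x => signedPower σ m (v x)) 2 volPi := by
  refine ((Lp.memLp v).norm.add (memLp_const 1)).mono
    ((continuous_signedPower hσ hm hm1).comp_aestronglyMeasurable (Lp.aestronglyMeasurable v))
    (Eventually.of_forall fun x => ?_)
  rw [Real.norm_eq_abs, abs_signedPower hσ, Pi.add_apply, Real.norm_of_nonneg (by positivity),
    Real.norm_eq_abs]
  rcases le_total |v x| 1 with h1 | h1
  · linarith [Real.rpow_le_one (abs_nonneg (v x)) h1 hm.le, abs_nonneg (v x)]
  · have := Real.rpow_le_rpow_of_exponent_le h1 hm1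
    rw [Real.rpow_one] at this
    linarith

/-- The operator `v ↦ v ^ m` on `L₂(0, π)`. -/
def powerL2 {σ : ℝ} (hσ : σ = 1 ∨ σ = -1) {m : ℝ} (hm : 0 < m) (hm1 : m ≤ 1) (v : L2pi) : L2pi :=
  (memLp_signedPower hσ hm hm1 v).toLp _

section Power

variable {σ : ℝ} (hσ : σ = 1 ∨ σ = -1) {m : ℝ} (hm : 0 < m) (hm1 : m ≤ 1)

theorem coeFn_powerL2 (v : L2pi) :
    powerL2 hσ hm hm1 v =ᵐ[volPi] fun x => signedPower σ m (v x) := MemLp.coeFn_toLp _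

theorem norm_powerL2_le (v : L2pi) :
    ‖powerL2 hσ hm hm1 v‖ ≤ Real.pi ^ ((1 - m) / 2) * ‖v‖ ^ m := by
  have h := norm_le_of_abs_le_rpow (w := powerL2 hσ hm hm1 v) (v := v) hm.le hm1 zero_le_one
    ((coeFn_powerL2 hσ hm hm1 v).mono fun x hx => by rw [hx, abs_signedPower hσ, one_mul])
  rwa [one_mul] at h

theorem continuous_powerL2 : Continuous (powerL2 hσ hm hm1) := by
  refine continuous_iff_continuousAt.2 fun v => tendsto_iff_norm_sub_tendsto_zero.2 ?_
  have hle : ∀ w, ‖powerL2 hσ hm hm1 w - powerL2 hσ hm hm1 v‖ ≤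
      2 * (Real.pi ^ ((1 - m) / 2) * ‖w - v‖ ^ m) := fun w => by
    refine norm_le_of_abs_le_rpow hm.le hm1 zero_le_two ?_
    filter_upwards [Lp.coeFn_sub (powerL2 hσ hm hm1 w) (powerL2 hσ hm hm1 v), Lp.coeFn_sub w v,
      coeFn_powerL2 hσ hm hm1 w, coeFn_powerL2 hσ hm hm1 v] with x h1 h2 h3 h4
    rw [h1, h2, Pi.sub_apply, Pi.sub_apply, h3, h4]
    exact abs_signedPower_sub_le hσ hm.le hm1 _ _
  refine squeeze_zero (fun _ => norm_nonneg _) hle ?_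
  have : Continuous fun w : L2pi => 2 * (Real.pi ^ ((1 - m) / 2) * ‖w - v‖ ^ m) :=
    continuous_const.mul (continuous_const.mul
      ((by fun_prop : Continuous fun w => ‖w - v‖).rpow_const fun _ => Or.inr hm.le))
  simpa [Real.zero_rpow hm.ne'] using this.tendsto v

end Power


/-! ### The weak form of a linear flow -/

section WeakForm

variable {H X : Type*} [NormedAddCommGroup H] [InnerProductSpace ℝ H] [CompleteSpace H]
  [NormedAddCommGroup X] [InnerProductSpace ℝ X] [CompleteSpace X]

/-- The functional that has to vanish for `s` to satisfy `s' = -A s + h`, integrated up to time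
`t`, in the weak sense. -/
def weakDefect (ι : X →L[ℝ] H) (s : ℝ → X) (h : ℝ → H) (t : ℝ) : X →L[ℝ] ℝ :=
  (innerSL ℝ (ι (s t) - ι (s 0) - ∫ τ in (0 : ℝ)..t, h τ)).comp ι +
    innerSL ℝ (∫ τ in (0 : ℝ)..t, s τ)

theorem weakDefect_apply (ι : X →L[ℝ] H) {s : ℝ → X} {h : ℝ → H} (hs : Continuous s)
    (hh : Continuous h) (t : ℝ) (ψ : X) :
    weakDefect ι s h t ψ = ⟪ι (s t), ι ψ⟫ -
      (⟪ι (s 0), ι ψ⟫ + ∫ τ in (0 : ℝ)..t, (-⟪s τ, ψ⟫ + ⟪h τ, ι ψ⟫)) := by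
  have h1 : ∫ τ in (0 : ℝ)..t, ⟪s τ, ψ⟫ = ⟪∫ τ in (0 : ℝ)..t, s τ, ψ⟫ := by
    have := (innerSL ℝ ψ).intervalIntegral_comp_comm (hs.intervalIntegrable (μ := volume) 0 t)
    simp only [innerSL_apply_apply] at this
    simpa only [real_inner_comm ψ] using this
  have h2 : ∫ τ in (0 : ℝ)..t, ⟪h τ, ι ψ⟫ = ⟪∫ τ in (0 : ℝ)..t, h τ, ι ψ⟫ := by
    have := (innerSL ℝ (ι ψ)).intervalIntegral_comp_comm
      (hh.intervalIntegrable (μ := volume) 0 t)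
    simp only [innerSL_apply_apply] at this
    simpa only [real_inner_comm (ι ψ)] using this
  rw [intervalIntegral.integral_add (Continuous.intervalIntegrable (by fun_prop) _ _)
    (Continuous.intervalIntegrable (by fun_prop) _ _), intervalIntegral.integral_neg, h1, h2]
  simp only [weakDefect, add_apply, ContinuousLinearMap.comp_apply,
    innerSL_apply_apply, inner_sub_left]
  ring

/-- Tested with eX k and multiplied by μ k ^ 2, the weak equation is the k-th coordinate equation.
The defect is a continuous functional, so it vanishes once it does so on the basis, whose span is
dense. -/
theorem DiagonalEmbedding.isLinearFlow_iff {ι : X →L[ℝ] H} {eX : HilbertBasis ℕ ℝ X}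
    {eH : HilbertBasis ℕ ℝ H} {μ : ℕ → ℝ} (D : DiagonalEmbedding ι eX eH μ) {T : ℝ} {s : ℝ → X}
    {h : ℝ → H} (hs : Continuous s) (hh : Continuous h) :
    IsLinearFlow eX eH μ T s h ↔ ∀ t ∈ Icc 0 T, weakDefect ι s h t = 0 := by
  have key : ∀ k t, μ k ^ 2 * weakDefect ι s h t (eX k) = ⟪eX k, s t⟫ - (⟪eX k, s 0⟫ +
      ∫ τ in (0 : ℝ)..t, (-(μ k ^ 2 * ⟪eX k, s τ⟫) + μ k * ⟪eH k, h τ⟫)) := by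
    intro k t
    have hμ : μ k ≠ 0 := (zero_lt_one.trans_le (D.one_le k)).ne'
    have h1 : ι (eX k) = (μ k)⁻¹ • eH k := by
      rw [← D.smul_map k, smul_smul, inv_mul_cancel₀ hμ, one_smul]
    have h2 : ∀ x, μ k ^ 2 * ⟪ι x, ι (eX k)⟫ = ⟪eX k, x⟫ := fun x => by
      rw [h1, real_inner_smul_right, real_inner_comm, D.inner_eq]
      field_simp
    have h3 : ∀ y, μ k ^ 2 * ⟪y, ι (eX k)⟫ = μ k * ⟪eH k, y⟫ := fun y => by
      rw [h1, real_inner_smul_right, real_inner_comm]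
      field_simp
    rw [weakDefect_apply ι hs hh, mul_sub, mul_add, h2, h2,
      ← intervalIntegral.integral_const_mul]
    simp only [mul_add, h3, mul_neg, real_inner_comm (eX k)]
  constructor
  · intro hf t ht
    refine ContinuousLinearMap.ext_on (Submodule.dense_iff_topologicalClosure_eq_top.2
      eX.dense_span) ?_
    rintro _ ⟨k, rfl⟩
    have hμ : μ k ^ 2 ≠ 0 := pow_ne_zero 2 (zero_lt_one.trans_le (D.one_le k)).ne'
    have h1 := key k t
    rw [← hf.equation k t ht, sub_self] at h1
    exact (mul_eq_zero.1 h1).resolve_left hμ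
  · intro hw
    refine ⟨hs, hh, fun k t ht => ?_⟩
    have h1 := key k t
    rw [hw t ht, zero_apply, mul_zero] at h1
    linarith

end WeakForm

/-! ### Weak solutions of the parabolic equation -/

section Solutions

variable {f : ℝ → ℝ} {σ : ℝ} (hσ : σ = 1 ∨ σ = -1) {m : ℝ} (hm : 0 < m) (hm1 : m ≤ 1)

/-- The forcing term `u ^ m`. -/
def forcing (u : C(ℝ≥0, L2pi)) (τ : ℝ) : L2pi := powerL2 hσ hm hm1 (u τ.toNNReal)

theorem continuous_forcing (u : C(ℝ≥0, L2pi)) : Continuous (forcing hσ hm hm1 u) :=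
  (continuous_powerL2 hσ hm hm1).comp (u.continuous.comp continuous_real_toNNReal)

/-- `s` solves the parabolic equation on `[0, T]`. -/
def IsFlow (hf : Continuous f) (u : C(ℝ≥0, L2pi)) (T : ℝ) (s : ℝ → H10) : Prop :=
  IsLinearFlow sinBasisH10 sinBasisL2 (fun k => (k : ℝ) + 1) T s
    fun τ => forcing hσ hm hm1 u τ - superposition f hf (s τ)

theorem integral_weak_eq (hf : Continuous f) (v : L2pi) (s : H10) {ψ : ℝ → ℝ}
    (hψ : IsTestFun ⊤ ψ) :
    ∫ x in Ioo 0 Real.pi, (-(H10.dx s x * deriv ψ x)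
      + (-f (H10.toL2 s x) + signedPower σ m (v x)) * ψ x) =
    -⟪s, H10.ofTest ψ hψ.of_top⟫ +
      ⟪powerL2 hσ hm hm1 v - superposition f hf s, H10.toL2L (H10.ofTest ψ hψ.of_top)⟫ := by
  have hψ1 := hψ.of_top
  have i1 : Integrable (fun x => H10.dx s x * deriv ψ x) volPi :=
    (Lp.memLp (H10.dx s)).integrable_mul (memLp_volPi_of_continuous hψ1.continuous_deriv)
  have i2 : Integrable (fun x => (powerL2 hσ hm hm1 v - superposition f hf s) x * ψ x) volPi :=
    (Lp.memLp _).integrable_mul (memLp_volPi_of_continuous hψ1.continuous)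
  have i3 : Integrable (fun x => -(H10.dx s x * deriv ψ x)) volPi := i1.neg
  rw [H10.toL2L_apply, H10.inner_eq, H10.dx_ofTest, H10.toL2_ofTest, inner_ofContinuous,
    inner_ofContinuous, ← integral_neg, ← integral_add i3 i2]
  refine integral_congr_ae ?_
  filter_upwards [Lp.coeFn_sub (powerL2 hσ hm hm1 v) (superposition f hf s),
    coeFn_powerL2 hσ hm hm1 v, coeFn_superposition hf s] with x h1 h2 h3
  rw [h1, Pi.sub_apply, h2, h3]
  ring

theorem continuous_superposition (hf : LocallyLipschitz f) :
    Continuous (superposition f hf.continuous) :=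
  continuous_of_lipschitz_on_balls (exists_norm_superposition_sub_le hf)

theorem continuous_forcing_sub (hf : LocallyLipschitz f) (u : C(ℝ≥0, L2pi)) {s : ℝ → H10}
    (hs : Continuous s) :
    Continuous fun τ => forcing hσ hm hm1 u τ - superposition f hf.continuous (s τ) :=
  (continuous_forcing hσ hm hm1 u).sub ((continuous_superposition hf).comp hs)

theorem weakDefect_ofTest (hf : LocallyLipschitz f) (u : C(ℝ≥0, L2pi)) {s : ℝ → H10}
    (hs : Continuous s) {ψ : ℝ → ℝ} (hψ : IsTestFun ⊤ ψ) (t : ℝ) :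
    weakDefect H10.toL2L s (fun τ => forcing hσ hm hm1 u τ - superposition f hf.continuous (s τ)) t
        (H10.ofTest ψ hψ.of_top) =
      (∫ x in Ioo 0 Real.pi, H10.toL2 (s t) x * ψ x) -
        ((∫ x in Ioo 0 Real.pi, H10.toL2 (s 0) x * ψ x) +
          ∫ τ in (0 : ℝ)..t, ∫ x in Ioo 0 Real.pi, (-(H10.dx (s τ) x * deriv ψ x)
            + (-f (H10.toL2 (s τ) x) + signedPower σ m (u τ.toNNReal x)) * ψ x)) := by
  rw [weakDefect_apply _ hs (continuous_forcing_sub hσ hm hm1 hf u hs)]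
  simp only [integral_weak_eq hσ hm hm1 hf.continuous _ _ hψ]
  simp only [H10.toL2L_apply, H10.toL2_ofTest, inner_ofContinuous]
  rfl

theorem IsWeakSolution.isFlow (hf : LocallyLipschitz f) {T : ℝ≥0∞} {s₀ : H10} {u : C(ℝ≥0, L2pi)}
    {s : ℝ≥0 → H10} (hs : IsWeakSolution f σ m T s₀ u s) {t₀ : ℝ≥0} (ht₀ : (t₀ : ℝ≥0∞) < T) :
    IsFlow hσ hm hm1 hf.continuous u t₀ fun τ => s (min τ.toNNReal t₀) := by
  -- Freezing the curve before 0 and after t₀ makes it continuous on ℝ although s is controlled only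
  -- on [0, T).
  have hc : Continuous fun τ : ℝ => s (min τ.toNNReal t₀) :=
    hs.continuousOn.comp_continuous (by fun_prop) fun τ =>
      lt_of_le_of_lt (ENNReal.coe_le_coe.2 (min_le_right _ _)) ht₀
  refine (diagonalEmbedding_toL2L.isLinearFlow_iff hc (continuous_forcing_sub hσ hm hm1 hf u hc)).2 fun t ht => ?_
  have hmin : ∀ τ ∈ Icc 0 t, min τ.toNNReal t₀ = τ.toNNReal := fun τ hτ =>
    min_eq_left (Real.toNNReal_le_iff_le_coe.2 (hτ.2.trans ht.2))
  refine H10.eq_of_eqOn_test fun ψ hψ => ?_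
  have ht' : (t.toNNReal : ℝ≥0∞) < T :=
    lt_of_le_of_lt (ENNReal.coe_le_coe.2 (Real.toNNReal_le_iff_le_coe.2 ht.2)) ht₀
  have heq := hs.equation t.toNNReal ht' ψ hψ
  rw [weakDefect_ofTest hσ hm hm1 hf u hc hψ, hmin t ⟨ht.1, le_rfl⟩, hmin 0 ⟨le_rfl, ht.1⟩,
    Real.toNNReal_zero, hs.initial, heq, Real.coe_toNNReal t ht.1, add_sub_add_left_eq_sub,
    zero_apply, sub_eq_zero]
  refine intervalIntegral.integral_congr fun τ hτ => ?_
  rw [uIcc_of_le ht.1] at hτ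
  simp only [hmin τ hτ]

theorem isWeakSolution_of_isFlow (hf : LocallyLipschitz f) {u : C(ℝ≥0, L2pi)} {s : ℝ≥0 → H10}
    (hc : Continuous s)
    (hs : ∀ T, IsFlow hσ hm hm1 hf.continuous u T fun τ => s τ.toNNReal) :
    IsWeakSolution f σ m ⊤ (s 0) u s where
  continuousOn := hc.continuousOn
  initial := rfl
  equation t _ ψ hψ := by
    have hc' : Continuous fun τ : ℝ => s τ.toNNReal := hc.comp continuous_real_toNNReal
    have h3 := (diagonalEmbedding_toL2L.isLinearFlow_iff hc' (continuous_forcing_sub hσ hm hm1 hf u hc')).1 (hs t) t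
      ⟨t.2, le_rfl⟩
    have h4 := weakDefect_ofTest hσ hm hm1 hf u hc' hψ t
    rw [h3, zero_apply, Real.toNNReal_coe, Real.toNNReal_zero] at h4
    exact sub_eq_zero.1 h4.symm

/-! ### Uniqueness, energy inequality and global existence for the parabolic equation -/

theorem IsFlow.eq_of_eq_zero (hf : LocallyLipschitz f) {u : C(ℝ≥0, L2pi)} {T : ℝ}
    {s s' : ℝ → H10} (hs : IsFlow hσ hm hm1 hf.continuous u T s)
    (hs' : IsFlow hσ hm hm1 hf.continuous u T s') (h0 : s 0 = s' 0) : ∀ t ∈ Icc 0 T, s t = s' t :=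
  diagonalEmbedding_toL2L.flow_unique (exists_norm_superposition_sub_le hf) hs hs' h0

theorem IsFlow.energy_le (hf : LocallyLipschitz f) (hmono : Monotone f) (h0 : f 0 = 0)
    {u : C(ℝ≥0, L2pi)} {T : ℝ} {s : ℝ → H10} (hs : IsFlow hσ hm hm1 hf.continuous u T s) {r t : ℝ}
    (hr : 0 ≤ r) (hrt : r ≤ t) (htT : t ≤ T) :
    energy f (s t) - energy f (s r) ≤
      ∫ τ in r..t, dissipation ‖s τ‖ ‖forcing hσ hm hm1 u τ‖ := by
  rw [energy_eq hf.continuous, energy_eq hf.continuous]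
  exact diagonalEmbedding_toL2L.energy_le (isGradientOf_superposition hf hmono h0)
    (continuous_forcing hσ hm hm1 u) hs hr hrt htT

/-- Solve with f made constant outside [-R, R], which is globally Lipschitz, and use the energy to
see that the solution never leaves the range where f is unchanged. -/
theorem exists_isFlow (hf : LocallyLipschitz f) (hmono : Monotone f) (h0 : f 0 = 0) (s₀ : H10)
    (u : C(ℝ≥0, L2pi)) {T : ℝ} (hT : 0 ≤ T) :
    ∃ s, IsFlow hσ hm hm1 hf.continuous u T s ∧ s 0 = s₀ := by
  have hgc := continuous_forcing hσ hm hm1 u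
  have hqc : Continuous fun τ => ‖forcing hσ hm hm1 u τ‖ ^ 2 / 4 := by fun_prop
  -- The a priori bound of the energy on [0, T]. It does not depend on the cut-off, since s₀ has the
  -- same energy for f and for the truncated f; hence R can be fixed in advance.
  set M := energy f s₀ + ∫ τ in (0 : ℝ)..T, ‖forcing hσ hm hm1 u τ‖ ^ 2 / 4 with hM
  have hI : 0 ≤ ∫ τ in (0 : ℝ)..T, ‖forcing hσ hm hm1 u τ‖ ^ 2 / 4 :=
    intervalIntegral.integral_nonneg hT fun _ _ => by positivity
  have hbound : ∀ s : H10, ‖s‖ ^ 2 / 2 ≤ M → √Real.pi * ‖s‖ ≤ √Real.pi * √(2 * M) := fun s h =>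
    mul_le_mul_of_nonneg_left (Real.le_sqrt_of_sq_le (by linarith)) (Real.sqrt_nonneg _)
  set R := √Real.pi * √(2 * M) with hR
  have hR0 : 0 ≤ R := by positivity
  have hs₀ : √Real.pi * ‖s₀‖ ≤ R := hbound s₀ (by
    have := potentialEnergy_nonneg hf.continuous hmono h0 s₀
    rw [hM, energy_eq hf.continuous]
    linarith)
  obtain ⟨L, hL⟩ := exists_lipschitz_clampArg hf hR0
  have hcl : LocallyLipschitz (clampArg f R) := hL.locallyLipschitz
  have hmc := monotone_clampArg hmono R
  have heq : ∀ y, |y| ≤ R → clampArg f R y = f y := fun y hy => clampArg_eq f hy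
  have h0c : clampArg f R 0 = 0 := by rw [heq 0 (by rwa [abs_zero]), h0]
  obtain ⟨s, hs, hs0⟩ := diagonalEmbedding_toL2L.exists_flow_of_lipschitz hT s₀ hgc
    (N := superposition (clampArg f R) hcl.continuous) (L := L) fun x y =>
      norm_superposition_sub_le hcl.continuous (R := max (√Real.pi * ‖x‖) (√Real.pi * ‖y‖)) L.2
        (fun a b _ _ => hL.dist_le_mul a b) (le_max_left _ _) (le_max_right _ _)
  have hsb : ∀ t ∈ Icc 0 T, √Real.pi * ‖s t‖ ≤ R := fun t ht => by
    refine hbound _ ?_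
    have h1 := IsFlow.energy_le hσ hm hm1 hcl hmc h0c hs le_rfl ht.1 ht.2
    have h2 : ∫ τ in (0 : ℝ)..t, dissipation ‖s τ‖ ‖forcing hσ hm hm1 u τ‖ ≤
        ∫ τ in (0 : ℝ)..T, ‖forcing hσ hm hm1 u τ‖ ^ 2 / 4 := by
      have hsc := hs.continuous
      exact (intervalIntegral.integral_mono_on ht.1
        (Continuous.intervalIntegrable (by fun_prop) _ _) (hqc.intervalIntegrable _ _)
        fun τ _ => dissipation_le_sq _ _).trans
        (intervalIntegral.integral_mono_interval le_rfl ht.1 ht.2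
          (Eventually.of_forall fun τ => by positivity) (hqc.intervalIntegrable _ _))
    rw [hs0, energy_eq hcl.continuous, energy_eq hcl.continuous,
      potentialEnergy_congr heq hs₀] at h1
    have h3 := potentialEnergy_nonneg hcl.continuous hmc h0c (s t)
    rw [hM, energy_eq hf.continuous]
    linarith
  refine ⟨s, IsLinearFlow.congr hs hs.continuous ?_ (fun _ _ => rfl) fun t ht => ?_, hs0⟩
  · exact continuous_forcing_sub hσ hm hm1 hf u hs.continuous
  · rw [superposition_congr hcl.continuous hf.continuous heq (hsb t ht)]

theorem exists_global_isFlow (hf : LocallyLipschitz f) (hmono : Monotone f) (h0 : f 0 = 0)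
    (s₀ : H10) (u : C(ℝ≥0, L2pi)) :
    ∃ s : ℝ≥0 → H10, s 0 = s₀ ∧ Continuous s ∧
      ∀ T, IsFlow hσ hm hm1 hf.continuous u T fun τ => s τ.toNNReal := by
  choose S hS hS0 using fun n : ℕ => exists_isFlow hσ hm hm1 hf hmono h0 s₀ u n.cast_nonneg
  have hSS : ∀ n n' : ℕ, n ≤ n' → ∀ t ∈ Icc (0 : ℝ) n, S n t = S n' t := fun n n' hn =>
    IsFlow.eq_of_eq_zero hσ hm hm1 hf (hS n) (IsLinearFlow.mono (hS n') (by exact_mod_cast hn))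
      (by rw [hS0, hS0])
  -- By uniqueness the solutions on [0, n] extend one another, so any n ≥ t gives the same value.
  let s : ℝ≥0 → H10 := fun t => S ⌈t⌉₊ t
  have hs : ∀ n : ℕ, ∀ t : ℝ≥0, t ≤ n → s t = S n t := fun n t ht =>
    hSS ⌈t⌉₊ n (Nat.ceil_le.2 ht) t ⟨t.2, by exact_mod_cast Nat.le_ceil t⟩
  have hsc : Continuous s := by
    refine continuous_iff_continuousAt.2 fun t => ?_
    obtain ⟨n, hn⟩ := exists_nat_gt t
    have h1 : ContinuousAt (fun t : ℝ≥0 => S n t) t :=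
      ((hS n).continuous.comp NNReal.continuous_coe).continuousAt
    exact h1.congr ((gt_mem_nhds hn).mono fun z hz => (hs n z (le_of_lt hz)).symm)
  have hsc' : Continuous fun τ : ℝ => s τ.toNNReal := hsc.comp continuous_real_toNNReal
  refine ⟨s, ?_, hsc, fun T => ?_⟩
  · rw [hs 0 0 (by simp)]
    exact_mod_cast hS0 0
  · obtain ⟨n, hn⟩ := exists_nat_ge T
    have heq : ∀ t ∈ Icc 0 T, S n t = s t.toNNReal := fun t ht => by
      rw [hs n t.toNNReal (Real.toNNReal_le_iff_le_coe.2 (by exact_mod_cast ht.2.trans hn)),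
        Real.coe_toNNReal t ht.1]
    refine IsLinearFlow.congr (IsLinearFlow.mono (hS n) hn) hsc'
      (continuous_forcing_sub hσ hm hm1 hf u hsc') heq
      fun t ht => ?_
    rw [heq t ht]

end Solutions

/-! ### The solution map -/

/-- `φ` is the solution map of the parabolic equation. -/
structure IsSolutionMap {f : ℝ → ℝ} (hf : LocallyLipschitz f) {σ : ℝ} (hσ : σ = 1 ∨ σ = -1) {m : ℝ}
    (hm : 0 < m) (hm1 : m ≤ 1) (φ : ℝ≥0 → H10 → C(ℝ≥0, L2pi) → H10) : Prop where
  initial : ∀ x u, φ 0 x u = x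
  continuous : ∀ x u, Continuous fun t => φ t x u
  isFlow : ∀ x u T, IsFlow hσ hm hm1 hf.continuous u T fun τ => φ τ.toNNReal x u

theorem exists_isSolutionMap {f : ℝ → ℝ} (hf : LocallyLipschitz f) (hmono : Monotone f)
    (h0 : f 0 = 0) {σ : ℝ} (hσ : σ = 1 ∨ σ = -1) {m : ℝ} (hm : 0 < m) (hm1 : m ≤ 1) :
    ∃ φ, IsSolutionMap hf hσ hm hm1 φ := by
  choose s h1 h2 h3 using exists_global_isFlow hσ hm hm1 hf hmono h0
  exact ⟨fun t x u => s x u t, h1, h2, h3⟩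

namespace IsSolutionMap

variable {f : ℝ → ℝ} {hf : LocallyLipschitz f} {σ : ℝ} {hσ : σ = 1 ∨ σ = -1} {m : ℝ} {hm : 0 < m}
  {hm1 : m ≤ 1} {φ : ℝ≥0 → H10 → C(ℝ≥0, L2pi) → H10}

theorem isWeakSolution (h : IsSolutionMap hf hσ hm hm1 φ) (x : H10) (u : C(ℝ≥0, L2pi)) :
    IsWeakSolution f σ m ⊤ x u fun t => φ t x u := by
  have := isWeakSolution_of_isFlow hσ hm hm1 hf (h.continuous x u) (h.isFlow x u)
  rwa [h.initial] at this

theorem eq_of_isFlow (h : IsSolutionMap hf hσ hm hm1 φ) {u : C(ℝ≥0, L2pi)} {t : ℝ≥0} {s : ℝ → H10}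
    (hs : IsFlow hσ hm hm1 hf.continuous u t s) : s t = φ t (s 0) u := by
  have := IsFlow.eq_of_eq_zero hσ hm hm1 hf hs (h.isFlow (s 0) u t)
    (by rw [Real.toNNReal_zero, h.initial]) t ⟨t.2, le_rfl⟩
  rwa [Real.toNNReal_coe] at this

theorem eq_of_isWeakSolution (h : IsSolutionMap hf hσ hm hm1 φ) {T : ℝ≥0∞} {x : H10}
    {u : C(ℝ≥0, L2pi)} {s : ℝ≥0 → H10} (hs : IsWeakSolution f σ m T x u s) {t : ℝ≥0}
    (ht : (t : ℝ≥0∞) < T) : s t = φ t x u := by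
  have := h.eq_of_isFlow (hs.isFlow hσ hm hm1 hf ht)
  simpa [hs.initial] using this

/-- Causality and the semigroup property are uniqueness statements: the other trajectory,
respectively the shifted one, solves the same problem on [0, t]. -/
theorem isControlSystem (h : IsSolutionMap hf hσ hm hm1 φ) : IsControlSystem φ where
  identity := h.initial
  causality t x u v huv := by
    have hc : Continuous fun τ : ℝ => φ τ.toNNReal x v :=
      (h.continuous x v).comp continuous_real_toNNReal
    have h1 : IsFlow hσ hm hm1 hf.continuous u t fun τ => φ τ.toNNReal x v := by
      refine IsLinearFlow.congr (h.isFlow x v t) hc (continuous_forcing_sub hσ hm hm1 hf u hc)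
        (fun _ _ => rfl) fun τ hτ => ?_
      rw [forcing, forcing, huv τ.toNNReal (Real.toNNReal_le_iff_le_coe.2 hτ.2)]
    have h2 := h.eq_of_isFlow h1
    rw [Real.toNNReal_coe, Real.toNNReal_zero, h.initial] at h2
    exact h2.symm
  continuity := h.continuous
  semigroup t r x u := by
    have hc : Continuous fun τ : ℝ => φ (r + τ.toNNReal) x u :=
      (h.continuous x u).comp (continuous_const.add continuous_real_toNNReal)
    have hadd : ∀ τ ∈ Icc (0 : ℝ) t, (τ + r).toNNReal = τ.toNNReal + r := fun τ hτ => by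
      rw [Real.toNNReal_add hτ.1 r.coe_nonneg, Real.toNNReal_coe]
    have h1 : IsFlow hσ hm hm1 hf.continuous (shiftInput r u) t
        fun τ => φ (r + τ.toNNReal) x u := by
      have h2 := IsLinearFlow.shift (h.isFlow x u (t + r)) r.coe_nonneg
      rw [add_sub_cancel_right] at h2
      refine IsLinearFlow.congr h2 hc (continuous_forcing_sub hσ hm hm1 hf _ hc) (fun τ hτ => ?_) fun τ hτ => ?_
      · simp only [hadd τ hτ, add_comm]
      · simp only [forcing, hadd τ hτ, add_comm]
        rw [add_comm r]
        rfl
    have h2 := h.eq_of_isFlow h1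
    rwa [Real.toNNReal_coe, Real.toNNReal_zero, add_zero] at h2

end IsSolutionMap


/-! ### Growth of the energy -/

/-- Lipschitz constants on integer balls, summed, form a nondecreasing step function G; its mean
over [R, R + 1] is continuous, still nondecreasing, and at least G(R). -/
theorem LocallyLipschitz.exists_continuous_linear_bound {f : ℝ → ℝ} (hf : LocallyLipschitz f)
    (h0 : f 0 = 0) :
    ∃ K : ℝ → ℝ, Continuous K ∧ Monotone K ∧ (∀ R, 0 ≤ K R) ∧
      ∀ R y, |y| ≤ R → |f y| ≤ K R * |y| := by
  choose L hL0 hL using fun n : ℕ => hf.exists_abs_sub_le n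
  let G : ℝ → ℝ := fun R => ∑ i ∈ Finset.range (⌈R⌉₊ + 1), L i
  have hG0 : ∀ R, 0 ≤ G R := fun R => Finset.sum_nonneg fun i _ => hL0 i
  have hGm : Monotone G := fun R R' h => Finset.sum_le_sum_of_subset_of_nonneg
    (Finset.range_mono (Nat.add_le_add_right (Nat.ceil_mono h) 1)) fun i _ _ => hL0 i
  have hGf : ∀ R y, |y| ≤ R → |f y| ≤ G R * |y| := fun R y hy => by
    have h1 := hL ⌈R⌉₊ y 0 (hy.trans (Nat.le_ceil R)) (by simp)
    rw [h0, sub_zero, sub_zero] at h1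
    exact h1.trans (mul_le_mul_of_nonneg_right (Finset.single_le_sum (fun i _ => hL0 i)
      (Finset.mem_range.2 (Nat.lt_succ_self _))) (abs_nonneg y))
  have hi : ∀ a b, IntervalIntegrable G volume a b := fun a b => hGm.intervalIntegrable
  let K : ℝ → ℝ := fun R => ∫ z in R..R + 1, G z
  have hKG : ∀ R, G R ≤ K R := fun R => by
    have := intervalIntegral.integral_mono_on (by linarith : R ≤ R + 1)
      (intervalIntegrable_const (c := G R)) (hi R (R + 1)) fun x hx => hGm hx.1
    simpa using this
  refine ⟨K, ?_, ?_, fun R => (hG0 R).trans (hKG R), fun R y hy =>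
    (hGf R y hy).trans (mul_le_mul_of_nonneg_right (hKG R) (abs_nonneg y))⟩
  · have h1 : K = fun R => (∫ z in (0 : ℝ)..R + 1, G z) - ∫ z in (0 : ℝ)..R, G z := by
      funext R
      exact (intervalIntegral.integral_interval_sub_left (hi _ _) (hi _ _)).symm
    have h2 := intervalIntegral.continuous_primitive hi 0
    rw [h1]
    exact (h2.comp (continuous_add_const 1)).sub h2
  · intro R R' h
    have h1 : ∀ R, K R = ∫ z in (0 : ℝ)..1, G (z + R) := fun R => by
      rw [intervalIntegral.integral_comp_add_right, zero_add, add_comm 1 R]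
    have h2 : ∀ R, IntervalIntegrable (fun z => G (z + R)) volume 0 1 := fun R =>
      (show Monotone fun z => G (z + R) from fun _ _ hz =>
        hGm (add_le_add_left hz R)).intervalIntegrable
    rw [h1, h1]
    exact intervalIntegral.integral_mono_on zero_le_one (h2 R) (h2 R') fun z _ =>
      hGm (by linarith)

theorem half_sq_le_energy {f : ℝ → ℝ} (hf : Continuous f) (hm : Monotone f) (h0 : f 0 = 0)
    (s : H10) : ‖s‖ ^ 2 / 2 ≤ energy f s := by
  rw [energy_eq hf]
  linarith [potentialEnergy_nonneg hf hm h0 s]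

/-- Convexity, used at y with the other point 0, bounds the potential at y by f(y)y ≤ Cy². -/
theorem energy_le_of_linear_bound {f : ℝ → ℝ} (hf : Continuous f) (hm : Monotone f) {R C : ℝ}
    (hC : 0 ≤ C) (hfC : ∀ y, |y| ≤ R → |f y| ≤ C * |y|) {s : H10} (hs : √Real.pi * ‖s‖ ≤ R) :
    energy f s ≤ (1 / 2 + C) * ‖s‖ ^ 2 := by
  have h1 : potentialEnergy f s ≤ C * ‖H10.toL2 s‖ ^ 2 := by
    rw [L2pi.norm_sq_eq, ← integral_const_mul]
    have hi : Integrable (fun x => H10.toL2 s x ^ 2) volPi := by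
      simpa only [sq] using L2pi.integrable_mul (H10.toL2 s) (H10.toL2 s)
    refine integral_mono_ae (integrable_potential hf s) (hi.const_mul C) ?_
    filter_upwards [H10.abs_toL2_le s] with x hx
    have h2 := mul_sub_le_potential_sub hf hm (H10.toL2 s x) 0
    have h3 : potential f 0 = 0 := by simp [potential]
    have h4 := mul_le_mul_of_nonneg_right (hfC _ (hx.trans hs)) (abs_nonneg (H10.toL2 s x))
    rw [← abs_mul, mul_assoc, ← sq, sq_abs] at h4
    have h5 := le_abs_self (f (H10.toL2 s x) * H10.toL2 s x)
    rw [h3] at h2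
    linarith
  have h2 := pow_le_pow_left₀ (norm_nonneg _) (diagonalEmbedding_toL2L.norm_map_le s) 2
  have h3 := mul_le_mul_of_nonneg_left h2 hC
  rw [energy_eq hf]
  rw [H10.toL2L_apply] at h3
  linarith

theorem continuous_energy {f : ℝ → ℝ} (hf : LocallyLipschitz f) (hm : Monotone f) (h0 : f 0 = 0) :
    Continuous (energy f) := by
  have h1 : Continuous (potentialEnergy f) := continuous_iff_continuousAt.2 fun s =>
    ((isGradientOf_superposition hf hm h0).hasFDerivAt s).continuousAt
  rw [show energy f = fun s => ‖s‖ ^ 2 / 2 + potentialEnergy f s from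
    funext fun s => energy_eq hf.continuous s]
  fun_prop

/-! ### Comparison functions -/

theorem isClassK_gain {a : ℝ≥0} (ha : 0 < a) {m : ℝ} (hm : 0 < m) : IsClassK (gain a m) where
  continuous := continuous_const.mul (NNReal.continuous_rpow_const hm.le)
  strictMono r r' h := by
    have h1 : 0 < a * NNReal.pi ^ ((1 - m) / 2) := mul_pos ha (NNReal.rpow_pos NNReal.pi_pos)
    exact mul_lt_mul_of_pos_left (NNReal.rpow_lt_rpow h hm) h1
  map_zero := by rw [gain, NNReal.zero_rpow hm.ne', mul_zero]

theorem coe_gain (a : ℝ≥0) (m : ℝ) (r : ℝ≥0) :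
    (gain a m r : ℝ) = a * (Real.pi ^ ((1 - m) / 2) * (r : ℝ) ^ m) := by
  simp [gain, mul_assoc]

theorem nnnorm_le_inputNorm {U : Type*} [NormedAddCommGroup U] {u : C(ℝ≥0, U)}
    (hu : inputNorm u ≠ ⊤) (t : ℝ≥0) : ‖u t‖₊ ≤ (inputNorm u).toNNReal := by
  have h : ‖u t‖ₑ ≤ inputNorm u := le_iSup (fun t => ‖u t‖ₑ) t
  have h2 := ENNReal.toNNReal_mono hu h
  simpa using h2

/-- A function of class `K∞` bounding the norm in terms of the energy. -/
def growthRadius (K : ℝ → ℝ) (r : ℝ) : ℝ := r * √(1 + 2 * K (√Real.pi * r))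

section Growth

variable {K : ℝ → ℝ}

theorem continuous_growthRadius (hK : Continuous K) : Continuous (growthRadius K) := by
  unfold growthRadius; fun_prop

theorem growthRadius_zero : growthRadius K 0 = 0 := by simp [growthRadius]

/-- `growthRadius` is designed so that half its square is the upper bound of the energy at norm r.
-/
theorem growthRadius_sq (hK0 : ∀ R, 0 ≤ K R) (r : ℝ) :
    growthRadius K r ^ 2 = 2 * ((1 / 2 + K (√Real.pi * r)) * r ^ 2) := by
  rw [growthRadius, mul_pow, Real.sq_sqrt (by linarith [hK0 (√Real.pi * r)])]
  ring

theorem growthRadius_lt (hKm : Monotone K) (hK0 : ∀ R, 0 ≤ K R) {r r' : ℝ} (hr : 0 ≤ r)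
    (h : r < r') : growthRadius K r < growthRadius K r' := by
  have h1 : √(1 + 2 * K (√Real.pi * r)) ≤ √(1 + 2 * K (√Real.pi * r')) :=
    Real.sqrt_le_sqrt (by
      linarith [hKm (mul_le_mul_of_nonneg_left h.le (Real.sqrt_nonneg Real.pi))])
  have h2 : 0 < √(1 + 2 * K (√Real.pi * r)) :=
    Real.sqrt_pos.2 (by linarith [hK0 (√Real.pi * r)])
  exact mul_lt_mul h h1 h2 (hr.trans h.le)

theorem le_growthRadius (hK0 : ∀ R, 0 ≤ K R) {r : ℝ} (hr : 0 ≤ r) : r ≤ growthRadius K r :=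
  le_mul_of_one_le_right hr (Real.one_le_sqrt.2 (by linarith [hK0 (√Real.pi * r)]))

theorem growthRadius_nonneg {r : ℝ} (hr : 0 ≤ r) : 0 ≤ growthRadius K r :=
  mul_nonneg hr (Real.sqrt_nonneg _)

/-- The rate of exponential decay of the energy along trajectories that start in the ball of
radius `r`. -/
def decayRate (K : ℝ → ℝ) (r : ℝ) : ℝ := (2 + 4 * K (√Real.pi * growthRadius K r))⁻¹

theorem decayRate_pos (hK0 : ∀ R, 0 ≤ K R) (r : ℝ) : 0 < decayRate K r :=
  inv_pos.2 (by linarith [hK0 (√Real.pi * growthRadius K r)])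

theorem continuous_decayRate (hK : Continuous K) (hK0 : ∀ R, 0 ≤ K R) :
    Continuous (decayRate K) := by
  have := continuous_growthRadius hK
  unfold decayRate
  refine Continuous.inv₀ (by fun_prop) fun r => ?_
  linarith [hK0 (√Real.pi * growthRadius K r)]

theorem decayRate_anti (hKm : Monotone K) (hK0 : ∀ R, 0 ≤ K R) {r r' : ℝ} (hr : 0 ≤ r)
    (h : r < r') : decayRate K r' ≤ decayRate K r := by
  have h1 := hKm (mul_le_mul_of_nonneg_left (growthRadius_lt hKm hK0 hr h).le
    (Real.sqrt_nonneg Real.pi))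
  exact inv_anti₀ (by linarith [hK0 (√Real.pi * growthRadius K r)]) (by linarith)

/-- The `KL` function of the ISS estimate. -/
def decayBound (K : ℝ → ℝ) (r t : ℝ≥0) : ℝ≥0 :=
  (growthRadius K r * Real.exp (-(decayRate K r * t / 2))).toNNReal

theorem coe_decayBound (r t : ℝ≥0) :
    (decayBound K r t : ℝ) = growthRadius K r * Real.exp (-(decayRate K r * t / 2)) :=
  Real.coe_toNNReal _ (mul_nonneg (growthRadius_nonneg r.2) (Real.exp_pos _).le)

/-- Strict growth in r comes from the first factor; the exponential does not spoil it because the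
decay rate is nonincreasing in r. -/
theorem isClassKL_decayBound (hK : Continuous K) (hKm : Monotone K) (hK0 : ∀ R, 0 ≤ K R) :
    IsClassKL (decayBound K) where
  left t := by
    have h1 := continuous_growthRadius hK
    have h2 := continuous_decayRate hK hK0
    refine ⟨continuous_real_toNNReal.comp (by fun_prop), fun r r' h => ?_, ?_⟩
    · rw [← NNReal.coe_lt_coe, coe_decayBound, coe_decayBound]
      have h' : (r : ℝ) < r' := h
      have h3 := mul_le_mul_of_nonneg_right (decayRate_anti hKm hK0 r.2 h') t.2
      refine mul_lt_mul (growthRadius_lt hKm hK0 r.2 h') (Real.exp_le_exp.2 ?_)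
        (Real.exp_pos _) (growthRadius_nonneg r'.2)
      simp only [NNReal.val_eq_coe] at h3
      linarith
    · rw [← NNReal.coe_inj, coe_decayBound, NNReal.coe_zero, growthRadius_zero, zero_mul]
  right r hr := by
    have h1 : 0 < growthRadius K r :=
      lt_of_lt_of_le (by exact_mod_cast hr) (le_growthRadius hK0 r.2)
    have h2 := decayRate_pos hK0 r
    refine ⟨continuous_real_toNNReal.comp (by fun_prop), fun t t' h => ?_, ?_⟩
    · rw [← NNReal.coe_lt_coe, coe_decayBound, coe_decayBound]
      refine mul_lt_mul_of_pos_left (Real.exp_lt_exp.2 ?_) h1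
      have h' : (t : ℝ) < t' := h
      nlinarith
    · rw [← NNReal.tendsto_coe]
      simp only [coe_decayBound]
      have h3 : Tendsto (fun t : ℝ≥0 => decayRate K r * (t : ℝ) / 2) atTop atTop :=
        ((NNReal.tendsto_coe_atTop.2 tendsto_id).const_mul_atTop h2).atTop_div_const two_pos
      simpa using (Real.tendsto_exp_neg_atTop_nhds_zero.comp h3).const_mul (growthRadius K r)

/-- The gain function of the ISS estimate. -/
def issGain (K : ℝ → ℝ) (m : ℝ) (r : ℝ≥0) : ℝ≥0 := (growthRadius K (gain 2 m r)).toNNReal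

theorem coe_issGain (m : ℝ) (r : ℝ≥0) : (issGain K m r : ℝ) = growthRadius K (gain 2 m r) :=
  Real.coe_toNNReal _ (growthRadius_nonneg (gain 2 m r).2)

theorem isClassK_issGain (hK : Continuous K) (hKm : Monotone K) (hK0 : ∀ R, 0 ≤ K R) {m : ℝ}
    (hm : 0 < m) : IsClassK (issGain K m) where
  continuous := by
    have h1 := continuous_growthRadius hK
    have h2 := (isClassK_gain two_pos hm).continuous
    exact continuous_real_toNNReal.comp (h1.comp (NNReal.continuous_coe.comp h2))
  strictMono r r' h := by
    rw [← NNReal.coe_lt_coe, coe_issGain, coe_issGain]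
    exact growthRadius_lt hKm hK0 (gain 2 m r).2 ((isClassK_gain two_pos hm).strictMono h)
  map_zero := by
    rw [← NNReal.coe_inj, coe_issGain, (isClassK_gain two_pos hm).map_zero, NNReal.coe_zero,
      growthRadius_zero]

end Growth

/-- If `V` cannot increase above the level `M`, it stays above `M` backwards in time. -/
theorem lt_of_sub_le_integral {V q : ℝ → ℝ} {M t : ℝ} (hV : Continuous V) (hq : Continuous q)
    (h : ∀ r t, 0 ≤ r → r ≤ t → V t - V r ≤ ∫ τ in r..t, q τ)
    (hqM : ∀ τ, 0 ≤ τ → M < V τ → q τ ≤ 0) (hM : M < V t) : ∀ τ ∈ Icc 0 t, M < V τ := by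
  by_contra! hc
  obtain ⟨τ₁, hτ₁, hc⟩ := hc
  have hS : IsCompact (Icc 0 t ∩ V ⁻¹' Iic M) :=
    isCompact_Icc.inter_right (isClosed_Iic.preimage hV)
  -- Take the last time at which V ≤ M. Afterwards q ≤ 0, so V could not have risen to V t > M.
  obtain ⟨τ₀, ⟨hτ₀, hle⟩, hmax⟩ := hS.exists_isGreatest ⟨τ₁, hτ₁, hc⟩
  have h1 : ∫ τ in τ₀..t, q τ ≤ ∫ τ in τ₀..t, (0 : ℝ) :=
    intervalIntegral.integral_mono_on_of_le_Ioo hτ₀.2 (hq.intervalIntegrable _ _)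
      intervalIntegrable_const fun τ hτ => hqM τ (hτ₀.1.trans hτ.1.le) (not_le.1 fun hτM =>
        absurd (hmax ⟨⟨hτ₀.1.trans hτ.1.le, hτ.2.le⟩, hτM⟩) (not_le.2 hτ.1))
  rw [intervalIntegral.integral_zero] at h1
  have h2 := h τ₀ t hτ₀.1 hτ₀.2
  have h3 : V τ₀ ≤ M := hle
  linarith

/-! ### Stability of the parabolic system -/

namespace IsSolutionMap

variable {f : ℝ → ℝ} {hf : LocallyLipschitz f} {σ : ℝ} {hσ : σ = 1 ∨ σ = -1} {m : ℝ} {hm : 0 < m}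
  {hm1 : m ≤ 1} {φ : ℝ≥0 → H10 → C(ℝ≥0, L2pi) → H10}

/-- The dissipation rate is continuous along the trajectory, so only its value at time 0 survives,
and with it only the input value u 0. -/
theorem lieDeriv_le (h : IsSolutionMap hf hσ hm hm1 φ) (hmono : Monotone f) (h0 : f 0 = 0)
    (x : H10) (u : C(ℝ≥0, L2pi)) :
    lieDeriv φ (energy f) x u ≤ (dissipation ‖x‖ ‖powerL2 hσ hm hm1 (u 0)‖ : ℝ) := by
  refine EReal.le_of_forall_lt_iff_le.1 fun r hr => limsup_le_of_le (by isBoundedDefault) ?_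
  have hr' := EReal.coe_lt_coe_iff.1 hr
  have hφ : Continuous fun τ : ℝ => φ τ.toNNReal x u :=
    (h.continuous x u).comp continuous_real_toNNReal
  have hg := continuous_forcing hσ hm hm1 u
  have h1 := eventually_slope_lt_of_sub_le_integral (x := 0) (b := 1) (r := r)
    (V := fun τ => energy f (φ τ.toNNReal x u))
    (q := fun τ => dissipation ‖φ τ.toNNReal x u‖ ‖forcing hσ hm hm1 u τ‖)
    (hφ.norm.dissipation hg.norm) one_pos (fun z hz hz1 => IsFlow.energy_le hσ hm hm1 hf hmono h0 (h.isFlow x u 1) le_rfl hz hz1)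
    (by simpa [forcing, h.initial] using hr')
  have h2 : Tendsto (fun t : ℝ≥0 => (t : ℝ)) (𝓝[>] 0) (𝓝[>] 0) :=
    tendsto_nhdsWithin_iff.2 ⟨(NNReal.continuous_coe.tendsto 0).mono_left nhdsWithin_le_nhds,
      eventually_mem_nhdsWithin.mono fun t ht => NNReal.coe_pos.2 ht⟩
  filter_upwards [h2.eventually h1] with t ht
  rw [Real.toNNReal_coe, Real.toNNReal_zero, h.initial, sub_zero, ← div_eq_inv_mul] at ht
  exact EReal.coe_le_coe_iff.2 ht.le

theorem lieDeriv_le_of_gain_le (h : IsSolutionMap hf hσ hm hm1 φ) (hmono : Monotone f)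
    (h0 : f 0 = 0) {a : ℝ≥0} (ha : 1 < a) (x : H10) (u : C(ℝ≥0, L2pi))
    (hx : gain a m ‖u 0‖₊ ≤ ‖x‖₊) :
    lieDeriv φ (energy f) x u ≤ (((1 / (a : ℝ) - 1) * ‖x‖ ^ 2 : ℝ) : EReal) := by
  refine (h.lieDeriv_le hmono h0 x u).trans (EReal.coe_le_coe_iff.2 ?_)
  have ha' : (1 : ℝ) < a := ha
  have ha0 : (0 : ℝ) < a := zero_lt_one.trans ha'
  set b := ‖powerL2 hσ hm hm1 (u 0)‖ with hb
  have h1 : a * b ≤ ‖x‖ := by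
    have h2 := NNReal.coe_le_coe.2 hx
    rw [coe_gain, coe_nnnorm, coe_nnnorm] at h2
    exact (mul_le_mul_of_nonneg_left (norm_powerL2_le hσ hm hm1 (u 0)) ha0.le).trans h2
  have hb0 : 0 ≤ b := norm_nonneg _
  -- As a > 1, this puts ‖x‖ to the right of the peak b/2, where the dissipation is ‖x‖(b - ‖x‖).
  have h3 : b ≤ ‖x‖ / a := (le_div_iff₀ ha0).2 (by linarith)
  rw [dissipation_of_le (by nlinarith)]
  have h4 := mul_le_mul_of_nonneg_left h3 (norm_nonneg x)
  calc ‖x‖ * (b - ‖x‖) ≤ ‖x‖ * (‖x‖ / a) - ‖x‖ ^ 2 := by linarith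
    _ = _ := by ring

theorem isISSLyapunovFunction (h : IsSolutionMap hf hσ hm hm1 φ) (hmono : Monotone f)
    (h0 : f 0 = 0) {a : ℝ≥0} (ha : 1 < a) :
    IsISSLyapunovFunction φ (energy f) (gain a m) := by
  have hK := isClassK_gain (zero_lt_one.trans ha) hm
  refine ⟨continuous_energy hf hmono h0, hK, ?_, fun r => (1 - a⁻¹) * r ^ 2, ?_, ?_⟩
  · obtain ⟨K, hKc, hKm, hK0, hKf⟩ := hf.exists_continuous_linear_bound h0
    have hρ := fun r => growthRadius_sq hK0 r
    let ψ₂ : ℝ≥0 → ℝ≥0 := fun r => (growthRadius K r ^ 2 / 2).toNNReal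
    have hψ₂ : ∀ r : ℝ≥0, (ψ₂ r : ℝ) = growthRadius K r ^ 2 / 2 := fun r =>
      Real.coe_toNNReal _ (by positivity)
    have hsq : ∀ r : ℝ≥0, (r : ℝ) ^ 2 / 2 ≤ ψ₂ r := fun r => by
      have := pow_le_pow_left₀ r.2 (le_growthRadius hK0 r.2) 2
      rw [hψ₂]
      simp only [NNReal.val_eq_coe] at this
      linarith
    have hunb : ∀ M : ℝ≥0, ∃ r : ℝ≥0, M < r ^ 2 / 2 := fun M => ⟨2 * (M + 1), by
      rw [← NNReal.coe_lt_coe]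
      push_cast
      nlinarith [M.2, NNReal.coe_nonneg M]⟩
    refine ⟨fun r => r ^ 2 / 2, ψ₂, ⟨⟨by fun_prop, fun r r' hr => ?_, by simp⟩, hunb⟩,
      ⟨⟨?_, fun r r' hr => ?_, ?_⟩, fun M => ?_⟩, fun x => ⟨?_, ?_⟩⟩
    · have hr' : (r : ℝ) < r' := hr
      rw [← NNReal.coe_lt_coe]
      push_cast
      nlinarith [NNReal.coe_nonneg r]
    · have := continuous_growthRadius hKc
      exact continuous_real_toNNReal.comp (by fun_prop)
    · rw [← NNReal.coe_lt_coe, hψ₂, hψ₂]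
      have h1 := growthRadius_lt hKm hK0 r.2 (NNReal.coe_lt_coe.2 hr)
      have h2 := growthRadius_nonneg (K := K) r.2
      simp only [NNReal.val_eq_coe] at h1 h2
      nlinarith
    · rw [← NNReal.coe_inj, hψ₂, NNReal.coe_zero, growthRadius_zero]
      simp
    · obtain ⟨r, hr⟩ := hunb M
      refine ⟨r, hr.trans_le ?_⟩
      rw [← NNReal.coe_le_coe]
      push_cast
      exact hsq r
    · have := half_sq_le_energy hf.continuous hmono h0 x
      push_cast
      exact this
    · rw [hψ₂, coe_nnnorm, hρ]
      have := energy_le_of_linear_bound hf.continuous hmono (hK0 _)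
        (hKf (√Real.pi * ‖x‖)) le_rfl
      linarith
  · have h1 : 0 < 1 - a⁻¹ := tsub_pos_of_lt (inv_lt_one_of_one_lt₀ ha)
    exact ⟨by fun_prop, by simp, fun r hr => mul_pos h1 (pow_pos hr 2)⟩
  · intro x u hu hx
    have h1 := h.lieDeriv_le_of_gain_le hmono h0 ha x u
      ((hK.strictMono.monotone (nnnorm_le_inputNorm hu 0)).trans hx)
    refine h1.trans_eq ?_
    have h2 : a⁻¹ ≤ 1 := inv_le_one_of_one_le₀ ha.le
    rw [NNReal.coe_mul, NNReal.coe_sub h2, NNReal.coe_pow, NNReal.coe_inv, NNReal.coe_one,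
      coe_nnnorm, EReal.coe_eq_coe_iff]
    ring

/-- Either V at time t is below the level M fixed by the input, which gives the gain term, or V
exceeded M on all of [0, t] and decayed exponentially, which gives the other term. -/
theorem norm_le (h : IsSolutionMap hf hσ hm hm1 φ) (hmono : Monotone f) (h0 : f 0 = 0) {K : ℝ → ℝ}
    (hKm : Monotone K) (hK0 : ∀ R, 0 ≤ K R) (hKf : ∀ R y, |y| ≤ R → |f y| ≤ K R * |y|) (x : H10)
    {u : C(ℝ≥0, L2pi)} (hu : inputNorm u ≠ ⊤) (t : ℝ≥0) :
    ‖φ t x u‖ ≤ growthRadius K ‖x‖ * Real.exp (-(decayRate K ‖x‖ * t / 2)) +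
      growthRadius K (gain 2 m (inputNorm u).toNNReal) := by
  set B : ℝ := (gain 2 m (inputNorm u).toNNReal : ℝ) with hB
  have hB0 : 0 ≤ B := (gain 2 m (inputNorm u).toNNReal).2
  set s : ℝ → H10 := fun τ => φ τ.toNNReal x u with hs
  have hsc : Continuous s := (h.continuous x u).comp continuous_real_toNNReal
  have hs0 : s 0 = x := by simp only [hs, Real.toNNReal_zero, h.initial]
  have hg : ∀ τ, 2 * ‖forcing hσ hm hm1 u τ‖ ≤ B := fun τ => by
    have h1 := NNReal.coe_le_coe.2 ((isClassK_gain two_pos hm).strictMono.monotone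
      (nnnorm_le_inputNorm hu τ.toNNReal))
    rw [coe_gain 2 m ‖u τ.toNNReal‖₊] at h1
    refine le_trans ?_ h1
    exact mul_le_mul_of_nonneg_left (norm_powerL2_le hσ hm hm1 _) zero_le_two
  have hgc := continuous_forcing hσ hm hm1 u
  set V : ℝ → ℝ := fun τ => energy f (s τ) with hV
  set q : ℝ → ℝ := fun τ => dissipation ‖s τ‖ ‖forcing hσ hm hm1 u τ‖ with hq
  have hVc : Continuous V := (continuous_energy hf hmono h0).comp hsc
  have hqc : Continuous q := by fun_prop
  have hVq : ∀ r t, 0 ≤ r → r ≤ t → V t - V r ≤ ∫ τ in r..t, q τ := fun r t hr hrt =>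
    IsFlow.energy_le hσ hm hm1 hf hmono h0 (h.isFlow x u t) hr hrt le_rfl
  have hlow : ∀ τ, ‖s τ‖ ^ 2 / 2 ≤ V τ := fun τ => half_sq_le_energy hf.continuous hmono h0 _
  have hup : ∀ y : H10, energy f y ≤ growthRadius K ‖y‖ ^ 2 / 2 := fun y => by
    have := energy_le_of_linear_bound hf.continuous hmono (hK0 _) (hKf (√Real.pi * ‖y‖)) le_rfl
    rw [growthRadius_sq hK0]
    linarith
  have hρmono : ∀ {r r' : ℝ}, 0 ≤ r → r ≤ r' → growthRadius K r ≤ growthRadius K r' :=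
    fun hr hrr => hrr.eq_or_lt.elim (fun h => h ▸ le_rfl) fun h => (growthRadius_lt hKm hK0 hr h).le
  have hBpos := growthRadius_nonneg (K := K) hB0
  have hxpos := growthRadius_nonneg (K := K) (norm_nonneg x)
  -- M bounds the energy on the ball of radius B, so above this level ‖s‖ > B ≥ 2‖g‖ for the force
  -- g.
  set M : ℝ := growthRadius K B ^ 2 / 2 with hM
  have hgt : ∀ τ, M < V τ → B < ‖s τ‖ := fun τ hτ => by
    by_contra hc
    have h1 := pow_le_pow_left₀ (growthRadius_nonneg (K := K) (norm_nonneg (s τ)))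
      (hρmono (norm_nonneg _) (not_lt.1 hc)) 2
    linarith [hup (s τ)]
  have hq' : ∀ τ, M < V τ → q τ ≤ -(‖s τ‖ ^ 2 / 4) := fun τ hτ => by
    have h1 := hgt τ hτ
    have h2 := dissipation_le_sub (b := ‖forcing hσ hm hm1 u τ‖) (norm_nonneg (s τ))
    have h3 : ‖forcing hσ hm hm1 u τ‖ ≤ ‖s τ‖ / 2 := by linarith [hg τ]
    have h4 := pow_le_pow_left₀ (norm_nonneg _) h3 2
    simp only [hq]
    nlinarith [sq_nonneg ‖s τ‖]
  rcases le_or_gt (V t) M with hle | hlt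
  · have h1 : ‖s t‖ ^ 2 ≤ growthRadius K B ^ 2 := by linarith [hlow t]
    have h2 := le_of_sq_le_sq h1 hBpos
    have h3 : s t = φ t x u := by simp only [hs, Real.toNNReal_coe]
    rw [h3] at h2
    have h4 : 0 ≤ growthRadius K ‖x‖ * Real.exp (-(decayRate K ‖x‖ * t / 2)) := by positivity
    linarith
  · have habove := lt_of_sub_le_integral hVc hqc hVq
      (fun τ _ hτ => (hq' τ hτ).trans (by linarith [sq_nonneg ‖s τ‖])) hlt
    have hV0 : ∀ τ ∈ Icc (0 : ℝ) t, V τ ≤ V 0 := fun τ hτ => by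
      have h1 := hVq 0 τ le_rfl hτ.1
      have h2 : ∫ τ in (0 : ℝ)..τ, q τ ≤ ∫ τ in (0 : ℝ)..τ, (0 : ℝ) :=
        intervalIntegral.integral_mono_on hτ.1 (hqc.intervalIntegrable _ _)
          intervalIntegrable_const fun r hr =>
            (hq' r (habove r ⟨hr.1, hr.2.trans hτ.2⟩)).trans (by linarith [sq_nonneg ‖s r‖])
      rw [intervalIntegral.integral_zero] at h2
      linarith
    have hV0x : V 0 ≤ growthRadius K ‖x‖ ^ 2 / 2 := by
      simp only [hV, hs0]
      exact hup x
    -- As V does not exceed its initial value, ‖s‖ stays below `growthRadius K ‖x‖`, which fixes one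
    -- constant C of the bound V ≤ (1/2 + C)‖s‖². The rate 1/(2 + 4C) is then what turns the decay
    -- -‖s‖²/4 into a multiple of V.
    have hqV : ∀ τ ∈ Icc (0 : ℝ) t, q τ ≤ -decayRate K ‖x‖ * V τ := fun τ hτ => by
      have h1 : ‖s τ‖ ≤ growthRadius K ‖x‖ :=
        le_of_sq_le_sq (by linarith [hlow τ, hV0 τ hτ]) hxpos
      have h2 := energy_le_of_linear_bound hf.continuous hmono
        (hK0 (√Real.pi * growthRadius K ‖x‖)) (hKf _)
        (mul_le_mul_of_nonneg_left h1 (Real.sqrt_nonneg Real.pi))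
      have h3 := hq' τ (habove τ hτ)
      have h4 : decayRate K ‖x‖ * V τ ≤ ‖s τ‖ ^ 2 / 4 := by
        rw [decayRate, inv_mul_le_iff₀ (by linarith [hK0 (√Real.pi * growthRadius K ‖x‖)])]
        refine h2.trans_eq ?_
        ring
      linarith
    have hexp := le_mul_exp_of_sub_le_integral hVc.continuousOn hqc
      (fun r t' hr hrt _ => hVq r t' hr hrt) hqV t ⟨t.2, le_rfl⟩
    rw [sub_zero] at hexp
    have h1 : ‖s t‖ ^ 2 ≤
        (growthRadius K ‖x‖ * Real.exp (-(decayRate K ‖x‖ * t / 2))) ^ 2 := by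
      have h2 : Real.exp (-decayRate K ‖x‖ * t) =
          Real.exp (-(decayRate K ‖x‖ * t / 2)) ^ 2 := by
        rw [← Real.exp_nat_mul]; congr 1; push_cast; ring
      have h3 := mul_le_mul_of_nonneg_right hV0x (Real.exp_pos (-decayRate K ‖x‖ * t)).le
      rw [mul_pow, ← h2]
      linarith [hlow t]
    have h2 := le_of_sq_le_sq h1 (by positivity)
    have h3 : s t = φ t x u := by simp only [hs, Real.toNNReal_coe]
    rw [h3] at h2
    linarith

theorem isISS (h : IsSolutionMap hf hσ hm hm1 φ) (hmono : Monotone f) (h0 : f 0 = 0) :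
    IsISS φ := by
  obtain ⟨K, hKc, hKm, hK0, hKf⟩ := hf.exists_continuous_linear_bound h0
  refine ⟨decayBound K, issGain K m, isClassKL_decayBound hKc hKm hK0,
    isClassK_issGain hKc hKm hK0 hm, fun x u hu t => ?_⟩
  rw [← NNReal.coe_le_coe, NNReal.coe_add, coe_decayBound, coe_issGain, coe_nnnorm, coe_nnnorm]
  exact h.norm_le hmono h0 hKm hK0 hKf x hu t

end IsSolutionMap

end

theorem mainTheorem9 (f : ℝ → ℝ) (hf_lip : LocallyLipschitz f) (hf_mono : Monotone f)
    (hf_odd : ∀ r, f (-r) = -f r) (m : ℝ) (hm_pos : 0 < m) (hm_le : m ≤ 1)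
    (σ : ℝ) (hσ : σ = 1 ∨ σ = -1) :
    ∃ φ : ℝ≥0 → H10 → C(ℝ≥0, L2pi) → H10,
      -- `φ` is the solution map of the equation: solutions exist globally and are unique
      (∀ s₀ u, IsWeakSolution f σ m ⊤ s₀ u (fun t => φ t s₀ u)) ∧
      (∀ T s₀ u s, IsWeakSolution f σ m T s₀ u s →
        ∀ t : ℝ≥0, (t : ℝ≥0∞) < T → s t = φ t s₀ u) ∧
      IsControlSystem φ ∧
      IsISS φ ∧
      ∀ a : ℝ≥0, 1 < a →
        IsISSLyapunovFunction φ (energy f) (gain a m) ∧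
        ∀ (s₀ : H10) (u : C(ℝ≥0, L2pi)), gain a m ‖u 0‖₊ ≤ ‖s₀‖₊ →
          lieDeriv φ (energy f) s₀ u ≤ (((1 / (a : ℝ) - 1) * ‖s₀‖ ^ 2 : ℝ) : EReal) := by
  have h0 : f 0 = 0 := by
    have := hf_odd 0
    rw [neg_zero] at this
    linarith
  obtain ⟨φ, h⟩ := exists_isSolutionMap hf_lip hf_mono h0 hσ hm_pos hm_le
  exact ⟨φ, h.isWeakSolution, fun T s₀ u s hs t ht => h.eq_of_isWeakSolution hs ht,
    h.isControlSystem, h.isISS hf_mono h0, fun a ha => ⟨h.isISSLyapunovFunction hf_mono h0 ha,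
      fun s₀ u hx => h.lieDeriv_le_of_gain_le hf_mono h0 ha s₀ u hx⟩⟩
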